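/- Let $N\ge 1$, $0<\beta<1$, $1<q<\infty$ and $\frac1q+\frac1{q'}=1$; all spaces are real. For a bounded open set $\Omega\subset\mathbb{R}^N$, $0<s\le 1$ and $1\le p<\infty$, let $\mathcal{D}^{s,p}_0(\Omega)$ be the completion of $C_0^\infty(\Omega)$ with respect to the norm $$\|\psi\|_{\mathcal{D}^{s,p}_0(\Omega)}=\Big(\int_{\mathbb{R}^N}\int_{\mathbb{R}^N}\frac{|\psi(x)-\psi(y)|^p}{|x-y|^{N+sp}}\,dx\,dy\Big)^{1/p}\ \ (0<s<1),\qquad \|\psi\|_{\mathcal{D}^{1,p}_0(\Omega)}=\|\nabla\psi\|_{L^p(\mathbb{R}^N)}\ \ (s=1).$$ By Poincaré's inequality the identity of $C_0^\infty(\Omega)$ extends to a continuous map $\mathcal{D}^{s,p}_0(\Omega)\to L^p(\Omega)$. For $1<p<\infty$, $\frac1p+\frac1{p'}=1$, let $\mathcal{D}^{-s,p'}(\Omega)=(\mathcal{D}^{s,p}_0(\Omega))^*$ be the topological dual, with the dual norm; $f\in L^{p'}(\Omega)$ is regarded as the functional $u\mapsto\int_\Omega f u\,dx$ on $\mathcal{D}^{s,p}_0(\Omega)$.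 For a compatible couple $(X,Y)$ of Banach spaces, $0<\alpha<1$ and $1<p<\infty$, let $K(t,u,X,Y)=\inf\{\|u_1\|_X+t\,\|u_2\|_Y:\ u=u_1+u_2,\ u_1\in X,\ u_2\in Y\}$ and let $(X,Y)_{\alpha,p}$ be the space of all $u\in X+Y$ for which $$\|u\|_{(X,Y)_{\alpha,p}}=\Big(\int_0^{\infty}t^{-\alpha p}\,K(t,u,X,Y)^p\,\frac{dt}{t}\Big)^{1/p}<\infty .$$ Then there is a constant $C=C(N,\beta,q)>0$ such that, for every open ball $B\subset\mathbb{R}^N$ (of any centre and any radius), the following holds. The pairs $(\mathcal{D}^{-1,q}(B),L^q(B))$ and $(L^{q'}(B),\mathcal{D}^{1,q'}_0(B))$ are compatible couples under the maps above (these maps are injective); as subspaces of $L^{q'}(B)$, $$\big(\mathcal{D}^{1,q'}_0(B),L^{q'}(B)\big)_{\beta,q'}=\big(L^{q'}(B),\mathcal{D}^{1,q'}_0(B)\big)_{1-\beta,q'}=\mathcal{D}^{1-\beta,q'}_0(B);$$ and, all functionals being identified with their restrictions to $C_0^\infty(B)$ (which determine them), $$\big(\mathcal{D}^{-1,q}(B),L^{q}(B)\big)_{\beta,q}=\Big(\big(\mathcal{D}^{1,q'}_0(B),L^{q'}(B)\big)_{\beta,q'}\Big)^*=\Big(\big(L^{q'}(B),\mathcal{D}^{1,q'}_0(B)\big)_{1-\beta,q'}\Big)^*=\big(\mathcal{D}^{1-\beta,q'}_0(B)\big)^*=\mathcal{D}^{\beta-1,q}(B).$$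 In each of these identities the two sides have the same elements and equivalent norms, each norm being at most $C$ times the other. In particular $(\mathcal{D}^{-1,q}(B),L^q(B))_{\beta,q}=\mathcal{D}^{\beta-1,q}(B)$ with equivalent norms, with the same constant $C$. -/

import Mathlib

open MeasureTheory Set TopologicalSpace
open scoped ENNReal NNReal

namespace RealInterpolation

section KMethod

variable {X Y Z W : Type*} [NormedAddCommGroup X] [NormedSpace ℝ X]
  [NormedAddCommGroup Y] [NormedSpace ℝ Y] [NormedAddCommGroup Z] [NormedSpace ℝ Z]
  [AddCommGroup W] [Module ℝ W]

/-- `X` and `Y`, mapped continuously and linearly into a common ambient space `Z` by `i` and `j`,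
form a compatible couple: both maps are embeddings. -/
def IsCompatibleCouple (i : X →L[ℝ] Z) (j : Y →L[ℝ] Z) : Prop :=
  Function.Injective i ∧ Function.Injective j

/-- The functional `K(t, z, X, Y) = inf {‖x‖ + t ‖y‖ : z = x + y}`; it is `∞` when `z` is not
in `X + Y`. -/
noncomputable def kFunctional (i : X →L[ℝ] Z) (j : Y →L[ℝ] Z) (t : ℝ) (z : Z) : ℝ≥0∞ :=
  ⨅ (x : X) (y : Y) (_ : i x + j y = z), (‖x‖ₑ + ENNReal.ofReal t * ‖y‖ₑ)

/-- `(∫₀^∞ t ^ (-α q) K(t, z, X, Y) ^ q dt / t) ^ (1 / q)`, with values in `[0, ∞]`. -/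
noncomputable def interpENorm (i : X →L[ℝ] Z) (j : Y →L[ℝ] Z) (α : ℝ) (q : ℝ≥0) (z : Z) :
    ℝ≥0∞ :=
  (∫⁻ t in Ioi (0 : ℝ), ENNReal.ofReal (t ^ (-(α * q))) * kFunctional i j t z ^ (q : ℝ)
    / ENNReal.ofReal t) ^ (1 / (q : ℝ))

variable (i : X →L[ℝ] Z) (j : Y →L[ℝ] Z)

theorem kFunctional_mono (z : Z) : Monotone fun t : ℝ => kFunctional i j t z := by
  intro s t hst
  refine iInf_mono fun x => iInf_mono fun y => iInf_mono fun _ => ?_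
  have := ENNReal.ofReal_le_ofReal hst
  gcongr

theorem kFunctional_le (t : ℝ) {z : Z} (x : X) (y : Y) (h : i x + j y = z) :
    kFunctional i j t z ≤ ‖x‖ₑ + ENNReal.ofReal t * ‖y‖ₑ :=
  iInf_le_of_le x <| iInf_le_of_le y <| iInf_le _ h

theorem kFunctional_add (t : ℝ) (z w : Z) :
    kFunctional i j t (z + w) ≤ kFunctional i j t z + kFunctional i j t w := by
  unfold kFunctional
  simp only [ENNReal.iInf_add, ENNReal.add_iInf]
  refine le_iInf fun x => le_iInf fun y => le_iInf fun h => ?_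
  refine le_iInf fun x' => le_iInf fun y' => le_iInf fun h' => ?_
  refine (iInf_le_of_le (x' + x) <| iInf_le_of_le (y' + y) <| iInf_le _ ?_).trans ?_
  · rw [map_add, map_add, ← h, ← h']; abel
  · calc _ ≤ (‖x'‖ₑ + ‖x‖ₑ) + ENNReal.ofReal t * (‖y'‖ₑ + ‖y‖ₑ) := by
          gcongr <;> exact enorm_add_le _ _
      _ = _ := by ring

theorem kFunctional_smul_le (t : ℝ) (c : ℝ) (z : Z) :
    kFunctional i j t (c • z) ≤ ‖c‖ₑ * kFunctional i j t z := by
  by_cases hc : c = 0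
  · subst hc
    have := kFunctional_le i j t (z := (0 : ℝ) • z) 0 0 (by simp)
    simpa using this
  unfold kFunctional
  have hc' : ‖c‖ₑ ≠ 0 := by simpa using hc
  simp only [ENNReal.mul_iInf_of_ne hc' (by simp)]
  refine le_iInf fun x => le_iInf fun y => le_iInf fun h => ?_
  refine (iInf_le_of_le (c • x) <| iInf_le_of_le (c • y) <| iInf_le _ ?_).trans ?_
  · simp [← h]
  · rw [enorm_smul, enorm_smul]; exact le_of_eq (by ring)

theorem enorm_le_kFunctional (t : ℝ) (ht : 0 < t) :
    ∃ C : ℝ≥0, ∀ z : Z, ‖z‖ₑ ≤ C * kFunctional i j t z := by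
  have hn : ENNReal.ofReal t ≠ 0 := by simpa using ht
  set C : ℝ≥0 := ‖i‖₊ + ‖j‖₊ * (Real.toNNReal t)⁻¹ + 1 with hC
  refine ⟨C, fun z => ?_⟩
  unfold kFunctional
  have hc' : (C : ℝ≥0∞) ≠ 0 := by
    rw [hC]; simp
  simp only [ENNReal.mul_iInf_of_ne hc' (by simp)]
  refine le_iInf fun x => le_iInf fun y => le_iInf fun h => ?_
  have h1 : ‖i x‖ₑ ≤ ‖i‖ₑ * ‖x‖ₑ := i.le_opENorm x
  have h2 : ‖j y‖ₑ ≤ ‖j‖ₑ * ‖y‖ₑ := j.le_opENorm y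
  have e1 : (‖i‖ₑ : ℝ≥0∞) ≤ C := by
    rw [enorm_eq_nnnorm]; norm_cast
    rw [hC, add_assoc]; exact le_self_add
  have e2 : (‖j‖ₑ : ℝ≥0∞) ≤ C * ENNReal.ofReal t := by
    rw [enorm_eq_nnnorm, ENNReal.ofReal]; norm_cast
    have ht' : Real.toNNReal t ≠ 0 := by simpa using ht
    calc ‖j‖₊ = ‖j‖₊ * (Real.toNNReal t)⁻¹ * Real.toNNReal t := by
          rw [mul_assoc, inv_mul_cancel₀ ht', mul_one]
      _ ≤ C * Real.toNNReal t := by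
          gcongr
          rw [hC, add_right_comm]; exact le_add_self
  calc ‖z‖ₑ ≤ ‖i x‖ₑ + ‖j y‖ₑ := by rw [← h]; exact enorm_add_le _ _
    _ ≤ C * ‖x‖ₑ + (C * ENNReal.ofReal t) * ‖y‖ₑ :=
        add_le_add (h1.trans (by gcongr)) (h2.trans (by gcongr))
    _ = _ := by ring

variable (α : ℝ) (q : ℝ≥0)

theorem interpENorm_eq (hq : 1 ≤ q) (z : Z) :
    interpENorm i j α q z = (∫⁻ t in Ioi (0 : ℝ),
      (ENNReal.ofReal (t ^ (-α - 1 / (q : ℝ))) * kFunctional i j t z) ^ (q : ℝ))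
        ^ (1 / (q : ℝ)) := by
  have hq0 : (0 : ℝ) < q := lt_of_lt_of_le one_pos (by exact_mod_cast hq)
  unfold interpENorm
  congr 1
  refine setLIntegral_congr_fun measurableSet_Ioi fun t ht => ?_
  have ht : 0 < t := ht
  rw [ENNReal.mul_rpow_of_nonneg _ _ hq0.le, ENNReal.ofReal_rpow_of_nonneg (by positivity) hq0.le,
    ← Real.rpow_mul ht.le, ENNReal.mul_div_right_comm, ← ENNReal.ofReal_div_of_pos ht]
  congr 2
  rw [sub_mul, one_div, inv_mul_cancel₀ hq0.ne', Real.rpow_sub_one ht.ne', neg_mul]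

theorem interpENorm_add (hq : 1 ≤ q) (z w : Z) :
    interpENorm i j α q (z + w) ≤ interpENorm i j α q z + interpENorm i j α q w := by
  have hq1 : (1 : ℝ) ≤ q := by exact_mod_cast hq
  rw [interpENorm_eq i j α q hq, interpENorm_eq i j α q hq, interpENorm_eq i j α q hq]
  have hm : ∀ z : Z, AEMeasurable (fun t : ℝ => ENNReal.ofReal (t ^ (-α - 1 / (q : ℝ))) *
      kFunctional i j t z) (volume.restrict (Ioi 0)) := fun z =>
    ((ENNReal.measurable_ofReal.comp (by fun_prop)).mul
      (kFunctional_mono i j z).measurable).aemeasurable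
  refine le_trans ?_ (ENNReal.lintegral_Lp_add_le (hm z) (hm w) hq1)
  gcongr with t
  rw [Pi.add_apply, ← mul_add]
  gcongr
  exact kFunctional_add i j t z w

theorem interpENorm_smul_le (hq : 1 ≤ q) (c : ℝ) (z : Z) :
    interpENorm i j α q (c • z) ≤ ‖c‖ₑ * interpENorm i j α q z := by
  have hq0 : (0 : ℝ) < q := lt_of_lt_of_le one_pos (by exact_mod_cast hq)
  rw [interpENorm_eq i j α q hq, interpENorm_eq i j α q hq]
  calc _ ≤ (∫⁻ t in Ioi (0 : ℝ), ‖c‖ₑ ^ (q : ℝ) *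
      (ENNReal.ofReal (t ^ (-α - 1 / (q : ℝ))) * kFunctional i j t z) ^ (q : ℝ))
        ^ (1 / (q : ℝ)) := by
        refine ENNReal.rpow_le_rpow (lintegral_mono fun t => ?_) (by positivity)
        rw [← ENNReal.mul_rpow_of_nonneg _ _ hq0.le, mul_left_comm]
        gcongr
        exact kFunctional_smul_le i j t c z
    _ = _ := by
        rw [lintegral_const_mul' _ _ (by simp),
          ENNReal.mul_rpow_of_nonneg _ _ (by positivity), ← ENNReal.rpow_mul,
          mul_one_div_cancel hq0.ne', ENNReal.rpow_one]

theorem interpENorm_zero (hq : 1 ≤ q) : interpENorm i j α q 0 = 0 := by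
  have := interpENorm_smul_le i j α q hq 0 0
  simpa using this

theorem eq_zero_of_interpENorm_eq_zero (hq : 1 ≤ q) {z : Z} (h : interpENorm i j α q z = 0) :
    z = 0 := by
  have hq0 : (0 : ℝ) < q := lt_of_lt_of_le one_pos (by exact_mod_cast hq)
  have hm : Measurable fun t : ℝ => (ENNReal.ofReal (t ^ (-α - 1 / (q : ℝ))) *
      kFunctional i j t z) ^ (q : ℝ) :=
    ((ENNReal.measurable_ofReal.comp (by fun_prop)).mul
      (kFunctional_mono i j z).measurable).pow_const _
  rw [interpENorm_eq i j α q hq, ENNReal.rpow_eq_zero_iff_of_pos (by positivity),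
    lintegral_eq_zero_iff hm,
      Filter.EventuallyEq, ae_restrict_iff' measurableSet_Ioi] at h
  have hne : ∃ t : ℝ, 0 < t ∧ kFunctional i j t z = 0 := by
    by_contra! hcon
    have hv : volume (Ioi (0 : ℝ)) = 0 := by
      refine measure_mono_null (fun t ht => ?_) h
      have ht : 0 < t := ht
      simp only [mem_compl_iff, mem_ofPred_eq, Classical.not_imp]
      refine ⟨ht, ?_⟩
      simp only [Pi.zero_apply, ENNReal.rpow_eq_zero_iff_of_pos hq0, mul_eq_zero, not_or]
      refine ⟨?_, hcon t ht⟩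
      simpa using Real.rpow_pos_of_pos ht _
    simp at hv
  obtain ⟨t, ht, hK⟩ := hne
  obtain ⟨C, hC⟩ := enorm_le_kFunctional i j t ht
  have := hC z
  rw [hK, mul_zero] at this
  simpa using this

/-- The carrier of the interpolation space `(X, Y)_{α, q}`, as a linear subspace of `Z`. -/
def interpSubmodule [hq : Fact (1 ≤ q)] : Submodule ℝ Z where
  carrier := {z | (∃ x y, i x + j y = z) ∧ interpENorm i j α q z < ∞}
  zero_mem' := ⟨⟨0, 0, by simp⟩, by simp [interpENorm_zero i j α q hq.out]⟩
  add_mem' := by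
    rintro z w ⟨⟨x, y, h⟩, hz⟩ ⟨⟨x', y', h'⟩, hw⟩
    refine ⟨⟨x + x', y + y', ?_⟩,
      (interpENorm_add i j α q hq.out z w).trans_lt (ENNReal.add_lt_top.2 ⟨hz, hw⟩)⟩
    rw [map_add, map_add, ← h, ← h']; abel
  smul_mem' := by
    rintro c z ⟨⟨x, y, h⟩, hz⟩
    exact ⟨⟨c • x, c • y, by simp [← h]⟩,
      (interpENorm_smul_le i j α q hq.out c z).trans_lt (ENNReal.mul_lt_top (by simp) hz)⟩

/-- The real interpolation space `(X, Y)_{α, q}` of the `K`-method. It is a separate type because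
it carries the interpolation norm, not the norm of the ambient space `Z`. -/
def RealInterp [Fact (1 ≤ q)] : Type _ := interpSubmodule i j α q

namespace RealInterp

variable [hq : Fact (1 ≤ q)]

instance : AddCommGroup (RealInterp i j α q) :=
  inferInstanceAs (AddCommGroup (interpSubmodule i j α q))

instance : Module ℝ (RealInterp i j α q) :=
  inferInstanceAs (Module ℝ (interpSubmodule i j α q))

/-- The inclusion of `(X, Y)_{α, q}` in the ambient space. -/
def subtype : RealInterp i j α q →ₗ[ℝ] Z := (interpSubmodule i j α q).subtype

theorem subtype_injective : Function.Injective (subtype i j α q) := Subtype.val_injective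

theorem interpENorm_lt_top (z : RealInterp i j α q) :
    interpENorm i j α q (subtype i j α q z) < ∞ := z.2.2

/-- The norm `‖z‖ = (∫₀^∞ t ^ (-α q) K(t, z) ^ q dt / t) ^ (1 / q)`. -/
noncomputable instance : NormedAddCommGroup (RealInterp i j α q) :=
  AddGroupNorm.toNormedAddCommGroup
    { toFun := fun z => (interpENorm i j α q (subtype i j α q z)).toReal
      map_zero' := by simp [interpENorm_zero i j α q hq.out]
      add_le' := fun z w => by
        rw [← ENNReal.toReal_add (interpENorm_lt_top i j α q z).ne
          (interpENorm_lt_top i j α q w).ne, map_add]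
        exact ENNReal.toReal_mono (ENNReal.add_ne_top.2 ⟨(interpENorm_lt_top i j α q z).ne,
          (interpENorm_lt_top i j α q w).ne⟩) (interpENorm_add i j α q hq.out _ _)
      neg' := fun z => by
        have key : ∀ w : Z, interpENorm i j α q (-w) ≤ interpENorm i j α q w := fun w => by
          simpa using interpENorm_smul_le i j α q hq.out (-1) w
        rw [map_neg]
        congr 1
        refine le_antisymm (key _) ?_
        simpa using key (-(subtype i j α q z))
      eq_zero_of_map_eq_zero' := fun z hz => by
        have h := ((ENNReal.toReal_eq_zero_iff _).1 hz).resolve_right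
          (interpENorm_lt_top i j α q z).ne
        exact subtype_injective i j α q
          (by rw [map_zero]; exact eq_zero_of_interpENorm_eq_zero i j α q hq.out h) }

theorem norm_def (z : RealInterp i j α q) :
    ‖z‖ = (interpENorm i j α q (subtype i j α q z)).toReal := rfl

noncomputable instance : NormedSpace ℝ (RealInterp i j α q) where
  norm_smul_le c z := by
    rw [norm_def, norm_def, map_smul]
    refine (ENNReal.toReal_mono (ENNReal.mul_ne_top (by simp)
      (interpENorm_lt_top i j α q z).ne) (interpENorm_smul_le i j α q hq.out c _)).trans ?_
    rw [ENNReal.toReal_mul]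
    simp

end RealInterp

theorem interpENorm_lt_top_of_mem_both (hq : 1 ≤ q) (hα : α ∈ Ioo (0 : ℝ) 1) {x : X} {y : Y}
    (h : i x = j y) : interpENorm i j α q (i x) < ∞ := by
  have hq0 : (0 : ℝ) < q := lt_of_lt_of_le one_pos (by exact_mod_cast hq)
  have k1 : ∀ t, kFunctional i j t (i x) ≤ ENNReal.ofReal ‖x‖ := fun t => by
    simpa using kFunctional_le i j t x 0 (by simp)
  have k2 : ∀ t, kFunctional i j t (i x) ≤ ENNReal.ofReal t * ENNReal.ofReal ‖y‖ := fun t => by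
    simpa using kFunctional_le i j t 0 y (by simp [h])
  unfold interpENorm
  refine ENNReal.rpow_lt_top_of_nonneg (by positivity) (ne_of_lt ?_)
  rw [← Ioc_union_Ioi_eq_Ioi (zero_le_one' ℝ)]
  refine (lintegral_union_le _ _ _).trans_lt (ENNReal.add_lt_top.2 ⟨?_, ?_⟩)
  · have hint : IntegrableOn (fun t : ℝ => ‖y‖ ^ (q : ℝ) * t ^ ((1 - α) * q - 1)) (Ioc 0 1) := by
      refine Integrable.const_mul ?_ _
      rw [← IntegrableOn, integrableOn_Ioc_iff_integrableOn_Ioo,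
        intervalIntegral.integrableOn_Ioo_rpow_iff one_pos]
      have := mul_pos (sub_pos.2 hα.2) hq0
      linarith
    refine lt_of_le_of_lt ?_ hint.lintegral_lt_top
    refine setLIntegral_mono' measurableSet_Ioc fun t ht => ?_
    have ht0 : 0 < t := ht.1
    calc _ ≤ ENNReal.ofReal (t ^ (-(α * q))) * (ENNReal.ofReal t * ENNReal.ofReal ‖y‖) ^ (q : ℝ)
            / ENNReal.ofReal t := by gcongr; exact k2 t
      _ = _ := by
        rw [← ENNReal.ofReal_mul ht0.le, ENNReal.ofReal_rpow_of_nonneg (by positivity) hq0.le,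
          ← ENNReal.ofReal_mul (by positivity), ← ENNReal.ofReal_div_of_pos ht0,
          Real.mul_rpow ht0.le (norm_nonneg _)]
        congr 1
        rw [show (1 - α) * (q : ℝ) - 1 = -(α * q) + q - 1 by ring, Real.rpow_sub_one ht0.ne',
          Real.rpow_add ht0]
        ring
  · have hint : IntegrableOn (fun t : ℝ => ‖x‖ ^ (q : ℝ) * t ^ (-(α * q) - 1)) (Ioi 1) := by
      refine Integrable.const_mul ?_ _
      refine integrableOn_Ioi_rpow_of_lt ?_ one_pos
      have := mul_pos hα.1 hq0
      linarith
    refine lt_of_le_of_lt ?_ hint.lintegral_lt_top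
    refine setLIntegral_mono' measurableSet_Ioi fun t ht => ?_
    have ht0 : 0 < t := lt_trans one_pos ht
    calc _ ≤ ENNReal.ofReal (t ^ (-(α * q))) * (ENNReal.ofReal ‖x‖) ^ (q : ℝ)
            / ENNReal.ofReal t := by gcongr; exact k1 t
      _ = _ := by
        rw [ENNReal.ofReal_rpow_of_nonneg (by positivity) hq0.le,
          ← ENNReal.ofReal_mul (by positivity), ← ENNReal.ofReal_div_of_pos ht0,
          Real.rpow_sub_one ht0.ne']
        congr 1
        ring

/-- Elements lying both in `X` and in `Y`, as elements of `(X, Y)_{α, q}`. -/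
def RealInterp.ofBoth [hq : Fact (1 ≤ q)] (hα : α ∈ Ioo (0 : ℝ) 1) (f : W →ₗ[ℝ] X)
    (g : W →ₗ[ℝ] Y) (hfg : ∀ w, i (f w) = j (g w)) : W →ₗ[ℝ] RealInterp i j α q :=
  (i.toLinearMap ∘ₗ f).codRestrict (interpSubmodule i j α q) fun w =>
    ⟨⟨f w, 0, by simp⟩, interpENorm_lt_top_of_mem_both i j α q hq.out hα (hfg w)⟩

/-- Two normed spaces `X` and `Y`, seen as linear subspaces of `V` by means of `r` and `r'`,
coincide, and each norm is at most `C` times the other. -/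
def EqWithEquivalentNorms (C : ℝ) (r : X →ₗ[ℝ] W) (r' : Y →ₗ[ℝ] W) : Prop :=
  Function.Injective r ∧ Function.Injective r' ∧ LinearMap.range r = LinearMap.range r' ∧
    ∀ x y, r x = r' y → ‖x‖ ≤ C * ‖y‖ ∧ ‖y‖ ≤ C * ‖x‖

/-- Restriction of a continuous linear functional on `X` along a linear map `ι : W → X`. -/
def dualRestrict (ι : W →ₗ[ℝ] X) : StrongDual ℝ X →ₗ[ℝ] (W →ₗ[ℝ] ℝ) where
  toFun F := F.toLinearMap ∘ₗ ι
  map_add' _ _ := rfl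
  map_smul' _ _ := rfl

end KMethod

end RealInterpolation


namespace HomSobolev

/-- `ℝ^N` with the Euclidean norm. -/
abbrev Euc (N : ℕ) := EuclideanSpace ℝ (Fin N)

/-- `C_0^∞(Ω)`: smooth functions on `ℝ^N` with compact support contained in `Ω`. -/
abbrev Test {N : ℕ} (Ω : Opens (Euc N)) := TestFunction Ω ℝ ⊤

variable {N : ℕ}

instance {p : ℝ≥0} [hp : Fact (1 ≤ p)] : Fact (1 ≤ (p : ℝ≥0∞)) := ⟨by exact_mod_cast hp.out⟩

/-- The Gagliardo seminorm
`(∫ ∫ |ψ x - ψ y| ^ p / |x - y| ^ (N + s p) dx dy) ^ (1 / p)` on `ℝ^N`. -/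
noncomputable def gagliardo (s : ℝ) (p : ℝ≥0) (ψ : Euc N → ℝ) : ℝ≥0∞ :=
  (∫⁻ x, ∫⁻ y, ‖ψ x - ψ y‖ₑ ^ (p : ℝ) / ‖x - y‖ₑ ^ ((N : ℝ) + s * p)) ^ (1 / (p : ℝ))

/-- The homogeneous norm of order `s ∈ (0, 1]`: the Gagliardo seminorm on `ℝ^N` if `s < 1`, the
`L^p` norm of the gradient on `ℝ^N` if `s = 1`. -/
noncomputable def homENorm (s : ℝ) (p : ℝ≥0) (ψ : Euc N → ℝ) : ℝ≥0∞ :=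
  if s = 1 then eLpNorm (fun x => fderiv ℝ ψ x) p volume else gagliardo s p ψ

section Gagliardo

variable {s : ℝ} {p : ℝ≥0}

theorem gagliardo_eq (hp : 1 ≤ p) {ψ : Euc N → ℝ} (hψ : Continuous ψ) :
    gagliardo s p ψ = (∫⁻ z : Euc N × Euc N,
      (‖ψ z.1 - ψ z.2‖ₑ / ‖z.1 - z.2‖ₑ ^ (((N : ℝ) + s * p) / p)) ^ (p : ℝ))
        ^ (1 / (p : ℝ)) := by
  have hp0 : (0 : ℝ) < p := lt_of_lt_of_le one_pos (by exact_mod_cast hp)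
  unfold gagliardo
  rw [Measure.volume_eq_prod, lintegral_prod]
  · congr 1
    refine lintegral_congr fun x => lintegral_congr fun y => ?_
    rw [ENNReal.div_rpow_of_nonneg _ _ hp0.le, ← ENNReal.rpow_mul, div_mul_cancel₀ _ hp0.ne']
  · have h1 : Measurable fun z : Euc N × Euc N => ψ z.1 - ψ z.2 := by
      have := hψ.measurable
      fun_prop
    fun_prop

theorem gagliardo_add (hp : 1 ≤ p) {ψ φ : Euc N → ℝ} (hψ : Continuous ψ) (hφ : Continuous φ) :
    gagliardo s p (ψ + φ) ≤ gagliardo s p ψ + gagliardo s p φ := by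
  have hp1 : (1 : ℝ) ≤ p := by exact_mod_cast hp
  rw [gagliardo_eq hp hψ, gagliardo_eq hp hφ, gagliardo_eq hp (hψ.add hφ)]
  have hm : ∀ {ψ : Euc N → ℝ}, Continuous ψ → AEMeasurable (fun z : Euc N × Euc N =>
      ‖ψ z.1 - ψ z.2‖ₑ / ‖z.1 - z.2‖ₑ ^ (((N : ℝ) + s * p) / p)) := fun {ψ} hψ => by
    have h1 : Measurable fun z : Euc N × Euc N => ψ z.1 - ψ z.2 := by
      have := hψ.measurable
      fun_prop
    fun_prop
  refine le_trans ?_ (ENNReal.lintegral_Lp_add_le (hm hψ) (hm hφ) hp1)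
  refine ENNReal.rpow_le_rpow (lintegral_mono fun z => ?_) (by positivity)
  refine ENNReal.rpow_le_rpow ?_ p.2
  simp only [Pi.add_apply]
  rw [← ENNReal.add_div, add_sub_add_comm]
  gcongr
  exact enorm_add_le _ _

theorem gagliardo_smul (hp : 1 ≤ p) (c : ℝ) (ψ : Euc N → ℝ) :
    gagliardo s p (c • ψ) = ‖c‖ₑ * gagliardo s p ψ := by
  have hp0 : (0 : ℝ) < p := lt_of_lt_of_le one_pos (by exact_mod_cast hp)
  unfold gagliardo
  have h : ∀ x y, ‖(c • ψ) x - (c • ψ) y‖ₑ ^ (p : ℝ) / ‖x - y‖ₑ ^ ((N : ℝ) + s * p) =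
      ‖c‖ₑ ^ (p : ℝ) * (‖ψ x - ψ y‖ₑ ^ (p : ℝ) / ‖x - y‖ₑ ^ ((N : ℝ) + s * p)) := fun x y => by
    rw [Pi.smul_apply, Pi.smul_apply, ← smul_sub, enorm_smul,
      ENNReal.mul_rpow_of_nonneg _ _ hp0.le, mul_div_assoc]
  have hc : ‖c‖ₑ ^ (p : ℝ) ≠ ∞ := by simp
  simp only [h, lintegral_const_mul' _ _ hc]
  rw [ENNReal.mul_rpow_of_nonneg _ _ (by positivity), ← ENNReal.rpow_mul,
    mul_one_div_cancel hp0.ne', ENNReal.rpow_one]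

/-- The radial profile dominating the kernel of the Gagliardo seminorm is integrable. -/
theorem integrable_profile [NeZero N] (hs : s ∈ Ioo (0 : ℝ) 1) (hp : 1 ≤ p) {L M : ℝ}
    (hL : 0 ≤ L) (hM : 0 ≤ M) :
    Integrable (fun h : Euc N => (min (L * ‖h‖) M) ^ (p : ℝ) * ‖h‖ ^ (-((N : ℝ) + s * p))) := by
  have hp0 : (0 : ℝ) < p := lt_of_lt_of_le one_pos (by exact_mod_cast hp)
  have hN : 1 ≤ N := NeZero.one_le
  have : Nontrivial (Euc N) := Module.nontrivial_of_finrank_pos (R := ℝ) (by simp; omega)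
  have := integrable_fun_norm_addHaar (volume : Measure (Euc N))
    (f := fun t : ℝ => (min (L * t) M) ^ (p : ℝ) * t ^ (-((N : ℝ) + s * p)))
  rw [this, ← Ioc_union_Ioi_eq_Ioi (zero_le_one' ℝ)]
  have hmeas : Measurable (fun y : ℝ => y ^ (Module.finrank ℝ (Euc N) - 1) •
      ((min (L * y) M) ^ (p : ℝ) * y ^ (-((N : ℝ) + s * p)))) := by
    fun_prop
  have hnorm : ∀ y : ℝ, 0 < y → ‖y ^ (Module.finrank ℝ (Euc N) - 1) •
      ((min (L * y) M) ^ (p : ℝ) * y ^ (-((N : ℝ) + s * p)))‖ =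
        (min (L * y) M) ^ (p : ℝ) * y ^ (-(s * p) - 1) := fun y hy => by
    have h0 : 0 ≤ min (L * y) M := le_min (by positivity) hM
    rw [Real.norm_of_nonneg (by positivity), smul_eq_mul, finrank_euclideanSpace_fin,
      ← Real.rpow_natCast, mul_left_comm, ← Real.rpow_add hy, Nat.cast_sub hN]
    congr 2
    push_cast; ring
  refine IntegrableOn.union ?_ ?_
  · have hint : IntegrableOn (fun t : ℝ => L ^ (p : ℝ) * t ^ ((1 - s) * p - 1)) (Ioc 0 1) := by
      refine Integrable.const_mul ?_ _
      rw [← IntegrableOn, integrableOn_Ioc_iff_integrableOn_Ioo,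
        intervalIntegral.integrableOn_Ioo_rpow_iff one_pos]
      have := mul_pos (sub_pos.2 hs.2) hp0
      linarith
    refine Integrable.mono' hint hmeas.aestronglyMeasurable ?_
    filter_upwards [ae_restrict_mem measurableSet_Ioc] with y hy
    have hy0 : 0 < y := hy.1
    rw [hnorm y hy0]
    calc _ ≤ (L * y) ^ (p : ℝ) * y ^ (-(s * p) - 1) := by
          gcongr
          exact min_le_left _ _
      _ = _ := by
          rw [Real.mul_rpow hL hy0.le, mul_assoc, ← Real.rpow_add hy0]
          congr 2; ring
  · have hint : IntegrableOn (fun t : ℝ => M ^ (p : ℝ) * t ^ (-(s * p) - 1)) (Ioi 1) := by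
      refine Integrable.const_mul ?_ _
      refine integrableOn_Ioi_rpow_of_lt ?_ one_pos
      have := mul_pos hs.1 hp0
      linarith
    refine Integrable.mono' hint hmeas.aestronglyMeasurable ?_
    filter_upwards [ae_restrict_mem measurableSet_Ioi] with y hy
    have hy0 : 0 < y := lt_trans one_pos hy
    rw [hnorm y hy0]
    gcongr
    exact min_le_right _ _

theorem gagliardo_lt_top (hs : s ∈ Ioo (0 : ℝ) 1) (hp : 1 ≤ p) {ψ : Euc N → ℝ}
    (hψ : ContDiff ℝ 1 ψ) (hc : HasCompactSupport ψ) : gagliardo s p ψ < ∞ := by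
  have hp0 : (0 : ℝ) < p := lt_of_lt_of_le one_pos (by exact_mod_cast hp)
  have hsp : 0 < s * p := mul_pos hs.1 hp0
  unfold gagliardo
  refine ENNReal.rpow_lt_top_of_nonneg (by positivity) (ne_of_lt ?_)
  rcases Nat.eq_zero_or_pos N with rfl | hN
  · have h0 : ∀ x y : Euc 0, ‖ψ x - ψ y‖ₑ ^ (p : ℝ) / ‖x - y‖ₑ ^ (((0 : ℕ) : ℝ) + s * p) = 0 :=
      fun x y => by rw [Subsingleton.elim x y]; simp [hp0]
    simp only [h0, lintegral_zero, ENNReal.zero_lt_top]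
  have : NeZero N := ⟨hN.ne'⟩
  obtain ⟨L, hL⟩ := hψ.lipschitzWith_of_hasCompactSupport hc one_ne_zero
  obtain ⟨M, hM⟩ := hψ.continuous.bounded_above_of_compact_support hc
  have hM0 : 0 ≤ M := (norm_nonneg _).trans (hM 0)
  set k : Euc N → ℝ := fun h =>
    (min (L * ‖h‖) (M + M)) ^ (p : ℝ) * ‖h‖ ^ (-((N : ℝ) + s * p)) with hk
  have hkint : Integrable k := integrable_profile hs hp L.2 (by positivity)
  have hkm : Measurable fun h => ENNReal.ofReal (k h) := by
    rw [hk]; fun_prop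
  have hbound : ∀ x y, ‖ψ x - ψ y‖ₑ ^ (p : ℝ) / ‖x - y‖ₑ ^ ((N : ℝ) + s * p) ≤
      ENNReal.ofReal (k (x - y)) := fun x y => by
    rcases eq_or_ne x y with rfl | hxy
    · simp [hp0]
    have hd : 0 < ‖x - y‖ := norm_pos_iff.2 (sub_ne_zero.2 hxy)
    rw [← ofReal_norm, ← ofReal_norm,
      ENNReal.ofReal_rpow_of_nonneg (norm_nonneg _) hp0.le, ENNReal.ofReal_rpow_of_pos hd,
      ← ENNReal.ofReal_div_of_pos (by positivity)]
    refine ENNReal.ofReal_le_ofReal ?_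
    simp only [hk]
    rw [div_eq_mul_inv, ← Real.rpow_neg hd.le]
    have h1 : ‖ψ x - ψ y‖ ≤ L * ‖x - y‖ := by
      simpa [dist_eq_norm] using hL.dist_le_mul x y
    have h2 : ‖ψ x - ψ y‖ ≤ M + M := (norm_sub_le _ _).trans (add_le_add (hM x) (hM y))
    gcongr
    exact le_min h1 h2
  set K := tsupport ψ
  have hKm : MeasurableSet K := (isClosed_tsupport ψ).measurableSet
  have hsplit : ∀ x y, ‖ψ x - ψ y‖ₑ ^ (p : ℝ) / ‖x - y‖ₑ ^ ((N : ℝ) + s * p) ≤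
      K.indicator 1 x * ENNReal.ofReal (k (x - y)) +
        K.indicator 1 y * ENNReal.ofReal (k (x - y)) := fun x y => by
    by_cases hx : x ∈ K
    · refine le_add_right ?_
      simpa [hx] using hbound x y
    by_cases hy : y ∈ K
    · refine le_add_left ?_
      simpa [hy] using hbound x y
    · simp [image_eq_zero_of_notMem_tsupport hx, image_eq_zero_of_notMem_tsupport hy, hp0]
  have hI : ∫⁻ h, ENNReal.ofReal (k h) < ∞ := hkint.lintegral_lt_top
  have hI1 : ∀ x, ∫⁻ y, ENNReal.ofReal (k (x - y)) = ∫⁻ h, ENNReal.ofReal (k h) := fun x =>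
    lintegral_sub_left_eq_self (fun h => ENNReal.ofReal (k h)) x
  have hI2 : ∀ y, ∫⁻ x, ENNReal.ofReal (k (x - y)) = ∫⁻ h, ENNReal.ofReal (k h) := fun y =>
    lintegral_sub_right_eq_self (fun h => ENNReal.ofReal (k h)) y
  have hKv : ∫⁻ x, K.indicator 1 x * (∫⁻ h, ENNReal.ofReal (k h)) < ∞ := by
    rw [lintegral_mul_const' _ _ hI.ne, lintegral_indicator_one hKm]
    exact ENNReal.mul_lt_top hc.isCompact.measure_lt_top hI
  have hmi : Measurable (K.indicator (1 : Euc N → ℝ≥0∞)) := measurable_one.indicator hKm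
  have hkm2 : Measurable fun z : Euc N × Euc N => ENNReal.ofReal (k (z.1 - z.2)) :=
    hkm.comp (measurable_fst.sub measurable_snd)
  have hkm1 : ∀ x, Measurable fun y => ENNReal.ofReal (k (x - y)) := fun x =>
    hkm.comp (measurable_const.sub measurable_id)
  have hkm3 : ∀ y, Measurable fun x => ENNReal.ofReal (k (x - y)) := fun y =>
    hkm.comp (measurable_id.sub measurable_const)
  calc _ ≤ ∫⁻ x, ∫⁻ y, (K.indicator 1 x * ENNReal.ofReal (k (x - y)) +
        K.indicator 1 y * ENNReal.ofReal (k (x - y))) :=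
        lintegral_mono fun x => lintegral_mono fun y => hsplit x y
    _ = (∫⁻ x, ∫⁻ y, K.indicator 1 x * ENNReal.ofReal (k (x - y))) +
        ∫⁻ x, ∫⁻ y, K.indicator 1 y * ENNReal.ofReal (k (x - y)) := by
        rw [← lintegral_add_left]
        · refine lintegral_congr fun x => ?_
          rw [lintegral_add_left]
          exact (hkm1 x).const_mul _
        · exact Measurable.lintegral_prod_right ((hmi.comp measurable_fst).mul hkm2)
    _ < ∞ := by
        refine ENNReal.add_lt_top.2 ⟨?_, ?_⟩
        · refine lt_of_le_of_lt (lintegral_mono fun x => ?_) hKv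
          rw [lintegral_const_mul _ (hkm1 x), hI1]
        · rw [lintegral_lintegral_swap ((hmi.comp measurable_snd).mul hkm2).aemeasurable]
          refine lt_of_le_of_lt (lintegral_mono fun y => ?_) hKv
          rw [lintegral_const_mul _ (hkm3 y), hI2]

end Gagliardo

section Poincare

variable {s : ℝ} {p : ℝ≥0}

theorem eLpNorm_coe_eq (hp : 1 ≤ p) {F : Type*} [NormedAddCommGroup F] {α : Type*}
    [MeasurableSpace α] (μ : Measure α) (f : α → F) :
    eLpNorm f p μ = (∫⁻ x, ‖f x‖ₑ ^ (p : ℝ) ∂μ) ^ (1 / (p : ℝ)) := by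
  rw [eLpNorm_eq_lintegral_rpow_enorm_toReal (by simpa using (zero_lt_one.trans_le hp).ne')
    (by simp)]
  simp

theorem lintegral_translate_sub_le (hp : 1 ≤ p) {u : Euc N → ℝ} (hu : ContDiff ℝ 1 u)
    (h : Euc N) :
    ∫⁻ x, ‖u (x + h) - u x‖ₑ ^ (p : ℝ) ≤
      ‖h‖ₑ ^ (p : ℝ) * ∫⁻ x, ‖fderiv ℝ u x‖ₑ ^ (p : ℝ) := by
  have hp1 : (1 : ℝ) ≤ p := by exact_mod_cast hp
  have hp0 : (0 : ℝ) < p := one_pos.trans_le hp1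
  have hcd : Continuous (fderiv ℝ u) := hu.continuous_fderiv one_ne_zero
  set μ : Measure ℝ := volume.restrict (Icc 0 1) with hμ
  have : IsProbabilityMeasure μ := ⟨by simp [hμ]⟩
  have hpt : ∀ x, ‖u (x + h) - u x‖ₑ ^ (p : ℝ) ≤
      ‖h‖ₑ ^ (p : ℝ) * ∫⁻ τ, ‖fderiv ℝ u (x + τ • h)‖ₑ ^ (p : ℝ) ∂μ := fun x => by
    have hline : ∀ τ : ℝ, HasDerivAt (fun τ : ℝ => x + τ • h) h τ := fun τ => by
      simpa using ((hasDerivAt_id τ).smul_const h).const_add x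
    have hder : ∀ τ : ℝ, deriv (fun τ : ℝ => u (x + τ • h)) τ = fderiv ℝ u (x + τ • h) h :=
      fun τ => (((hu.differentiable one_ne_zero _).hasFDerivAt.comp_hasDerivAt τ
        (hline τ))).deriv
    have hcont : ContDiff ℝ 1 (fun τ : ℝ => u (x + τ • h)) := by fun_prop
    have h1 := enorm_sub_le_lintegral_deriv_of_contDiffOn_Icc (a := 0) (b := 1)
      hcont.contDiffOn zero_le_one
    simp only [one_smul, zero_smul, add_zero, hder] at h1
    have hc2 : Continuous fun τ : ℝ => fderiv ℝ u (x + τ • h) := hcd.comp (by fun_prop)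
    have h2 : ‖u (x + h) - u x‖ₑ ≤ ‖h‖ₑ * ∫⁻ τ, ‖fderiv ℝ u (x + τ • h)‖ₑ ∂μ := by
      rw [← lintegral_const_mul _ (by fun_prop)]
      refine h1.trans (lintegral_mono fun τ => ?_)
      rw [mul_comm]
      exact ContinuousLinearMap.le_opENorm _ _
    have h3 := eLpNorm'_le_eLpNorm'_of_exponent_le (μ := μ) one_pos hp1
      (f := fun τ : ℝ => fderiv ℝ u (x + τ • h)) hc2.aestronglyMeasurable
    simp only [eLpNorm', ENNReal.rpow_one, div_one] at h3
    calc _ ≤ (‖h‖ₑ * (∫⁻ τ, ‖fderiv ℝ u (x + τ • h)‖ₑ ^ (p : ℝ) ∂μ) ^ (1 / (p : ℝ))) ^ (p : ℝ) := by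
          gcongr
          exact h2.trans (by gcongr)
      _ = _ := by
          rw [ENNReal.mul_rpow_of_nonneg _ _ hp0.le, ← ENNReal.rpow_mul,
            one_div_mul_cancel hp0.ne', ENNReal.rpow_one]
  have hc3 : Continuous fun z : Euc N × ℝ => fderiv ℝ u (z.1 + z.2 • h) := hcd.comp (by fun_prop)
  have hm3 : Measurable fun z : Euc N × ℝ => ‖fderiv ℝ u (z.1 + z.2 • h)‖ₑ ^ (p : ℝ) :=
    (hc3.enorm.measurable).pow_const _
  calc _ ≤ ∫⁻ x, ‖h‖ₑ ^ (p : ℝ) * ∫⁻ τ, ‖fderiv ℝ u (x + τ • h)‖ₑ ^ (p : ℝ) ∂μ :=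
        lintegral_mono hpt
    _ = ‖h‖ₑ ^ (p : ℝ) * ∫⁻ x, ∫⁻ τ, ‖fderiv ℝ u (x + τ • h)‖ₑ ^ (p : ℝ) ∂μ :=
        lintegral_const_mul' _ _ (by simp)
    _ = ‖h‖ₑ ^ (p : ℝ) * ∫⁻ τ, ∫⁻ x, ‖fderiv ℝ u (x + τ • h)‖ₑ ^ (p : ℝ) ∂volume ∂μ := by
        rw [lintegral_lintegral_swap hm3.aemeasurable]
    _ = _ := by
        have : ∀ τ : ℝ, ∫⁻ x, ‖fderiv ℝ u (x + τ • h)‖ₑ ^ (p : ℝ) =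
            ∫⁻ x, ‖fderiv ℝ u x‖ₑ ^ (p : ℝ) := fun τ =>
          lintegral_add_right_eq_self (fun x => ‖fderiv ℝ u x‖ₑ ^ (p : ℝ)) (τ • h)
        simp [this]

/-- A unit vector. -/
theorem exists_unit [NeZero N] : ∃ e : Euc N, ‖e‖ = 1 :=
  ⟨EuclideanSpace.single 0 1, by simp⟩

/-- Poincaré inequality for the gradient. -/
theorem poincare_one [NeZero N] (hp : 1 ≤ p) {R : ℝ} (hR : 0 < R) {u : Euc N → ℝ}
    (hu : ContDiff ℝ 1 u) (hsupp : ∀ x, R ≤ ‖x‖ → u x = 0) :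
    eLpNorm u p volume ≤ ENNReal.ofReal (2 * R) * eLpNorm (fun x => fderiv ℝ u x) p volume := by
  have hp0 : (0 : ℝ) < p := one_pos.trans_le (by exact_mod_cast hp)
  obtain ⟨e, he⟩ := exists_unit (N := N)
  set h : Euc N := (2 * R) • e with hh
  have hhn : ‖h‖ = 2 * R := by
    rw [hh, norm_smul, he, mul_one, Real.norm_of_nonneg (by positivity)]
  rw [eLpNorm_coe_eq hp, eLpNorm_coe_eq hp]
  have key : ∀ x, ‖u x‖ₑ ^ (p : ℝ) ≤ ‖u (x + h) - u x‖ₑ ^ (p : ℝ) := fun x => by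
    by_cases hx : R ≤ ‖x‖
    · simp [hsupp x hx, hp0]
    · have : R ≤ ‖x + h‖ := by
        have := norm_sub_le (x + h) x
        rw [add_sub_cancel_left, hhn] at this
        linarith
      simp [hsupp _ this]
  calc _ ≤ (‖h‖ₑ ^ (p : ℝ) * ∫⁻ x, ‖fderiv ℝ u x‖ₑ ^ (p : ℝ)) ^ (1 / (p : ℝ)) := by
        gcongr
        exact (lintegral_mono key).trans (lintegral_translate_sub_le hp hu h)
    _ = _ := by
        rw [ENNReal.mul_rpow_of_nonneg _ _ (by positivity), ← ENNReal.rpow_mul,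
          mul_one_div_cancel hp0.ne', ENNReal.rpow_one, ← ofReal_norm, hhn]

/-- Poincaré inequality for the Gagliardo seminorm. -/
theorem poincare_frac [NeZero N] (hs : 0 < s) (hp : 1 ≤ p) {R : ℝ} (hR : 0 < R) :
    ∃ C : ℝ≥0, ∀ u : Euc N → ℝ, (∀ x, R ≤ ‖x‖ → u x = 0) →
      eLpNorm u p volume ≤ C * gagliardo s p u := by
  have hp0 : (0 : ℝ) < p := one_pos.trans_le (by exact_mod_cast hp)
  have ha : 0 < (N : ℝ) + s * p := by positivity
  obtain ⟨e, he⟩ := exists_unit (N := N)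
  set B := Metric.ball ((2 * R) • e : Euc N) R with hB
  have hBv0 : volume B ≠ 0 := (Metric.measure_ball_pos _ _ hR).ne'
  have hBv1 : volume B ≠ ∞ := Metric.isBounded_ball.measure_lt_top.ne
  have hc : ‖((2 * R) • e : Euc N)‖ = 2 * R := by
    rw [norm_smul, he, mul_one, Real.norm_of_nonneg (by positivity)]
  set D : ℝ≥0∞ := ENNReal.ofReal (4 * R) ^ ((N : ℝ) + s * p) / volume B with hD
  have hDt : D ≠ ∞ := ENNReal.div_ne_top (ENNReal.rpow_ne_top_of_nonneg ha.le ENNReal.ofReal_ne_top) hBv0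
  refine ⟨(D ^ (1 / (p : ℝ))).toNNReal, fun u hu => ?_⟩
  rw [ENNReal.coe_toNNReal (by simp [hDt]), eLpNorm_coe_eq hp, gagliardo,
    ← ENNReal.mul_rpow_of_nonneg _ _ (by positivity), ← lintegral_const_mul' _ _ hDt]
  refine ENNReal.rpow_le_rpow (lintegral_mono fun x => ?_) (by positivity)
  by_cases hx : R ≤ ‖x‖
  · simp [hu x hx, hp0]
  push Not at hx
  have h1 : volume B * (‖u x‖ₑ ^ (p : ℝ) / ENNReal.ofReal (4 * R) ^ ((N : ℝ) + s * p)) ≤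
      ∫⁻ y, ‖u x - u y‖ₑ ^ (p : ℝ) / ‖x - y‖ₑ ^ ((N : ℝ) + s * p) := by
    rw [mul_comm, ← setLIntegral_const]
    refine le_trans ?_ (setLIntegral_le_lintegral B _)
    refine setLIntegral_mono' measurableSet_ball fun y hy => ?_
    rw [hB, Metric.mem_ball, dist_eq_norm] at hy
    have hy1 : R ≤ ‖y‖ := by
      have := norm_sub_norm_le ((2 * R) • e : Euc N) y
      rw [hc, norm_sub_rev] at this
      linarith
    have hy2 : ‖x - y‖ ≤ 4 * R := by
      have h2 := norm_sub_norm_le y ((2 * R) • e : Euc N)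
      rw [hc] at h2
      have := norm_sub_le x y
      linarith
    rw [hu y hy1, sub_zero, ← ofReal_norm (x - y)]
    gcongr
  have hE0 : ENNReal.ofReal (4 * R) ^ ((N : ℝ) + s * p) ≠ 0 := by
    have : 0 < ENNReal.ofReal (4 * R) := by simpa using hR
    exact (ENNReal.rpow_pos this ENNReal.ofReal_ne_top).ne'
  have hE1 : ENNReal.ofReal (4 * R) ^ ((N : ℝ) + s * p) ≠ ∞ :=
    ENNReal.rpow_ne_top_of_nonneg ha.le ENNReal.ofReal_ne_top
  calc ‖u x‖ₑ ^ (p : ℝ) = D * (volume B *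
        (‖u x‖ₑ ^ (p : ℝ) / ENNReal.ofReal (4 * R) ^ ((N : ℝ) + s * p))) := by
        rw [hD, ← mul_assoc, ENNReal.div_mul_cancel hBv0 hBv1, ENNReal.mul_div_cancel hE0 hE1]
    _ ≤ _ := by gcongr

theorem poincare [NeZero N] {Ω : Opens (Euc N)} (hΩ : Bornology.IsBounded (Ω : Set (Euc N)))
    (hs : s ∈ Ioc (0 : ℝ) 1) (hp : 1 ≤ p) :
    ∃ C : ℝ≥0, ∀ φ : Test Ω, eLpNorm φ p volume ≤ C * homENorm s p φ := by
  obtain ⟨R, hR, hΩR⟩ := hΩ.subset_ball_lt 0 0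
  have hsupp : ∀ φ : Test Ω, ∀ x, R ≤ ‖x‖ → φ x = 0 := fun φ x hx => by
    refine image_eq_zero_of_notMem_tsupport fun hmem => ?_
    have := hΩR (φ.tsupport_subset hmem)
    rw [mem_ball_zero_iff] at this
    linarith
  unfold homENorm
  split_ifs with h1
  · refine ⟨(2 * R).toNNReal, fun φ => ?_⟩
    exact poincare_one hp hR (φ.contDiff.of_le (by simp)) (hsupp φ)
  · obtain ⟨C, hC⟩ := poincare_frac (N := N) hs.1 hp hR
    exact ⟨C, fun φ => hC φ (hsupp φ)⟩

end Poincare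

section Spaces

variable {Ω : Opens (Euc N)} {s : ℝ} {p : ℝ≥0}

theorem homENorm_lt_top (hs : s ∈ Ioc (0 : ℝ) 1) (hp : 1 ≤ p) (φ : Test Ω) :
    homENorm s p φ < ∞ := by
  have h1 : ContDiff ℝ 1 φ := φ.contDiff.of_le (by simp)
  unfold homENorm
  split_ifs with h
  · exact ((h1.continuous_fderiv one_ne_zero).memLp_of_hasCompactSupport
      (φ.hasCompactSupport.fderiv (𝕜 := ℝ))).eLpNorm_lt_top
  · exact gagliardo_lt_top ⟨hs.1, lt_of_le_of_ne hs.2 h⟩ hp h1 φ.hasCompactSupport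

theorem homENorm_add (hp : 1 ≤ p) (φ ψ : Test Ω) :
    homENorm s p ⇑(φ + ψ) ≤ homENorm s p φ + homENorm s p ψ := by
  have h1 : ∀ φ : Test Ω, ContDiff ℝ 1 φ := fun φ => φ.contDiff.of_le (by simp)
  have hd : ∀ φ : Test Ω, Differentiable ℝ φ := fun φ => (h1 φ).differentiable one_ne_zero
  rw [FunLike.coe_add]
  unfold homENorm
  split_ifs with h
  · have h2 : ∀ x, fderiv ℝ (⇑φ + ⇑ψ) x = fderiv ℝ φ x + fderiv ℝ ψ x := fun x =>
      fderiv_add (hd φ x) (hd ψ x)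
    have hc : ∀ φ : Test Ω, AEStronglyMeasurable (fun x => fderiv ℝ φ x) volume := fun φ =>
      ((h1 φ).continuous_fderiv one_ne_zero).aestronglyMeasurable
    have hp' : (1 : ℝ≥0∞) ≤ p := by exact_mod_cast hp
    have h3 := eLpNorm_add_le (μ := (volume : Measure (Euc N))) (hc φ) (hc ψ) hp'
    rwa [show ((fun x => fderiv ℝ φ x) + fun x => fderiv ℝ ψ x) =
      fun x => fderiv ℝ (⇑φ + ⇑ψ) x from funext fun x => (h2 x).symm] at h3
  · exact gagliardo_add hp φ.continuous ψ.continuous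

theorem homENorm_smul (hp : 1 ≤ p) (c : ℝ) (φ : Test Ω) :
    homENorm s p ⇑(c • φ) = ‖c‖ₑ * homENorm s p φ := by
  have hd : Differentiable ℝ φ := (φ.contDiff.of_le (m := 1) (by simp)).differentiable one_ne_zero
  rw [FunLike.coe_smul]
  unfold homENorm
  split_ifs with h
  · have h2 : ∀ x, fderiv ℝ (c • ⇑φ) x = c • fderiv ℝ φ x := fun x =>
      fderiv_const_smul (hd x) c
    simp only [h2]
    exact eLpNorm_const_smul c (fun x => fderiv ℝ φ x) p volume
  · exact gagliardo_smul hp c φ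

/-- `C_0^∞(Ω)` with the homogeneous norm of order `s` and exponent `p`. -/
def HomTest (Ω : Opens (Euc N)) (s : ℝ) (_hs : s ∈ Ioc (0 : ℝ) 1) (_p : ℝ≥0) : Type := Test Ω

variable (Ω : Opens (Euc N)) (s : ℝ) (hs : s ∈ Ioc (0 : ℝ) 1) (p : ℝ≥0)

noncomputable instance : AddCommGroup (HomTest Ω s hs p) := inferInstanceAs (AddCommGroup (Test Ω))

noncomputable instance : Module ℝ (HomTest Ω s hs p) := inferInstanceAs (Module ℝ (Test Ω))

/-- A test function, seen in `HomTest`. -/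
noncomputable def HomTest.of : Test Ω ≃ₗ[ℝ] HomTest Ω s hs p := LinearEquiv.refl ℝ (Test Ω)

variable [hp : Fact (1 ≤ p)]

noncomputable instance : SeminormedAddCommGroup (HomTest Ω s hs p) :=
  AddGroupSeminorm.toSeminormedAddCommGroup
    { toFun := fun φ => (homENorm s p ((HomTest.of Ω s hs p).symm φ)).toReal
      map_zero' := by
        have := homENorm_smul (s := s) hp.out 0 (0 : Test Ω)
        rw [zero_smul, enorm_zero, zero_mul] at this
        rw [map_zero, this, ENNReal.toReal_zero]
      add_le' := fun φ ψ => by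
        have h1 := fun φ : Test Ω => (homENorm_lt_top hs hp.out φ).ne
        rw [← ENNReal.toReal_add (h1 _) (h1 _), map_add]
        exact ENNReal.toReal_mono (ENNReal.add_ne_top.2 ⟨h1 _, h1 _⟩) (homENorm_add hp.out _ _)
      neg' := fun φ => by
        have := homENorm_smul (s := s) hp.out (-1) ((HomTest.of Ω s hs p).symm φ)
        rw [map_neg]
        rw [neg_one_smul] at this
        rw [this]
        simp }

theorem HomTest.norm_of (φ : Test Ω) :
    ‖HomTest.of Ω s hs p φ‖ = (homENorm s p φ).toReal := rfl

noncomputable instance : NormedSpace ℝ (HomTest Ω s hs p) where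
  norm_smul_le c φ := by
    obtain ⟨φ, rfl⟩ := (HomTest.of Ω s hs p).surjective φ
    rw [← map_smul, HomTest.norm_of, HomTest.norm_of, homENorm_smul hp.out, ENNReal.toReal_mul]
    simp

/-- The homogeneous Sobolev-Slobodeckii space `D_0^{s,p}(Ω)`: the completion of `C_0^∞(Ω)` in the
homogeneous norm of order `s`. -/
abbrev D0 : Type := UniformSpace.Completion (HomTest Ω s hs p)

/-- The dual of `D_0^{s,p}(Ω)`, i.e. `D^{-s,p'}(Ω)` with `1 / p + 1 / p' = 1`, with the dual
norm. -/
abbrev D0Dual : Type := StrongDual ℝ (D0 Ω s hs p)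

/-- Test functions as elements of `D_0^{s,p}(Ω)`. -/
noncomputable def ofTest : Test Ω →ₗ[ℝ] D0 Ω s hs p :=
  (UniformSpace.Completion.toComplL (𝕜 := ℝ) (E := HomTest Ω s hs p)).toLinearMap ∘ₗ
    (HomTest.of Ω s hs p).toLinearMap

/-- The Lebesgue space `L^p(Ω)`. -/
abbrev LpSpace : Type := Lp ℝ (p : ℝ≥0∞) (volume.restrict (Ω : Set (Euc N)))

/-- Test functions as elements of `L^p(Ω)`. -/
noncomputable def testToLp : Test Ω →ₗ[ℝ] LpSpace Ω p where
  toFun φ := MemLp.toLp φ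
    ((φ.continuous.memLp_of_hasCompactSupport φ.hasCompactSupport).restrict (Ω : Set (Euc N)))
  map_add' _ _ := rfl
  map_smul' _ _ := rfl

theorem exists_norm_testToLp_le [NeZero N] (hΩ : Bornology.IsBounded (Ω : Set (Euc N))) :
    ∃ C : ℝ, ∀ φ : HomTest Ω s hs p,
      ‖(testToLp Ω p ∘ₗ (HomTest.of Ω s hs p).symm.toLinearMap) φ‖ ≤ C * ‖φ‖ := by
  obtain ⟨C, hC⟩ := poincare hΩ hs hp.out
  refine ⟨C, fun φ => ?_⟩
  obtain ⟨φ, rfl⟩ := (HomTest.of Ω s hs p).surjective φ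
  have h1 : eLpNorm φ p (volume.restrict (Ω : Set (Euc N))) ≤ C * homENorm s p φ :=
    (eLpNorm_mono_measure _ Measure.restrict_le_self).trans (hC φ)
  have h2 := ENNReal.toReal_mono
    (ENNReal.mul_ne_top ENNReal.coe_ne_top (homENorm_lt_top hs hp.out φ).ne) h1
  rw [ENNReal.toReal_mul, ENNReal.coe_toReal] at h2
  rw [HomTest.norm_of]
  refine le_trans (le_of_eq ?_) h2
  exact Lp.norm_toLp φ
    ((φ.continuous.memLp_of_hasCompactSupport φ.hasCompactSupport).restrict (Ω : Set (Euc N)))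

/-- The embedding `D_0^{s,p}(Ω) → L^p(Ω)` for bounded `Ω`: the continuous extension of the
identity of `C_0^∞(Ω)`. -/
noncomputable def toLp [NeZero N] (hΩ : Bornology.IsBounded (Ω : Set (Euc N))) :
    D0 Ω s hs p →L[ℝ] LpSpace Ω p :=
  ((testToLp Ω p ∘ₗ (HomTest.of Ω s hs p).symm.toLinearMap).mkContinuousOfExistsBound
    (exists_norm_testToLp_le Ω s hs p hΩ)).extend UniformSpace.Completion.toComplL

theorem toLp_ofTest [NeZero N] (hΩ : Bornology.IsBounded (Ω : Set (Euc N))) (φ : Test Ω) :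
    toLp Ω s hs p hΩ (ofTest Ω s hs p φ) = testToLp Ω p φ :=
  ContinuousLinearMap.extend_eq _ UniformSpace.Completion.denseRange_coe
    (UniformSpace.Completion.isUniformInducing_coe _) (HomTest.of Ω s hs p φ)

/-- The embedding `L^q(Ω) → D^{-s,q}(Ω)` for conjugate exponents `q, p`: the function `f` acts on
`u ∈ D_0^{s,p}(Ω)` by `∫_Ω f u`. -/
noncomputable def lpToDual [NeZero N] (hΩ : Bornology.IsBounded (Ω : Set (Euc N)))
    {q : ℝ≥0} [Fact (1 ≤ q)] (hqp : q.HolderConjugate p) :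
    LpSpace Ω q →L[ℝ] D0Dual Ω s hs p :=
  haveI : ENNReal.HolderConjugate (q : ℝ≥0∞) (p : ℝ≥0∞) := hqp.coe_ennreal
  (ContinuousLinearMap.precomp ℝ (toLp Ω s hs p hΩ)).comp
    ((ContinuousLinearMap.mul ℝ ℝ).lpPairing (volume.restrict (Ω : Set (Euc N)))
      (q : ℝ≥0∞) (p : ℝ≥0∞))

theorem lpToDual_apply [NeZero N] (hΩ : Bornology.IsBounded (Ω : Set (Euc N)))
    {q : ℝ≥0} [Fact (1 ≤ q)] (hqp : q.HolderConjugate p) (f : LpSpace Ω q)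
    (u : D0 Ω s hs p) :
    lpToDual Ω s hs p hΩ hqp f u = ∫ x in (Ω : Set (Euc N)), f x * toLp Ω s hs p hΩ u x :=
  haveI : ENNReal.HolderConjugate (q : ℝ≥0∞) (p : ℝ≥0∞) := hqp.coe_ennreal
  (ContinuousLinearMap.mul ℝ ℝ).lpPairing_eq_integral f (toLp Ω s hs p hΩ u)

end Spaces

section DualIdentities

open RealInterpolation

/-- An open ball, as a bundled open set. -/
def openBall (c : Euc N) (r : ℝ) : Opens (Euc N) := ⟨Metric.ball c r, Metric.isOpen_ball⟩

theorem isBounded_openBall (c : Euc N) (r : ℝ) :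
    Bornology.IsBounded (openBall c r : Set (Euc N)) := Metric.isBounded_ball

theorem one_mem_Ioc : (1 : ℝ) ∈ Ioc (0 : ℝ) 1 := ⟨one_pos, le_rfl⟩

theorem one_sub_mem_Ioo {β : ℝ} (hβ : β ∈ Ioo (0 : ℝ) 1) : 1 - β ∈ Ioo (0 : ℝ) 1 :=
  ⟨sub_pos.2 hβ.2, sub_lt_self 1 hβ.1⟩

theorem one_sub_mem_Ioc {β : ℝ} (hβ : β ∈ Ioo (0 : ℝ) 1) : 1 - β ∈ Ioc (0 : ℝ) 1 :=
  Ioo_subset_Ioc_self (one_sub_mem_Ioo hβ)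

/-- `D_0^{1,p}(Ω)`. -/
abbrev D0One (Ω : Opens (Euc N)) (p : ℝ≥0) [Fact (1 ≤ p)] : Type := D0 Ω 1 one_mem_Ioc p

variable [NeZero N] {Ω : Opens (Euc N)} (hΩ : Bornology.IsBounded (Ω : Set (Euc N)))

/-- The embedding `D_0^{1,p}(Ω) → L^p(Ω)`. -/
noncomputable abbrev oneToLp (p : ℝ≥0) [Fact (1 ≤ p)] : D0One Ω p →L[ℝ] LpSpace Ω p :=
  toLp Ω 1 one_mem_Ioc p hΩ

/-- The embedding `L^q(Ω) → D^{-1,q}(Ω)`. -/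
noncomputable abbrev lpToNegOne {q q' : ℝ≥0} [Fact (1 ≤ q)] [Fact (1 ≤ q')]
    (hq : q.HolderConjugate q') : LpSpace Ω q →L[ℝ] StrongDual ℝ (D0One Ω q') :=
  lpToDual Ω 1 one_mem_Ioc q' hΩ hq

/-- `(D^{-1,q}(Ω), L^q(Ω))_{β,q}`, a subspace of `D^{-1,q}(Ω)`. -/
abbrev InterpNeg (β : ℝ) {q q' : ℝ≥0} [Fact (1 ≤ q)] [Fact (1 ≤ q')]
    (hq : q.HolderConjugate q') : Type :=
  RealInterp (ContinuousLinearMap.id ℝ (StrongDual ℝ (D0One Ω q'))) (lpToNegOne hΩ hq) β q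

/-- `(D_0^{1,p}(Ω), L^p(Ω))_{α,p}`, a subspace of `L^p(Ω)`. -/
abbrev InterpDL (α : ℝ) (p : ℝ≥0) [Fact (1 ≤ p)] : Type :=
  RealInterp (oneToLp hΩ p) (ContinuousLinearMap.id ℝ (LpSpace Ω p)) α p

/-- `(L^p(Ω), D_0^{1,p}(Ω))_{α,p}`, a subspace of `L^p(Ω)`. -/
abbrev InterpLD (α : ℝ) (p : ℝ≥0) [Fact (1 ≤ p)] : Type :=
  RealInterp (ContinuousLinearMap.id ℝ (LpSpace Ω p)) (oneToLp hΩ p) α p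

/-- Test functions as elements of `(D_0^{1,p}(Ω), L^p(Ω))_{α,p}`. -/
noncomputable def testToInterpDL {α : ℝ} (hα : α ∈ Ioo (0 : ℝ) 1) (p : ℝ≥0) [Fact (1 ≤ p)] :
    Test Ω →ₗ[ℝ] InterpDL hΩ α p :=
  RealInterp.ofBoth _ _ α p hα (ofTest Ω 1 one_mem_Ioc p) (testToLp Ω p)
    fun φ => toLp_ofTest Ω 1 one_mem_Ioc p hΩ φ

/-- Test functions as elements of `(L^p(Ω), D_0^{1,p}(Ω))_{α,p}`. -/
noncomputable def testToInterpLD {α : ℝ} (hα : α ∈ Ioo (0 : ℝ) 1) (p : ℝ≥0) [Fact (1 ≤ p)] :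
    Test Ω →ₗ[ℝ] InterpLD hΩ α p :=
  RealInterp.ofBoth _ _ α p hα (testToLp Ω p) (ofTest Ω 1 one_mem_Ioc p)
    fun φ => (toLp_ofTest Ω 1 one_mem_Ioc p hΩ φ).symm

/-- Elements of `(D^{-1,q}(Ω), L^q(Ω))_{β,q}`, acting on test functions. -/
noncomputable def interpNegAct (β : ℝ) {q q' : ℝ≥0} [Fact (1 ≤ q)] [Fact (1 ≤ q')]
    (hq : q.HolderConjugate q') : InterpNeg hΩ β hq →ₗ[ℝ] (Test Ω →ₗ[ℝ] ℝ) :=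
  dualRestrict (ofTest Ω 1 one_mem_Ioc q') ∘ₗ RealInterp.subtype _ _ β q

/-- Elements of the dual of `(D_0^{1,p}(Ω), L^p(Ω))_{α,p}`, acting on test functions. -/
noncomputable def interpDLDualAct {α : ℝ} (hα : α ∈ Ioo (0 : ℝ) 1) (p : ℝ≥0) [Fact (1 ≤ p)] :
    StrongDual ℝ (InterpDL hΩ α p) →ₗ[ℝ] (Test Ω →ₗ[ℝ] ℝ) :=
  dualRestrict (testToInterpDL hΩ hα p)

/-- Elements of the dual of `(L^p(Ω), D_0^{1,p}(Ω))_{α,p}`, acting on test functions. -/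
noncomputable def interpLDDualAct {α : ℝ} (hα : α ∈ Ioo (0 : ℝ) 1) (p : ℝ≥0) [Fact (1 ≤ p)] :
    StrongDual ℝ (InterpLD hΩ α p) →ₗ[ℝ] (Test Ω →ₗ[ℝ] ℝ) :=
  dualRestrict (testToInterpLD hΩ hα p)

/-- Elements of the dual of `D_0^{s,p}(Ω)`, acting on test functions. -/
noncomputable def d0DualAct (Ω : Opens (Euc N)) (s : ℝ) (hs : s ∈ Ioc (0 : ℝ) 1) (p : ℝ≥0)
    [Fact (1 ≤ p)] : D0Dual Ω s hs p →ₗ[ℝ] (Test Ω →ₗ[ℝ] ℝ) :=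
  dualRestrict (ofTest Ω s hs p)

end DualIdentities

end HomSobolev

open RealInterpolation HomSobolev

/-! Put X = L^p(B) and Y = D_0^{1,p}(B) with p = q', and let j : Y → X be the embedding. The proof
joins two independent facts.

Duality: (Y*, X*)_{β,q} = ((X, Y)_{1-β,p})*. Interpolation norms are replaced by dyadic sums over
K(2^n). For f in the left space and y in Y, near minimizers u_n of K(2^n, jy) decompose y into the
increments u_n - u_{n+1}, on which |f| is at most a constant times 2^{-n} K(2^n, f) K(2^n, jy);
Hölder's inequality sums these bounds (`enorm_apply_le_dyadicENorm`). Conversely, Hahn-Banach in Y ×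
X shows that K(t, f) is comparable to the supremum of f(y) over ‖y‖ ≤ 1, ‖jy‖ ≤ t
(`exists_norming_vector`). Superposing norming vectors with coefficients in the unit ball of ℓ^p,
and controlling the sum by Young's inequality on ℤ, bounds the interpolation norm of f by its norm
as a functional (`interpENorm_dualEmb_le`). The Riesz representation turns X* into L^q(B).

Identification: (L^p, D_0^{1,p})_{s,p} = D_0^{s,p} on a ball, with s = 1 - β. By Fubini, the p-th
power of the Gagliardo seminorm is a weighted integral in t of the energy E(t) of the translates φ(·
+ h) - φ with |h| < t, so it is enough to compare K(t, φ)^p with t^{-N} E(t). That K dominates holds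
on every bounded open set: translations are isometries of L^p, and the increments of ψ are
controlled by |h| ‖∇ψ‖. The reverse bound needs a competitor in C_0^∞(B). It is obtained by
averaging φ at a scale comparable to t after a dilation about the centre, which keeps the support
inside the ball (`exists_kFunctional_rpow_le`); for t large compared with the radius the trivial
decomposition suffices. No constant depends on the centre or the radius.

The comparison is made on test functions, which are dense in (X, Y)_{s,p} and in D_0^{s,p}. It
extends to the spaces since the interpolation space is complete and lies in L^p; the injectivity of
D_0^{s,p} → L^p is then a by-product. The same comparison identifies the duals. -/

namespace RealInterpolation

/-! ### The K-functional: symmetry of the couple and dyadic discretization -/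

section KFunctional

variable {X Y Z : Type*} [NormedAddCommGroup X] [NormedSpace ℝ X]
  [NormedAddCommGroup Y] [NormedSpace ℝ Y] [NormedAddCommGroup Z] [NormedSpace ℝ Z]
  (i : X →L[ℝ] Z) (j : Y →L[ℝ] Z)

theorem kFunctional_swap {t : ℝ} (ht : 0 < t) (z : Z) :
    kFunctional j i t⁻¹ z = ENNReal.ofReal t⁻¹ * kFunctional i j t z := by
  unfold kFunctional
  have h0 : ENNReal.ofReal t⁻¹ ≠ 0 := by simpa using ht
  simp only [ENNReal.mul_iInf_of_ne h0 ENNReal.ofReal_ne_top]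
  rw [iInf_comm]
  refine iInf_congr fun x => iInf_congr fun y => ?_
  rw [add_comm (j y)]
  refine iInf_congr fun _ => ?_
  rw [mul_add, ← mul_assoc, ← ENNReal.ofReal_mul (by positivity), inv_mul_cancel₀ ht.ne',
    ENNReal.ofReal_one, one_mul, add_comm]

/-- K(t)/t is nonincreasing. Together with the monotonicity of K, this makes K constant up to a
factor 2 on each dyadic interval. -/
theorem kFunctional_mul_le {c : ℝ} (hc : 1 ≤ c) (t : ℝ) (z : Z) :
    kFunctional i j (c * t) z ≤ ENNReal.ofReal c * kFunctional i j t z := by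
  have hc0 : 0 < c := one_pos.trans_le hc
  unfold kFunctional
  have h0 : ENNReal.ofReal c ≠ 0 := by simpa using hc0
  simp only [ENNReal.mul_iInf_of_ne h0 ENNReal.ofReal_ne_top]
  refine iInf_mono fun x => iInf_mono fun y => iInf_mono fun _ => ?_
  rw [mul_add, ← mul_assoc, ENNReal.ofReal_mul hc0.le]
  gcongr
  exact le_mul_of_one_le_left zero_le (by simpa using hc)

theorem lintegral_Ioi_comp_inv (F : ℝ → ℝ≥0∞) :
    ∫⁻ t in Ioi (0 : ℝ), F t = ∫⁻ t in Ioi (0 : ℝ), ENNReal.ofReal (t ^ 2)⁻¹ * F t⁻¹ := by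
  have himg : (fun t : ℝ => t⁻¹) '' Ioi 0 = Ioi 0 := by
    ext t
    constructor
    · rintro ⟨u, hu, rfl⟩
      exact mem_Ioi.2 (inv_pos.2 (mem_Ioi.1 hu))
    · intro ht
      exact ⟨t⁻¹, mem_Ioi.2 (inv_pos.2 (mem_Ioi.1 ht)), inv_inv t⟩
  have h := lintegral_image_eq_lintegral_abs_deriv_mul (f := fun t : ℝ => t⁻¹)
    (f' := fun t => -(t ^ 2)⁻¹) measurableSet_Ioi
    (fun t (ht : 0 < t) => (hasDerivAt_inv ht.ne').hasDerivWithinAt) inv_injective.injOn F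
  rw [himg] at h
  simpa only [abs_neg, abs_inv, abs_pow, sq_abs] using h

/-- The substitution t ↦ 1/t preserves dt/t, and K(1/t) for the swapped couple is K(t)/t. The two
norms are therefore equal, not merely equivalent. -/
theorem interpENorm_swap (α : ℝ) (q : ℝ≥0) (z : Z) :
    interpENorm j i α q z = interpENorm i j (1 - α) q z := by
  unfold interpENorm
  congr 1
  rw [lintegral_Ioi_comp_inv]
  refine setLIntegral_congr_fun measurableSet_Ioi fun t (ht : 0 < t) => ?_
  rw [kFunctional_swap i j ht, ENNReal.mul_rpow_of_nonneg _ _ q.coe_nonneg,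
    ENNReal.ofReal_rpow_of_pos (by positivity), ← mul_assoc, ← ENNReal.ofReal_mul (by positivity),
    ENNReal.mul_div_right_comm, ENNReal.mul_div_right_comm, ← mul_assoc,
    ← ENNReal.ofReal_div_of_pos (by positivity), ← ENNReal.ofReal_div_of_pos (by positivity),
    ← ENNReal.ofReal_mul (by positivity)]
  congr 2
  rw [Real.inv_rpow ht.le, Real.inv_rpow ht.le, ← Real.rpow_neg ht.le, ← Real.rpow_neg ht.le,
    neg_neg, show -((1 - α) * (q : ℝ)) = α * q + -q by ring, Real.rpow_add ht]
  field_simp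

theorem iUnion_Ico_two_zpow : ⋃ n : ℤ, Ico ((2 : ℝ) ^ n) (2 ^ (n + 1)) = Ioi 0 := by
  ext t
  simp only [mem_iUnion, mem_Ioi]
  constructor
  · rintro ⟨n, hn⟩
    exact lt_of_lt_of_le (by positivity) hn.1
  · intro ht
    exact exists_mem_Ico_zpow ht one_lt_two

/-- The discrete interpolation norm
`(∑_{n ∈ ℤ} (2 ^ (-α n) K(2 ^ n, z)) ^ q) ^ (1 / q)`. -/
noncomputable def dyadicENorm (α : ℝ) (q : ℝ≥0) (z : Z) : ℝ≥0∞ :=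
  (∑' n : ℤ, (ENNReal.ofReal (2 ^ (-(α * n))) * kFunctional i j (2 ^ n) z) ^ (q : ℝ))
    ^ (1 / (q : ℝ))

theorem lintegral_eq_tsum_dyadic (F : ℝ → ℝ≥0∞) :
    ∫⁻ t in Ioi (0 : ℝ), F t = ∑' n : ℤ, ∫⁻ t in Ico ((2 : ℝ) ^ n) (2 ^ (n + 1)), F t := by
  rw [← iUnion_Ico_two_zpow, lintegral_iUnion (fun _ => measurableSet_Ico)]
  intro m n hmn
  rw [Function.onFun, Set.disjoint_left]
  intro t hm hn
  have h1 := (zpow_lt_zpow_iff_right₀ one_lt_two).1 (hm.1.trans_lt hn.2)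
  have h2 := (zpow_lt_zpow_iff_right₀ one_lt_two).1 (hn.1.trans_lt hm.2)
  omega

theorem volume_Ico_two_zpow (n : ℤ) :
    volume (Ico ((2 : ℝ) ^ n) (2 ^ (n + 1))) = ENNReal.ofReal (2 ^ n) := by
  rw [Real.volume_Ico, zpow_add_one₀ two_ne_zero]
  congr 1; ring

/-- On [2^n, 2^(n+1)) the powers of t are largest at the left end, K(t) ≤ 2 K(2^n), and the length
of the interval cancels the factor 1/2^n. Only the factor 2 from K remains. -/
theorem interpENorm_le_dyadicENorm {α : ℝ} (hα : 0 ≤ α) {q : ℝ≥0} (hq : 1 ≤ q) (z : Z) :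
    interpENorm i j α q z ≤ 2 * dyadicENorm i j α q z := by
  have hq0 : (0 : ℝ) < q := lt_of_lt_of_le one_pos (by exact_mod_cast hq)
  have h2 : (2 : ℝ≥0∞) = (2 ^ (q : ℝ)) ^ (1 / (q : ℝ)) := by
    rw [← ENNReal.rpow_mul, mul_one_div_cancel hq0.ne', ENNReal.rpow_one]
  unfold dyadicENorm interpENorm
  rw [h2, ← ENNReal.mul_rpow_of_nonneg _ _ (by positivity), lintegral_eq_tsum_dyadic,
    ← ENNReal.tsum_mul_left]
  refine ENNReal.rpow_le_rpow (ENNReal.tsum_le_tsum fun n => ?_) (by positivity)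
  have hn : (0 : ℝ) < 2 ^ n := by positivity
  calc _ ≤ ∫⁻ t in Ico ((2 : ℝ) ^ n) (2 ^ (n + 1)), ENNReal.ofReal ((2 ^ n) ^ (-(α * q))) *
        (2 * kFunctional i j (2 ^ n) z) ^ (q : ℝ) / ENNReal.ofReal (2 ^ n) := by
        refine setLIntegral_mono' measurableSet_Ico fun t ht => ?_
        have ht0 : 0 < t := hn.trans_le ht.1
        have hk : kFunctional i j t z ≤ 2 * kFunctional i j (2 ^ n) z := by
          refine (kFunctional_mono i j z ht.2.le).trans ?_
          simp only [zpow_add_one₀ (two_ne_zero' ℝ)]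
          rw [mul_comm]
          simpa using kFunctional_mul_le i j one_le_two (2 ^ n) z
        gcongr ?_ * ?_ ^ (q : ℝ) / ENNReal.ofReal ?_
        · exact ENNReal.ofReal_le_ofReal (Real.rpow_le_rpow_of_nonpos hn ht.1
            (neg_nonpos.2 (by positivity)))
        · exact ht.1
    _ = _ := by
        rw [setLIntegral_const, volume_Ico_two_zpow, ENNReal.div_mul_cancel (by simpa using hn)
          ENNReal.ofReal_ne_top, ENNReal.mul_rpow_of_nonneg _ _ q.coe_nonneg,
          ENNReal.mul_rpow_of_nonneg _ _ q.coe_nonneg, ENNReal.ofReal_rpow_of_pos (by positivity),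
          ← Real.rpow_intCast, ← Real.rpow_mul (by positivity), ← Real.rpow_mul (by positivity),
          mul_left_comm]
        congr 4
        ring

theorem dyadicENorm_le_interpENorm {α : ℝ} (hα : α ∈ Icc (0 : ℝ) 1) {q : ℝ≥0} (hq : 1 ≤ q)
    (z : Z) : dyadicENorm i j α q z ≤ 4 * interpENorm i j α q z := by
  have hq1 : (1 : ℝ) ≤ q := by exact_mod_cast hq
  have hq0 : (0 : ℝ) < q := one_pos.trans_le hq1
  have h2 : (4 : ℝ≥0∞) = (4 ^ (q : ℝ)) ^ (1 / (q : ℝ)) := by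
    rw [← ENNReal.rpow_mul, mul_one_div_cancel hq0.ne', ENNReal.rpow_one]
  unfold dyadicENorm interpENorm
  rw [h2, ← ENNReal.mul_rpow_of_nonneg _ _ (by positivity), lintegral_eq_tsum_dyadic,
    ← ENNReal.tsum_mul_left]
  refine ENNReal.rpow_le_rpow (ENNReal.tsum_le_tsum fun n => ?_) (by positivity)
  have hn : (0 : ℝ) < 2 ^ n := by positivity
  have hn' : (0 : ℝ) < 2 ^ (n + 1) := by positivity
  have h4 : (4 : ℝ≥0∞) ^ (q : ℝ) * ∫⁻ t in Ico ((2 : ℝ) ^ n) (2 ^ (n + 1)),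
      ENNReal.ofReal ((2 ^ (n + 1)) ^ (-(α * q))) *
        (kFunctional i j (2 ^ n) z) ^ (q : ℝ) / ENNReal.ofReal (2 ^ (n + 1)) ≤
      (4 : ℝ≥0∞) ^ (q : ℝ) * ∫⁻ t in Ico ((2 : ℝ) ^ n) (2 ^ (n + 1)),
        ENNReal.ofReal (t ^ (-(α * q))) * kFunctional i j t z ^ (q : ℝ) / ENNReal.ofReal t := by
    refine mul_le_mul_right (setLIntegral_mono' measurableSet_Ico fun t ht => ?_) _
    have ht0 : 0 < t := hn.trans_le ht.1
    gcongr ?_ * ?_ ^ (q : ℝ) / ENNReal.ofReal ?_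
    · exact ENNReal.ofReal_le_ofReal (Real.rpow_le_rpow_of_nonpos ht0 ht.2.le
            (neg_nonpos.2 (mul_nonneg hα.1 hq0.le)))
    · exact kFunctional_mono i j z ht.1
    · exact ht.2.le
  refine le_trans ?_ h4
  rw [setLIntegral_const, volume_Ico_two_zpow, ENNReal.mul_rpow_of_nonneg _ _ q.coe_nonneg,
    ENNReal.ofReal_rpow_of_pos (by positivity), ENNReal.mul_div_right_comm,
    ← ENNReal.ofReal_div_of_pos hn', mul_right_comm, ← ENNReal.ofReal_mul (by positivity),
    ← mul_assoc, show (4 : ℝ≥0∞) = ENNReal.ofReal 4 by simp,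
    ENNReal.ofReal_rpow_of_pos (by positivity), ← ENNReal.ofReal_mul (by positivity)]
  gcongr
  have e1 : (2 : ℝ) ^ (n + 1) = 2 * 2 ^ n := by rw [zpow_add_one₀ two_ne_zero, mul_comm]
  rw [e1, Real.mul_rpow (by positivity) hn.le, ← Real.rpow_mul (by positivity),
    ← Real.rpow_intCast, ← Real.rpow_mul (by positivity),
    show -(α * n) * (q : ℝ) = n * -(α * q) by ring]
  -- Evaluating the powers of t at the right end of the interval costs 2^(αq + 1), which is at most
  -- 4^q because α ≤ 1 and q ≥ 1. This is the source of the constant 4.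
  have e2 : (1 : ℝ) ≤ 4 ^ (q : ℝ) * (2 ^ (-(α * q)) / 2) := by
    rw [show (4 : ℝ) = 2 ^ (2 : ℝ) by norm_num, ← Real.rpow_mul (by positivity),
      ← Real.rpow_sub_one two_ne_zero, ← Real.rpow_add two_pos]
    refine Real.one_le_rpow one_le_two ?_
    have := mul_le_mul_of_nonneg_right hα.2 hq0.le
    linarith
  have e3 : (0 : ℝ) < 2 ^ ((n : ℝ) * -(α * q)) := by positivity
  calc (2 : ℝ) ^ ((n : ℝ) * -(α * q)) ≤ (4 ^ (q : ℝ) * (2 ^ (-(α * q)) / 2)) *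
        2 ^ ((n : ℝ) * -(α * q)) := le_mul_of_one_le_left e3.le e2
    _ = _ := by
      have : (2 : ℝ) ^ (n : ℝ) ≠ 0 := by positivity
      field_simp

end KFunctional

/-! ### Couples in which Y is mapped into X -/

section Embedded

variable {X Y : Type*} [NormedAddCommGroup X] [NormedSpace ℝ X]
  [NormedAddCommGroup Y] [NormedSpace ℝ Y] (j : Y →L[ℝ] X)

theorem kFunctional_id_eq (t : ℝ) (z : X) :
    kFunctional (.id ℝ X) j t z = ⨅ y : Y, (‖z - j y‖ₑ + ENNReal.ofReal t * ‖y‖ₑ) := by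
  refine le_antisymm (le_iInf fun y => kFunctional_le _ _ t _ y (by simp)) ?_
  refine le_iInf fun x => le_iInf fun y => le_iInf fun h => iInf_le_of_le y ?_
  rw [← h]
  simp

theorem kFunctional_id_le_sub (t : ℝ) (z : X) (y : Y) :
    kFunctional (.id ℝ X) j t z ≤ ‖z - j y‖ₑ + ENNReal.ofReal t * ‖y‖ₑ :=
  kFunctional_le _ _ t _ y (by simp)

theorem kFunctional_id_le_enorm (t : ℝ) (z : X) : kFunctional (.id ℝ X) j t z ≤ ‖z‖ₑ := by
  simpa using kFunctional_id_le_sub j t z 0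

theorem kFunctional_id_apply_le (t : ℝ) (y : Y) :
    kFunctional (.id ℝ X) j t (j y) ≤ ENNReal.ofReal t * ‖y‖ₑ := by
  simpa using kFunctional_id_le_sub j t (j y) y

theorem kFunctional_id_ne_top (t : ℝ) (z : X) : kFunctional (.id ℝ X) j t z ≠ ∞ :=
  ne_top_of_le_ne_top (by simp) (kFunctional_id_le_enorm j t z)

theorem kFunctional_sub_le (t : ℝ) (z w : X) :
    kFunctional (.id ℝ X) j t (z - w) ≤
      kFunctional (.id ℝ X) j t z + kFunctional (.id ℝ X) j t w := by
  rw [sub_eq_add_neg]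
  refine (kFunctional_add _ _ t _ _).trans ?_
  gcongr
  simpa using kFunctional_smul_le (.id ℝ X) j t (-1) w

/-- K is finite, so 2K exceeds the infimum unless K = 0; in that case z = 0, and y = 0 is a
minimizer. -/
theorem exists_near_minimizer {t : ℝ} (ht : 0 < t) (z : X) :
    ∃ y : Y, ‖z - j y‖ₑ + ENNReal.ofReal t * ‖y‖ₑ ≤ 2 * kFunctional (.id ℝ X) j t z := by
  rcases eq_or_ne (kFunctional (.id ℝ X) j t z) 0 with h0 | h0
  · obtain ⟨C, hC⟩ := enorm_le_kFunctional (.id ℝ X) j t ht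
    have := hC z
    rw [h0, mul_zero, nonpos_iff_eq_zero, enorm_eq_zero] at this
    exact ⟨0, by simp [this]⟩
  · have hlt : kFunctional (.id ℝ X) j t z < 2 * kFunctional (.id ℝ X) j t z := by
      rw [two_mul]
      exact ENNReal.lt_add_right (kFunctional_id_ne_top j t z) h0
    conv_lhs at hlt => rw [kFunctional_id_eq]
    obtain ⟨y, hy⟩ := iInf_lt_iff.1 hlt
    exact ⟨y, hy.le⟩

end Embedded

end RealInterpolation

namespace RealInterpolation

/-! ### Completeness of the interpolation space and density of Y -/

section Density

open Filter Topology

variable {X Y : Type*} [NormedAddCommGroup X] [NormedSpace ℝ X]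
  [NormedAddCommGroup Y] [NormedSpace ℝ Y] (j : Y →L[ℝ] X) {α : ℝ} {q : ℝ≥0}

theorem ofReal_mul_kFunctional_le_dyadicENorm {Z : Type*} [NormedAddCommGroup Z]
    [NormedSpace ℝ Z] (i : X →L[ℝ] Z) (j : Y →L[ℝ] Z) (hq : 1 ≤ q) (n : ℤ) (z : Z) :
    ENNReal.ofReal (2 ^ (-(α * n))) * kFunctional i j (2 ^ n) z ≤ dyadicENorm i j α q z := by
  have hq0 : (0 : ℝ) < q := lt_of_lt_of_le one_pos (by exact_mod_cast hq)
  unfold dyadicENorm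
  calc _ = ((ENNReal.ofReal (2 ^ (-(α * n))) * kFunctional i j (2 ^ n) z) ^ (q : ℝ))
        ^ (1 / (q : ℝ)) := by
        rw [← ENNReal.rpow_mul, mul_one_div_cancel hq0.ne', ENNReal.rpow_one]
    _ ≤ _ := ENNReal.rpow_le_rpow (ENNReal.le_tsum n) (by positivity)

theorem exists_enorm_le_interpENorm (hα : α ∈ Icc (0 : ℝ) 1) (hq : 1 ≤ q) :
    ∃ C : ℝ≥0, ∀ z : X, ‖z‖ₑ ≤ C * interpENorm (.id ℝ X) j α q z := by
  obtain ⟨C, hC⟩ := enorm_le_kFunctional (.id ℝ X) j 1 one_pos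
  refine ⟨C * 4, fun z => (hC z).trans ?_⟩
  push_cast
  rw [mul_assoc]
  gcongr
  have := ofReal_mul_kFunctional_le_dyadicENorm (α := α) (.id ℝ X) j hq 0 z
  simp only [Int.cast_zero, mul_zero, neg_zero, Real.rpow_zero, ENNReal.ofReal_one, one_mul,
    zpow_zero] at this
  exact this.trans (dyadicENorm_le_interpENorm _ j hα hq z)

theorem continuous_kFunctional_id (t : ℝ) : Continuous (kFunctional (.id ℝ X) j t) := by
  refine continuous_of_le_add_edist 1 (by simp) fun z w => ?_
  have := kFunctional_add (.id ℝ X) j t w (z - w)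
  rw [add_sub_cancel] at this
  rw [one_mul, edist_eq_enorm_sub]
  exact this.trans (add_le_add_right (kFunctional_id_le_enorm j t _) _)

/-- The dyadic norm is lower semicontinuous on X: it comes from a supremum of finite sums, each
continuous because K(t, ·) is 1-Lipschitz for the norm of X. -/
theorem isClosed_dyadicENorm_le (hq : 1 ≤ q) (c : ℝ≥0∞) :
    IsClosed {z : X | dyadicENorm (.id ℝ X) j α q z ≤ c} := by
  have hq0 : (0 : ℝ) < q := lt_of_lt_of_le one_pos (by exact_mod_cast hq)
  have h : {z : X | dyadicENorm (.id ℝ X) j α q z ≤ c} = ⋂ S : Finset ℤ, {z : X |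
      ∑ n ∈ S, (ENNReal.ofReal (2 ^ (-(α * n))) * kFunctional (.id ℝ X) j (2 ^ n) z) ^ (q : ℝ) ≤
        c ^ (q : ℝ)} := by
    ext z
    rw [mem_iInter]
    simp only [mem_ofPred_eq, dyadicENorm]
    rw [one_div, ENNReal.rpow_inv_le_iff hq0, ENNReal.tsum_eq_iSup_sum, iSup_le_iff]
  rw [h]
  refine isClosed_iInter fun S => isClosed_le ?_ continuous_const
  refine continuous_finsetSum _ fun n _ => ?_
  refine ENNReal.continuous_rpow_const.comp ?_
  exact ENNReal.continuous_const_mul ENNReal.ofReal_ne_top |>.comp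
    (continuous_kFunctional_id j _)

theorem RealInterp.enorm_def {Z : Type*} [NormedAddCommGroup Z] [NormedSpace ℝ Z]
    (i : X →L[ℝ] Z) (j : Y →L[ℝ] Z) [hq : Fact (1 ≤ q)] (z : RealInterp i j α q) :
    ‖z‖ₑ = interpENorm i j α q (RealInterp.subtype i j α q z) := by
  rw [← ofReal_norm, RealInterp.norm_def, ENNReal.ofReal_toReal]
  exact (RealInterp.interpENorm_lt_top i j α q z).ne

/-- An element of `X` of finite interpolation norm, as an element of `(X, Y)_{α, q}`. -/
def RealInterp.mk [hq : Fact (1 ≤ q)] (z : X) (hz : interpENorm (.id ℝ X) j α q z < ∞) :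
    RealInterp (.id ℝ X) j α q :=
  ⟨z, ⟨z, 0, by simp⟩, hz⟩

theorem RealInterp.subtype_mk [hq : Fact (1 ≤ q)] (z : X)
    (hz : interpENorm (.id ℝ X) j α q z < ∞) :
    RealInterp.subtype _ _ α q (RealInterp.mk j z hz) = z := rfl

/-- A Cauchy sequence converges in X, whose norm is the weaker one. Closedness of the dyadic
sublevel sets in X then carries the Cauchy estimates over to the limit. -/
theorem RealInterp.completeSpace [CompleteSpace X] (hα : α ∈ Icc (0 : ℝ) 1) [hq : Fact (1 ≤ q)] :
    CompleteSpace (RealInterp (.id ℝ X) j α q) := by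
  refine Metric.complete_of_cauchySeq_tendsto fun u hu => ?_
  obtain ⟨C, hC⟩ := exists_enorm_le_interpENorm j hα hq.out
  have hlip : LipschitzWith C (RealInterp.subtype (.id ℝ X) j α q) := fun z w => by
    rw [edist_eq_enorm_sub, edist_eq_enorm_sub, ← map_sub, RealInterp.enorm_def]
    exact hC _
  have hu' : CauchySeq fun n => RealInterp.subtype (.id ℝ X) j α q (u n) :=
    hlip.uniformContinuous.comp_cauchySeq hu
  obtain ⟨x, hx⟩ := cauchySeq_tendsto_of_complete hu'
  -- The factor 8 = 4 · 2 is the price of passing to the dyadic norm, where limits can be taken, and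
  -- back.
  have key : ∀ ε : ℝ≥0∞, 0 < ε → ∃ N, ∀ n ≥ N,
      interpENorm (.id ℝ X) j α q (x - RealInterp.subtype _ _ _ _ (u n)) ≤ 8 * ε := by
    intro ε hε
    obtain ⟨N, hN⟩ := EMetric.cauchySeq_iff.1 hu ε hε
    refine ⟨N, fun n hn => ?_⟩
    have h1 : dyadicENorm (.id ℝ X) j α q (x - RealInterp.subtype _ _ _ _ (u n)) ≤ 4 * ε := by
      have hcl := isClosed_dyadicENorm_le (α := α) j hq.out (4 * ε)
      refine hcl.mem_of_tendsto (hx.sub_const (RealInterp.subtype _ _ _ _ (u n))) ?_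
      filter_upwards [eventually_ge_atTop N] with m hm
      refine (dyadicENorm_le_interpENorm _ j hα hq.out _).trans ?_
      rw [← map_sub, ← RealInterp.enorm_def, ← edist_eq_enorm_sub]
      gcongr
      exact (hN m hm n hn).le
    calc _ ≤ 2 * dyadicENorm (.id ℝ X) j α q (x - RealInterp.subtype _ _ _ _ (u n)) :=
          interpENorm_le_dyadicENorm _ j hα.1 hq.out _
      _ ≤ 2 * (4 * ε) := by gcongr
      _ = 8 * ε := by rw [← mul_assoc]; norm_num
  obtain ⟨N, hN⟩ := key 1 one_pos
  have hxt : interpENorm (.id ℝ X) j α q x < ∞ := by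
    have h1 := interpENorm_add (.id ℝ X) j α q hq.out
      (x - RealInterp.subtype _ _ _ _ (u N)) (RealInterp.subtype _ _ _ _ (u N))
    rw [sub_add_cancel] at h1
    refine h1.trans_lt (ENNReal.add_lt_top.2 ⟨(hN N le_rfl).trans_lt (by simp), ?_⟩)
    exact RealInterp.interpENorm_lt_top _ _ α q _
  refine ⟨RealInterp.mk j x hxt, ?_⟩
  rw [EMetric.tendsto_atTop]
  intro ε hε
  obtain ⟨δ, hδ0, hδ⟩ : ∃ δ : ℝ≥0∞, 0 < δ ∧ 8 * δ < ε := by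
    rcases eq_or_ne ε ∞ with rfl | hε'
    · exact ⟨1, one_pos, by simp⟩
    · refine ⟨ε / 16, ENNReal.div_pos hε.ne' (by simp), ?_⟩
      have : (8 : ℝ≥0∞) * (ε / 16) = ε / 2 := by
        rw [show (16 : ℝ≥0∞) = 8 * 2 by norm_num, ← mul_div_assoc,
          ENNReal.mul_div_mul_left _ _ (by simp) (by simp)]
      rw [this]
      exact ENNReal.half_lt_self hε.ne' hε'
  obtain ⟨N, hN⟩ := key δ hδ0
  refine ⟨N, fun n hn => ?_⟩
  rw [edist_comm, edist_eq_enorm_sub, RealInterp.enorm_def, map_sub, RealInterp.subtype_mk]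
  exact (hN n hn).trans_lt hδ

theorem tendsto_kFunctional_two_zpow_neg (hα : 0 < α) (hq : 1 ≤ q) {z : X}
    (hz : dyadicENorm (.id ℝ X) j α q z ≠ ∞) :
    Tendsto (fun n : ℕ => kFunctional (.id ℝ X) j (2 ^ (-(n : ℤ))) z) atTop (𝓝 0) := by
  set D := dyadicENorm (.id ℝ X) j α q z
  have h1 : ∀ n : ℕ, kFunctional (.id ℝ X) j (2 ^ (-(n : ℤ))) z ≤
      ENNReal.ofReal ((2 ^ (-α)) ^ n) * D := fun n => by
    have h := ofReal_mul_kFunctional_le_dyadicENorm (α := α) (.id ℝ X) j hq (-(n : ℤ)) z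
    have h2 : (2 : ℝ) ^ (-(α * ((-(n : ℤ) : ℤ) : ℝ))) = ((2 ^ (-α)) ^ n)⁻¹ := by
      rw [← Real.rpow_natCast, ← Real.rpow_mul two_pos.le, ← Real.rpow_neg two_pos.le]
      push_cast
      congr 1; ring
    rw [h2, ENNReal.ofReal_inv_of_pos (by positivity)] at h
    have h3 := (ENNReal.inv_mul_le_iff (by simpa using by positivity) ENNReal.ofReal_ne_top).1 h
    exact h3
  have h0 : Tendsto (fun n : ℕ => ENNReal.ofReal (((2 : ℝ) ^ (-α)) ^ n) * D) atTop (𝓝 0) := by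
    have h2 : (2 : ℝ) ^ (-α) < 1 := Real.rpow_lt_one_of_one_lt_of_neg one_lt_two (by linarith)
    have h3 := ENNReal.tendsto_ofReal
      (tendsto_pow_atTop_nhds_zero_of_lt_one (by positivity : (0 : ℝ) ≤ 2 ^ (-α)) h2)
    have := ENNReal.Tendsto.mul_const h3 (Or.inr hz)
    simpa using this
  exact tendsto_of_tendsto_of_tendsto_of_le_of_le tendsto_const_nhds h0 (fun _ => zero_le) h1

/-- Subtracting a near minimizer at one scale t does not spoil K at any other scale τ. For τ ≥ t,
bound K by ‖z - jy‖ ≤ 2 K(t) ≤ 2 K(τ). For τ ≤ t, use K(τ, jy) ≤ τ ‖y‖ ≤ 2 (τ/t) K(t) ≤ 2 K(τ). -/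
theorem kFunctional_sub_near_minimizer_le {t : ℝ} (ht : 0 < t) {z : X} {y : Y}
    (hy : ‖z - j y‖ₑ + ENNReal.ofReal t * ‖y‖ₑ ≤ 2 * kFunctional (.id ℝ X) j t z)
    {τ : ℝ} (hτ : 0 < τ) :
    kFunctional (.id ℝ X) j τ (z - j y) ≤ 3 * kFunctional (.id ℝ X) j τ z := by
  have hx : ‖z - j y‖ₑ ≤ 2 * kFunctional (.id ℝ X) j t z := le_self_add.trans hy
  rcases le_total t τ with h | h
  · calc _ ≤ 2 * kFunctional (.id ℝ X) j t z := (kFunctional_id_le_enorm j τ _).trans hx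
      _ ≤ 3 * kFunctional (.id ℝ X) j τ z := by
        gcongr
        · norm_num
        · exact kFunctional_mono _ j z h
  · have hK : kFunctional (.id ℝ X) j t z ≤
        ENNReal.ofReal (t / τ) * kFunctional (.id ℝ X) j τ z := by
      have := kFunctional_mul_le (.id ℝ X) j ((one_le_div hτ).2 h) τ z
      rwa [div_mul_cancel₀ _ hτ.ne'] at this
    calc _ ≤ kFunctional (.id ℝ X) j τ z + kFunctional (.id ℝ X) j τ (j y) :=
          kFunctional_sub_le j τ _ _
      _ ≤ kFunctional (.id ℝ X) j τ z + ENNReal.ofReal τ * ‖y‖ₑ := by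
          gcongr; exact kFunctional_id_apply_le j τ y
      _ = kFunctional (.id ℝ X) j τ z + ENNReal.ofReal (τ / t) * (ENNReal.ofReal t * ‖y‖ₑ) := by
          rw [← mul_assoc, ← ENNReal.ofReal_mul (by positivity), div_mul_cancel₀ _ ht.ne']
      _ ≤ kFunctional (.id ℝ X) j τ z + ENNReal.ofReal (τ / t) *
            (2 * (ENNReal.ofReal (t / τ) * kFunctional (.id ℝ X) j τ z)) := by
          gcongr _ + _ * ?_
          exact (le_add_self.trans hy).trans (by gcongr)
      _ = _ := by
          rw [mul_left_comm, ← mul_assoc (ENNReal.ofReal (τ / t)),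
            ← ENNReal.ofReal_mul (by positivity),
            show τ / t * (t / τ) = 1 by field_simp, ENNReal.ofReal_one, one_mul,
            ← one_add_mul]
          norm_num

/-- Density of Y by dominated convergence, with y_n a near minimizer at scale 2^{-n}. The integrand
of z - j y_n is dominated by 3^q times that of z, and it tends to 0 pointwise because K(t, z - j
y_n) ≤ ‖z - j y_n‖ ≤ 2 K(2^{-n}, z) → 0. -/
theorem exists_interpENorm_sub_lt (hα : α ∈ Ioo (0 : ℝ) 1) (hq : 1 ≤ q) {z : X}
    (hz : interpENorm (.id ℝ X) j α q z < ∞) {ε : ℝ≥0∞} (hε : 0 < ε) :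
    ∃ y : Y, interpENorm (.id ℝ X) j α q (z - j y) < ε := by
  have hq0 : (0 : ℝ) < q := lt_of_lt_of_le one_pos (by exact_mod_cast hq)
  have hpos : ∀ n : ℕ, (0 : ℝ) < 2 ^ (-(n : ℤ)) := fun n => by positivity
  choose y hy using fun n : ℕ => exists_near_minimizer j (hpos n) z
  have hd : dyadicENorm (.id ℝ X) j α q z ≠ ∞ :=
    ne_top_of_le_ne_top (ENNReal.mul_ne_top (by simp) hz.ne)
      (dyadicENorm_le_interpENorm _ j ⟨hα.1.le, hα.2.le⟩ hq z)
  have hK0 := tendsto_kFunctional_two_zpow_neg j hα.1 hq hd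
  have hlim : Tendsto (fun n => interpENorm (.id ℝ X) j α q (z - j (y n))) atTop (𝓝 0) := by
    simp only [interpENorm_eq _ _ α q hq] at hz ⊢
    set w : ℝ → ℝ≥0∞ := fun t => ENNReal.ofReal (t ^ (-α - 1 / (q : ℝ)))
    have hwm : Measurable w := by fun_prop
    have hfin : ∫⁻ t in Ioi (0 : ℝ), (w t * kFunctional (.id ℝ X) j t z) ^ (q : ℝ) ≠ ∞ := by
      intro h
      rw [h, ENNReal.top_rpow_of_pos (by positivity)] at hz
      exact hz.ne rfl
    have h1 : Tendsto (fun n => ∫⁻ t in Ioi (0 : ℝ),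
        (w t * kFunctional (.id ℝ X) j t (z - j (y n))) ^ (q : ℝ)) atTop
        (𝓝 (∫⁻ t in Ioi (0 : ℝ), 0)) := by
      refine tendsto_lintegral_of_dominated_convergence
        (fun t => 3 ^ (q : ℝ) * (w t * kFunctional (.id ℝ X) j t z) ^ (q : ℝ)) ?_ ?_ ?_ ?_
      · exact fun n => (hwm.mul (kFunctional_mono _ j _).measurable).pow_const _
      · intro n
        filter_upwards [ae_restrict_mem measurableSet_Ioi] with t ht
        rw [← ENNReal.mul_rpow_of_nonneg _ _ hq0.le, mul_left_comm]
        gcongr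
        exact kFunctional_sub_near_minimizer_le j (hpos n) (hy n) ht
      · rw [lintegral_const_mul' _ _ (by simp)]
        exact ENNReal.mul_ne_top (by simp) hfin
      · refine Eventually.of_forall fun t => ?_
        have h2 : Tendsto (fun n => kFunctional (.id ℝ X) j t (z - j (y n))) atTop (𝓝 0) := by
          have h3 := ENNReal.Tendsto.const_mul (a := 2) hK0 (Or.inr (by simp))
          rw [mul_zero] at h3
          refine tendsto_of_tendsto_of_tendsto_of_le_of_le tendsto_const_nhds h3
            (fun _ => zero_le) fun n => ?_
          exact (kFunctional_id_le_enorm j t _).trans (le_self_add.trans (hy n))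
        have h3 := ENNReal.Tendsto.const_mul (a := w t) h2 (Or.inr ENNReal.ofReal_ne_top)
        rw [mul_zero] at h3
        have h4 := (ENNReal.continuous_rpow_const (y := (q : ℝ))).tendsto 0 |>.comp h3
        rwa [ENNReal.zero_rpow_of_pos hq0] at h4
    rw [lintegral_zero] at h1
    have h4 := (ENNReal.continuous_rpow_const (y := (1 / (q : ℝ)))).tendsto 0 |>.comp h1
    rwa [ENNReal.zero_rpow_of_pos (by positivity)] at h4
  obtain ⟨n, hn⟩ := (hlim.eventually (gt_mem_nhds hε)).exists
  exact ⟨y n, hn⟩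

end Density

end RealInterpolation

namespace RealInterpolation

/-! ### Young's inequality on ℤ and superposition of elements of Y -/

section Young

/-- The kernel `2 ^ (-α l) min(1, 2 ^ l)` on `ℤ`. -/
noncomputable def dyadicKernel (α : ℝ) (l : ℤ) : ℝ≥0∞ :=
  ENNReal.ofReal (2 ^ (-(α * l)) * min 1 (2 ^ l))

/-- The sum of the kernel `2 ^ (-α l) min(1, 2 ^ l)` over `ℤ`. -/
noncomputable def dyadicKernelSum (α : ℝ) : ℝ≥0∞ := ∑' l : ℤ, dyadicKernel α l

/-- A geometric series on each side: of ratio 2^{-α} for l ≥ 0 and 2^{α-1} for l ≤ 0. Both endpoints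
α = 0, 1 must be excluded. -/
theorem dyadicKernelSum_ne_top {α : ℝ} (hα : α ∈ Ioo (0 : ℝ) 1) : dyadicKernelSum α ≠ ∞ := by
  have hs : Summable fun l : ℤ => (2 : ℝ) ^ (-(α * l)) * min 1 (2 ^ l) := by
    refine Summable.of_nat_of_neg ?_ ?_
    · have h2 : (2 : ℝ) ^ (-α) < 1 := Real.rpow_lt_one_of_one_lt_of_neg one_lt_two (by linarith [hα.1])
      refine (summable_geometric_of_lt_one (by positivity) h2).congr fun n => ?_
      rw [min_eq_left, mul_one, ← Real.rpow_natCast, ← Real.rpow_mul two_pos.le]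
      · congr 1; push_cast; ring
      · exact one_le_zpow₀ one_le_two (by positivity)
    · have h2 : (2 : ℝ) ^ (α - 1) < 1 :=
        Real.rpow_lt_one_of_one_lt_of_neg one_lt_two (by linarith [hα.2])
      refine (summable_geometric_of_lt_one (by positivity) h2).congr fun n => ?_
      rw [min_eq_right, ← Real.rpow_natCast, ← Real.rpow_mul two_pos.le, ← Real.rpow_intCast,
        ← Real.rpow_add two_pos]
      · congr 1; push_cast; ring
      · exact zpow_le_one_of_nonpos₀ one_le_two (by simp)
  exact hs.tsum_ofReal_ne_top

/-- Young's inequality ℓ¹ * ℓ^p → ℓ^p: apply Hölder with the kernel as weight, then exchange the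
sums. Every translate of the kernel has the same total mass. -/
theorem tsum_sum_dyadicKernel_le {α : ℝ} {p : ℝ} (hp : 1 ≤ p) (S : Finset ℤ) (b : ℤ → ℝ≥0∞) :
    (∑' m : ℤ, (∑ n ∈ S, dyadicKernel α (m - n) * b n) ^ p) ^ (1 / p) ≤
      dyadicKernelSum α * (∑ n ∈ S, b n ^ p) ^ (1 / p) := by
  have hp0 : 0 < p := one_pos.trans_le hp
  set κ := dyadicKernelSum α with hκ
  have hsum : ∀ n : ℤ, ∑' m : ℤ, dyadicKernel α (m - n) = κ := fun n =>
    (Equiv.subRight n).tsum_eq (dyadicKernel α)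
  have hfin : ∀ m : ℤ, ∑ n ∈ S, dyadicKernel α (m - n) ≤ κ := fun m => by
    refine (ENNReal.sum_le_tsum S).trans (le_of_eq ?_)
    exact (Equiv.subLeft m).tsum_eq (dyadicKernel α)
  have hpt : ∀ m : ℤ, (∑ n ∈ S, dyadicKernel α (m - n) * b n) ^ p ≤
      κ ^ (p - 1) * ∑ n ∈ S, dyadicKernel α (m - n) * b n ^ p := fun m => by
    have h := ENNReal.inner_le_weight_mul_Lp_of_nonneg S hp (fun n => dyadicKernel α (m - n)) b
    calc _ ≤ ((∑ n ∈ S, dyadicKernel α (m - n)) ^ (1 - p⁻¹) *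
          (∑ n ∈ S, dyadicKernel α (m - n) * b n ^ p) ^ p⁻¹) ^ p := by gcongr
      _ = (∑ n ∈ S, dyadicKernel α (m - n)) ^ (p - 1) *
          (∑ n ∈ S, dyadicKernel α (m - n) * b n ^ p) := by
          rw [ENNReal.mul_rpow_of_nonneg _ _ hp0.le, ← ENNReal.rpow_mul, ← ENNReal.rpow_mul,
            inv_mul_cancel₀ hp0.ne', ENNReal.rpow_one, sub_mul, one_mul, inv_mul_cancel₀ hp0.ne']
      _ ≤ _ := by
          have : 0 ≤ p - 1 := by linarith
          gcongr
          exact hfin m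
  calc _ ≤ (∑' m : ℤ, κ ^ (p - 1) * ∑ n ∈ S, dyadicKernel α (m - n) * b n ^ p) ^ (1 / p) := by
        gcongr with m
        exact hpt m
    _ = (κ ^ p * ∑ n ∈ S, b n ^ p) ^ (1 / p) := by
        congr 1
        rw [ENNReal.tsum_mul_left, Summable.tsum_finsetSum (fun _ _ => ENNReal.summable)]
        simp only [ENNReal.tsum_mul_right, hsum]
        rw [← Finset.mul_sum, ← mul_assoc]
        congr 1
        conv_rhs => rw [← sub_add_cancel p 1,
          ENNReal.rpow_add_of_nonneg _ _ (by linarith) zero_le_one, ENNReal.rpow_one]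
    _ = _ := by
        rw [ENNReal.mul_rpow_of_nonneg _ _ (by positivity), ← ENNReal.rpow_mul,
          mul_one_div_cancel hp0.ne', ENNReal.rpow_one]

variable {X Y : Type*} [NormedAddCommGroup X] [NormedSpace ℝ X]
  [NormedAddCommGroup Y] [NormedSpace ℝ Y] (j : Y →L[ℝ] X) {α : ℝ} {p : ℝ≥0}

theorem kFunctional_sum_le {ι : Type*} (t : ℝ) (S : Finset ι) (z : ι → X) :
    kFunctional (.id ℝ X) j t (∑ n ∈ S, z n) ≤ ∑ n ∈ S, kFunctional (.id ℝ X) j t (z n) := by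
  classical
  induction S using Finset.induction_on with
  | empty => simpa using kFunctional_id_le_enorm j t 0
  | insert a S ha ih =>
    rw [Finset.sum_insert ha, Finset.sum_insert ha]
    exact (kFunctional_add _ _ t _ _).trans (by gcongr)

/-- This is the bound of the K-norm by the J-norm. The hypotheses give K(2^m, j y_n) ≤ min(2^n,
2^m); after multiplication by 2^{-αm} 2^{-(1-α)n} this is the kernel at m - n, so the dyadic norm is
controlled by a convolution with b. -/
theorem dyadicENorm_sum_le (hp : 1 ≤ p) (S : Finset ℤ) (b : ℤ → ℝ≥0) {y : ℤ → Y}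
    (hY : ∀ n ∈ S, ‖y n‖ₑ ≤ 1) (hX : ∀ n ∈ S, ‖j (y n)‖ₑ ≤ ENNReal.ofReal (2 ^ n)) :
    dyadicENorm (.id ℝ X) j α p
        (j (∑ n ∈ S, ((2 : ℝ) ^ (-((1 - α) * n)) * b n) • y n)) ≤
      dyadicKernelSum α * (∑ n ∈ S, (b n : ℝ≥0∞) ^ (p : ℝ)) ^ (1 / (p : ℝ)) := by
  have hp1 : (1 : ℝ) ≤ p := by exact_mod_cast hp
  refine le_trans ?_ (tsum_sum_dyadicKernel_le hp1 S fun n => b n)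
  unfold dyadicENorm
  gcongr with m
  rw [map_sum]
  refine (mul_le_mul_right (kFunctional_sum_le j _ S _) _).trans ?_
  rw [Finset.mul_sum]
  refine Finset.sum_le_sum fun n hn => ?_
  have hK : kFunctional (.id ℝ X) j (2 ^ m) (j (y n)) ≤ ENNReal.ofReal (min (2 ^ n) (2 ^ m)) := by
    rw [ENNReal.ofReal_min]
    refine le_min ((kFunctional_id_le_enorm j _ _).trans (hX n hn)) ?_
    exact (kFunctional_id_apply_le j _ _).trans (mul_le_of_le_one_right' (hY n hn))
  calc _ ≤ ENNReal.ofReal (2 ^ (-(α * m))) * (‖(2 : ℝ) ^ (-((1 - α) * n)) * b n‖ₑ *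
        ENNReal.ofReal (min (2 ^ n) (2 ^ m))) := by
        gcongr
        rw [map_smul]
        exact (kFunctional_smul_le _ _ _ _ _).trans (by gcongr)
    _ = _ := by
        rw [dyadicKernel, enorm_mul, Real.enorm_of_nonneg (by positivity), NNReal.enorm_eq,
          mul_right_comm, ← mul_assoc, ← ENNReal.ofReal_mul (by positivity),
          ← ENNReal.ofReal_mul (by positivity)]
        refine congrArg (fun r => ENNReal.ofReal r * (b n : ℝ≥0∞)) ?_
        have e : (2 : ℝ) ^ m = 2 ^ n * 2 ^ (m - n) := by rw [← zpow_add₀ two_ne_zero]; congr 1; ring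
        have hmin : min ((2 : ℝ) ^ n) (2 ^ m) = 2 ^ n * min 1 (2 ^ (m - n)) := by
          rw [mul_min_of_nonneg _ _ (by positivity), mul_one, ← e]
        rw [hmin, ← mul_assoc, ← mul_assoc]
        congr 1
        rw [← Real.rpow_intCast 2 n, ← Real.rpow_add two_pos, ← Real.rpow_add two_pos]
        congr 1; push_cast; ring

/-- Continuity of Y → (X, Y)_{α,p}: the superposition bound for a single term, at an index k with
‖j‖ < 2^k, so that a unit vector satisfies both hypotheses. -/
theorem exists_interpENorm_apply_le (hα : α ∈ Ioo (0 : ℝ) 1) (hp : 1 ≤ p) :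
    ∃ C : ℝ≥0, ∀ y : Y, interpENorm (.id ℝ X) j α p (j y) ≤ C * ‖y‖ₑ := by
  obtain ⟨k, hk⟩ := pow_unbounded_of_one_lt ‖j‖ (one_lt_two (α := ℝ))
  have hp0 : (0 : ℝ) < p := lt_of_lt_of_le one_pos (by exact_mod_cast hp)
  set w : ℝ := (2 : ℝ) ^ (-((1 - α) * ((k : ℤ) : ℝ)))
  have hw : 0 < w := by positivity
  have hunit : ∀ y : Y, ‖y‖ₑ ≤ 1 → interpENorm (.id ℝ X) j α p (j (w • y)) ≤
      2 * dyadicKernelSum α := fun y hy => by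
    have h := dyadicENorm_sum_le (α := α) (p := p) j hp {(k : ℤ)} (fun _ => 1) (y := fun _ => y)
      (fun _ _ => hy) (fun n hn => by
        rw [Finset.mem_singleton.1 hn, zpow_natCast]
        refine (j.le_opENorm y).trans ((mul_le_of_le_one_right' hy).trans ?_)
        rw [← ofReal_norm]
        exact ENNReal.ofReal_le_ofReal hk.le)
    simp only [Finset.sum_singleton, NNReal.coe_one, mul_one, ENNReal.coe_one, ENNReal.one_rpow]
      at h
    refine (interpENorm_le_dyadicENorm _ j hα.1.le hp _).trans ?_
    gcongr
  refine ⟨(ENNReal.ofReal w⁻¹ * (2 * dyadicKernelSum α)).toNNReal, fun y => ?_⟩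
  rw [ENNReal.coe_toNNReal (ENNReal.mul_ne_top ENNReal.ofReal_ne_top
    (ENNReal.mul_ne_top (by simp) (dyadicKernelSum_ne_top hα)))]
  rcases eq_or_ne y 0 with rfl | hy
  · simp [interpENorm_zero _ _ _ _ hp]
  have hy0 : 0 < ‖y‖ := norm_pos_iff.2 hy
  have h1 := hunit (‖y‖⁻¹ • y) (by
    rw [enorm_smul, ← ofReal_norm, ← ofReal_norm, ← ENNReal.ofReal_mul (by positivity)]
    simp [hy])
  have h2 : j y = (‖y‖ * w⁻¹) • j (w • ‖y‖⁻¹ • y) := by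
    rw [← map_smul, smul_smul, smul_smul]
    congr 1
    rw [show ‖y‖ * w⁻¹ * w * ‖y‖⁻¹ = 1 by field_simp, one_smul]
  rw [h2]
  refine (interpENorm_smul_le _ _ _ _ hp _ _).trans ?_
  calc _ ≤ ‖‖y‖ * w⁻¹‖ₑ * (2 * dyadicKernelSum α) := by gcongr
    _ = _ := by
        rw [Real.enorm_of_nonneg (by positivity), ENNReal.ofReal_mul (by positivity), ofReal_norm]
        ring

end Young

/-! ### Duality, first half: elements of (Y*, X*)_{β,q} act on the interpolation space -/

section Duality

open Filter Topology

variable {X Y G : Type*} [NormedAddCommGroup X] [NormedSpace ℝ X]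
  [NormedAddCommGroup Y] [NormedSpace ℝ Y] [NormedAddCommGroup G] [NormedSpace ℝ G]
  (j : Y →L[ℝ] X) (P : G →L[ℝ] StrongDual ℝ X)

/-- The embedding of `G ≃ X*` in `Y*` dual to `j : Y → X`. -/
noncomputable def dualEmb : G →L[ℝ] StrongDual ℝ Y := (ContinuousLinearMap.precomp ℝ j).comp P

theorem dualEmb_apply (g : G) (y : Y) : dualEmb j P g y = P g (j y) := rfl

variable {j P}

/-- K on the dual side pairs with ‖y‖ + ‖jy‖/t on the side of Y: split f by a near minimizer g and
let the two parts act on y and on jy. The 2 comes from the near minimizer. -/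
theorem enorm_apply_le_kFunctional (hP : ∀ g x, ‖P g x‖ₑ ≤ ‖g‖ₑ * ‖x‖ₑ) (f : StrongDual ℝ Y)
    {t : ℝ} (ht : 0 < t) (y : Y) :
    ‖f y‖ₑ ≤ kFunctional (.id ℝ (StrongDual ℝ Y)) (dualEmb j P) t f *
      (2 * (‖y‖ₑ + ENNReal.ofReal t⁻¹ * ‖j y‖ₑ)) := by
  obtain ⟨g, hg⟩ := exists_near_minimizer (dualEmb j P) ht f
  set K := kFunctional (.id ℝ (StrongDual ℝ Y)) (dualEmb j P) t f
  have h1 : ‖f - dualEmb j P g‖ₑ ≤ 2 * K := le_self_add.trans hg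
  have h2 : ‖g‖ₑ ≤ ENNReal.ofReal t⁻¹ * (2 * K) := by
    calc ‖g‖ₑ = ENNReal.ofReal t⁻¹ * (ENNReal.ofReal t * ‖g‖ₑ) := by
          rw [← mul_assoc, ← ENNReal.ofReal_mul (by positivity), inv_mul_cancel₀ ht.ne']
          simp
      _ ≤ _ := by gcongr _ * ?_; exact le_add_self.trans hg
  have h3 : f y = (f - dualEmb j P g) y + P g (j y) := by
    rw [sub_apply, dualEmb_apply]; ring
  calc ‖f y‖ₑ ≤ ‖(f - dualEmb j P g) y‖ₑ + ‖P g (j y)‖ₑ := by rw [h3]; exact enorm_add_le _ _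
    _ ≤ ‖f - dualEmb j P g‖ₑ * ‖y‖ₑ + ‖g‖ₑ * ‖j y‖ₑ :=
        add_le_add (ContinuousLinearMap.le_opENorm _ _) (hP g _)
    _ ≤ (2 * K) * ‖y‖ₑ + (ENNReal.ofReal t⁻¹ * (2 * K)) * ‖j y‖ₑ := by gcongr
    _ = _ := by ring

/-- Near minimizers u_n of K(2^n, jy) cut y into increments, small in Y and in X at the same scale.
The lower end y - u_{-M} contributes at most 10 K(2^{-M}, f) ‖y‖, and the upper end u_M at most a
multiple of 2^{-M}; both vanish as M → ∞. The constant is 20 = 2 (4 + 6), where 4 and 6 bound an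
increment in Y and in X. -/
theorem enorm_apply_le_dyadicENorm (hP : ∀ g x, ‖P g x‖ₑ ≤ ‖g‖ₑ * ‖x‖ₑ) {β : ℝ}
    (hβ : β ∈ Ioo (0 : ℝ) 1) {q p : ℝ≥0} (hqp : q.HolderConjugate p) {f : StrongDual ℝ Y}
    (hf : dyadicENorm (.id ℝ (StrongDual ℝ Y)) (dualEmb j P) β q f ≠ ∞) (y : Y) :
    ‖f y‖ₑ ≤ 20 * (dyadicENorm (.id ℝ (StrongDual ℝ Y)) (dualEmb j P) β q f *
      dyadicENorm (.id ℝ X) j (1 - β) p (j y)) := by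
  have hq : 1 ≤ q := hqp.lt.le
  have hqp' : (q : ℝ).HolderConjugate p := by exact_mod_cast hqp
  set Kf := fun n : ℤ => kFunctional (.id ℝ (StrongDual ℝ Y)) (dualEmb j P) (2 ^ n) f with hKf
  set Ky := fun n : ℤ => kFunctional (.id ℝ X) j (2 ^ n) (j y) with hKy
  have hpos : ∀ n : ℤ, (0 : ℝ) < 2 ^ n := fun n => by positivity
  have hinv : ∀ n : ℤ, ENNReal.ofReal ((2 : ℝ) ^ n)⁻¹ * ENNReal.ofReal (2 ^ n) = 1 := fun n => by
    rw [← ENNReal.ofReal_mul (by positivity), inv_mul_cancel₀ (hpos n).ne', ENNReal.ofReal_one]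
  choose u hu using fun n : ℤ => exists_near_minimizer j (hpos n) (j y)
  have hux : ∀ n, ‖j (y - u n)‖ₑ ≤ 2 * Ky n := fun n => by
    rw [map_sub]; exact le_self_add.trans (hu n)
  have huy : ∀ n, ‖u n‖ₑ ≤ ENNReal.ofReal (2 ^ n)⁻¹ * (2 * Ky n) := fun n => by
    calc ‖u n‖ₑ = ENNReal.ofReal (2 ^ n)⁻¹ * (ENNReal.ofReal (2 ^ n) * ‖u n‖ₑ) := by
          rw [← mul_assoc, hinv, one_mul]
      _ ≤ _ := by gcongr _ * ?_; exact le_add_self.trans (hu n)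
  have hKsucc : ∀ n, Ky (n + 1) ≤ 2 * Ky n := fun n => by
    have := kFunctional_mul_le (.id ℝ X) j one_le_two (2 ^ n) (j y)
    rwa [← zpow_one_add₀ two_ne_zero, add_comm 1 n, ENNReal.ofReal_ofNat] at this
  -- the three parts of the telescoping sum
  have hmid : ∀ n, ‖f (u n - u (n + 1))‖ₑ ≤ 20 * (ENNReal.ofReal (2 ^ n)⁻¹ * (Kf n * Ky n)) := by
    intro n
    have h1 : ‖u (n + 1)‖ₑ ≤ ENNReal.ofReal (2 ^ n)⁻¹ * (2 * Ky n) := by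
      refine (huy (n + 1)).trans ?_
      have e : ENNReal.ofReal ((2 : ℝ) ^ (n + 1))⁻¹ * 2 = ENNReal.ofReal (2 ^ n)⁻¹ := by
        rw [← ENNReal.ofReal_ofNat 2, ← ENNReal.ofReal_mul (by positivity)]
        congr 1
        rw [zpow_add_one₀ two_ne_zero]
        field_simp
      rw [← mul_assoc, e]
      gcongr
      exact hKsucc n
    have h2 : ‖u n - u (n + 1)‖ₑ ≤ 4 * (ENNReal.ofReal (2 ^ n)⁻¹ * Ky n) := by
      refine enorm_sub_le.trans ((add_le_add (huy n) h1).trans (le_of_eq ?_))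
      ring
    have h3 : ‖j (u n - u (n + 1))‖ₑ ≤ 6 * Ky n := by
      rw [show u n - u (n + 1) = (y - u (n + 1)) - (y - u n) by abel, map_sub]
      refine enorm_sub_le.trans ((add_le_add ((hux (n + 1)).trans
        (mul_le_mul_right (hKsucc n) 2)) (hux n)).trans (le_of_eq ?_))
      ring
    refine (enorm_apply_le_kFunctional (j := j) hP f (hpos n) _).trans ?_
    calc _ ≤ Kf n * (2 * (4 * (ENNReal.ofReal (2 ^ n)⁻¹ * Ky n) +
          ENNReal.ofReal (2 ^ n)⁻¹ * (6 * Ky n))) := by gcongr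
      _ = _ := by ring
  have hlow : ∀ n, ‖f (y - u n)‖ₑ ≤ 10 * (Kf n * ‖y‖ₑ) := fun n => by
    have hK1 : ENNReal.ofReal (2 ^ n)⁻¹ * Ky n ≤ ‖y‖ₑ := by
      calc _ ≤ ENNReal.ofReal (2 ^ n)⁻¹ * (ENNReal.ofReal (2 ^ n) * ‖y‖ₑ) := by
            gcongr; exact kFunctional_id_apply_le j _ y
        _ = _ := by rw [← mul_assoc, hinv, one_mul]
    have h1 : ‖y - u n‖ₑ ≤ 3 * ‖y‖ₑ := by
      refine enorm_sub_le.trans ?_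
      calc _ ≤ ‖y‖ₑ + 2 * ‖y‖ₑ := by
            gcongr
            refine (huy n).trans ?_
            rw [mul_left_comm]
            gcongr
        _ = _ := by ring
    refine (enorm_apply_le_kFunctional (j := j) hP f (hpos n) _).trans ?_
    calc _ ≤ Kf n * (2 * (3 * ‖y‖ₑ + ENNReal.ofReal (2 ^ n)⁻¹ * (2 * Ky n))) := by
          gcongr; exact hux n
      _ = Kf n * (2 * (3 * ‖y‖ₑ + 2 * (ENNReal.ofReal (2 ^ n)⁻¹ * Ky n))) := by ring
      _ ≤ Kf n * (2 * (3 * ‖y‖ₑ + 2 * ‖y‖ₑ)) := by gcongr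
      _ = _ := by ring
  have hhigh : ∀ n, ‖f (u n)‖ₑ ≤ ENNReal.ofReal (2 ^ n)⁻¹ * (2 * (‖f‖ₑ * ‖j y‖ₑ)) := fun n => by
    calc _ ≤ ‖f‖ₑ * ‖u n‖ₑ := f.le_opENorm _
      _ ≤ ‖f‖ₑ * (ENNReal.ofReal (2 ^ n)⁻¹ * (2 * ‖j y‖ₑ)) := by
          gcongr
          exact (huy n).trans (by gcongr; exact kFunctional_id_le_enorm j _ _)
      _ = _ := by ring
  set R := dyadicENorm (.id ℝ (StrongDual ℝ Y)) (dualEmb j P) β q f *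
      dyadicENorm (.id ℝ X) j (1 - β) p (j y) with hR
  -- The weight 2^{-n} splits as 2^{-βn} · 2^{-(1-β)n}, one factor for each dyadic norm, so Hölder
  -- with exponents q, p applies. The indices k - M run over -M, …, M - 1.
  have hholder : ∀ M : ℕ, ∑ k ∈ Finset.range (2 * M), ENNReal.ofReal (2 ^ ((k : ℤ) - M))⁻¹ *
      (Kf (k - M) * Ky (k - M)) ≤ R := fun M => by
    have hinj : Function.Injective fun k : ℕ => (k : ℤ) - M := fun a b h => by
      simpa using h
    set F : ℤ → ℝ≥0∞ := fun n => ENNReal.ofReal (2 ^ (-(β * n))) * Kf n with hF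
    set H : ℤ → ℝ≥0∞ := fun n => ENNReal.ofReal (2 ^ (-((1 - β) * n))) * Ky n with hH
    have e : ∀ n : ℤ, ENNReal.ofReal (2 ^ n)⁻¹ * (Kf n * Ky n) = F n * H n := fun n => by
      have : ((2 : ℝ) ^ n)⁻¹ = 2 ^ (-(β * n)) * 2 ^ (-((1 - β) * n)) := by
        rw [← Real.rpow_add two_pos, ← Real.rpow_intCast, ← Real.rpow_neg two_pos.le]
        congr 1; ring
      rw [this, ENNReal.ofReal_mul (by positivity)]
      simp only [hF, hH]
      ring
    simp only [e]
    refine (ENNReal.inner_le_Lp_mul_Lq _ (fun k : ℕ => F (k - M)) (fun k : ℕ => H (k - M))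
      hqp').trans ?_
    have hle : ∀ (r : ℝ≥0) (F : ℤ → ℝ≥0∞), (∑ k ∈ Finset.range (2 * M), F (k - M) ^ (r : ℝ)) ≤
        ∑' n : ℤ, F n ^ (r : ℝ) := fun r F =>
      (ENNReal.sum_le_tsum _).trans
        (ENNReal.tsum_comp_le_tsum_of_injective hinj fun n => F n ^ (r : ℝ))
    exact mul_le_mul' (ENNReal.rpow_le_rpow (hle q F) (by positivity))
      (ENNReal.rpow_le_rpow (hle p H) (by positivity))
  have hbound : ∀ M : ℕ, ‖f y‖ₑ ≤ 10 * (Kf (-(M : ℤ)) * ‖y‖ₑ) + 20 * R +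
      ENNReal.ofReal (2 ^ (M : ℤ))⁻¹ * (2 * (‖f‖ₑ * ‖j y‖ₑ)) := fun M => by
    have htel : y = (y - u (-(M : ℤ))) + (∑ k ∈ Finset.range (2 * M),
        (u ((k : ℤ) - M) - u ((k : ℤ) - M + 1))) + u M := by
      have := Finset.sum_range_sub' (fun k : ℕ => u ((k : ℤ) - M)) (2 * M)
      push_cast at this
      rw [show (2 * M : ℤ) - M = M by ring, zero_sub] at this
      simp only [add_sub_right_comm] at this
      rw [this]
      abel
    have hsum : ‖∑ k ∈ Finset.range (2 * M), f (u ((k : ℤ) - M) - u ((k : ℤ) - M + 1))‖ₑ ≤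
        20 * R := by
      refine (enorm_sum_le _ _).trans ?_
      calc _ ≤ ∑ k ∈ Finset.range (2 * M), 20 * (ENNReal.ofReal (2 ^ ((k : ℤ) - M))⁻¹ *
            (Kf (k - M) * Ky (k - M))) := Finset.sum_le_sum fun k _ => hmid _
        _ ≤ _ := by rw [← Finset.mul_sum]; gcongr; exact hholder M
    conv_lhs => rw [htel, map_add, map_add, map_sum]
    exact (enorm_add_le _ _).trans (add_le_add ((enorm_add_le _ _).trans
      (add_le_add (hlow _) hsum)) (hhigh _))
  have hK0 := tendsto_kFunctional_two_zpow_neg (dualEmb j P) hβ.1 hq hf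
  have hlim1 : Tendsto (fun M : ℕ => 10 * (Kf (-(M : ℤ)) * ‖y‖ₑ)) atTop (𝓝 0) := by
    have := ENNReal.Tendsto.const_mul (a := 10)
      (ENNReal.Tendsto.mul_const (b := ‖y‖ₑ) hK0 (Or.inr (by simp))) (Or.inr (by simp))
    rwa [zero_mul, mul_zero] at this
  have hlim2 : Tendsto (fun M : ℕ => ENNReal.ofReal (2 ^ (M : ℤ))⁻¹ * (2 * (‖f‖ₑ * ‖j y‖ₑ)))
      atTop (𝓝 0) := by
    have h1 : Tendsto (fun M : ℕ => ENNReal.ofReal ((2 : ℝ) ^ (M : ℤ))⁻¹) atTop (𝓝 0) := by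
      have := ENNReal.tendsto_ofReal (tendsto_pow_atTop_nhds_zero_of_lt_one
        (by norm_num : (0 : ℝ) ≤ 2⁻¹) (by norm_num))
      simpa using this
    have := ENNReal.Tendsto.mul_const (b := 2 * (‖f‖ₑ * ‖j y‖ₑ)) h1 (Or.inr (by finiteness))
    simpa using this
  have hlim := (hlim1.add_const (20 * R)).add hlim2
  rw [zero_add, add_zero] at hlim
  exact ge_of_tendsto' hlim hbound

/-- The constant is 20 · 4 · 4, each 4 being the cost of passing from an integral norm to its dyadic
version. -/
theorem enorm_apply_le_interpENorm (hP : ∀ g x, ‖P g x‖ₑ ≤ ‖g‖ₑ * ‖x‖ₑ) {β : ℝ}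
    (hβ : β ∈ Ioo (0 : ℝ) 1) {q p : ℝ≥0} (hqp : q.HolderConjugate p) {f : StrongDual ℝ Y}
    (hf : interpENorm (.id ℝ (StrongDual ℝ Y)) (dualEmb j P) β q f ≠ ∞) (y : Y) :
    ‖f y‖ₑ ≤ 320 * (interpENorm (.id ℝ (StrongDual ℝ Y)) (dualEmb j P) β q f *
      interpENorm (.id ℝ X) j (1 - β) p (j y)) := by
  have h1 := dyadicENorm_le_interpENorm (.id ℝ (StrongDual ℝ Y)) (dualEmb j P)
    ⟨hβ.1.le, hβ.2.le⟩ hqp.lt.le f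
  have h2 := dyadicENorm_le_interpENorm (.id ℝ X) j (α := 1 - β)
    ⟨by linarith [hβ.2], by linarith [hβ.1]⟩ hqp.symm.lt.le (j y)
  refine (enorm_apply_le_dyadicENorm hP hβ hqp
    (ne_top_of_le_ne_top (ENNReal.mul_ne_top (by simp) hf) h1) y).trans ?_
  calc _ ≤ 20 * ((4 * interpENorm (.id ℝ (StrongDual ℝ Y)) (dualEmb j P) β q f) *
        (4 * interpENorm (.id ℝ X) j (1 - β) p (j y))) := by gcongr
    _ = _ := by ring

end Duality

end RealInterpolation

namespace RealInterpolation

/-! ### Duality, second half: functionals on the interpolation space lie in (Y*, X*)_{β,q} -/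

section DualBound

variable {X Y G : Type*} [NormedAddCommGroup X] [NormedSpace ℝ X]
  [NormedAddCommGroup Y] [NormedSpace ℝ Y] [NormedAddCommGroup G] [NormedSpace ℝ G]
  {j : Y →L[ℝ] X} {P : G →L[ℝ] StrongDual ℝ X}

/-- The map y ↦ (y, jy/t) embeds Y in Y × X, and with the maximum norm the hypothesis says that f
has norm at most M on the image. Extend it by Hahn-Banach and restrict the extension to the two
factors. -/
theorem exists_dual_decomposition {t M : ℝ} (ht : 0 < t) (hM : 0 ≤ M) (f : StrongDual ℝ Y)
    (h : ∀ y, |f y| ≤ M * max ‖y‖ (t⁻¹ * ‖j y‖)) :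
    ∃ (f₀ : StrongDual ℝ Y) (f₁ : StrongDual ℝ X), f = f₀ + f₁.comp j ∧ ‖f₀‖ ≤ M ∧
      t * ‖f₁‖ ≤ M := by
  set L : Y →L[ℝ] Y × X := (ContinuousLinearMap.id ℝ Y).prod (t⁻¹ • j) with hL
  set p : Submodule ℝ (Y × X) := LinearMap.range L.toLinearMap
  set φ : StrongDual ℝ p := (f.comp (ContinuousLinearMap.fst ℝ Y X)).comp p.subtypeL
  have hφ : ‖φ‖ ≤ M := by
    refine φ.opNorm_le_bound hM ?_
    rintro ⟨_, y, rfl⟩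
    have h1 := h y
    rwa [← abs_of_pos (inv_pos.2 ht), ← Real.norm_eq_abs t⁻¹, ← norm_smul] at h1
  obtain ⟨F, hF, hFn⟩ := exists_extension_norm_eq p φ
  have hFM : ∀ z, ‖F z‖ ≤ M * ‖z‖ := fun z =>
    (F.le_opNorm z).trans (by rw [hFn]; gcongr)
  refine ⟨F.comp (ContinuousLinearMap.inl ℝ Y X), t⁻¹ • F.comp (ContinuousLinearMap.inr ℝ Y X),
    ?_, ?_, ?_⟩
  · ext y
    have h1 : F (L y) = f y := hF ⟨L y, y, rfl⟩
    have h2 : L y = ContinuousLinearMap.inl ℝ Y X y + t⁻¹ • ContinuousLinearMap.inr ℝ Y X (j y) := by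
      simp [hL]
    rw [← h1, h2, map_add, map_smul]
    rfl
  · refine ContinuousLinearMap.opNorm_le_bound _ hM fun y => (hFM _).trans ?_
    simp [Prod.norm_def]
  · rw [norm_smul, Real.norm_of_nonneg (inv_pos.2 ht).le, mul_inv_cancel_left₀ ht.ne']
    refine ContinuousLinearMap.opNorm_le_bound _ hM fun y => (hFM _).trans ?_
    simp [Prod.norm_def]

theorem kFunctional_dualEmb_le (hP : ∀ ϕ : StrongDual ℝ X, ∃ g, P g = ϕ ∧ ‖g‖ ≤ ‖ϕ‖) {t M : ℝ}
    (ht : 0 < t) (hM : 0 ≤ M) {f : StrongDual ℝ Y}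
    (h : ∀ y, |f y| ≤ M * max ‖y‖ (t⁻¹ * ‖j y‖)) :
    kFunctional (.id ℝ (StrongDual ℝ Y)) (dualEmb j P) t f ≤ ENNReal.ofReal (2 * M) := by
  obtain ⟨f₀, f₁, hf, h0, h1⟩ := exists_dual_decomposition ht hM f h
  obtain ⟨g, rfl, hg⟩ := hP f₁
  refine (kFunctional_le _ _ t f₀ g ?_).trans ?_
  · rw [hf]; rfl
  · rw [← ofReal_norm, ← ofReal_norm, ← ENNReal.ofReal_mul ht.le,
      ← ENNReal.ofReal_add (norm_nonneg _) (by positivity)]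
    refine ENNReal.ofReal_le_ofReal ?_
    have := mul_le_mul_of_nonneg_left hg ht.le
    linarith

/-- If f were below K/4 on all admissible y, then by homogeneity and the symmetry y ↦ -y it would
satisfy the hypothesis of the decomposition with M = K/4. This would give K ≤ K/2, which is
impossible for 0 < K < ∞. -/
theorem exists_norming_vector (hP : ∀ ϕ : StrongDual ℝ X, ∃ g, P g = ϕ ∧ ‖g‖ ≤ ‖ϕ‖) {t : ℝ}
    (ht : 0 < t) (f : StrongDual ℝ Y) :
    ∃ y : Y, ‖y‖ ≤ 1 ∧ ‖j y‖ ≤ t ∧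
      (kFunctional (.id ℝ (StrongDual ℝ Y)) (dualEmb j P) t f).toReal ≤ 4 * f y := by
  set K := kFunctional (.id ℝ (StrongDual ℝ Y)) (dualEmb j P) t f with hK
  have hKt : K ≠ ∞ := kFunctional_id_ne_top _ _ _
  rcases (ENNReal.toReal_nonneg (a := K)).eq_or_lt with h0 | h0
  · exact ⟨0, by simp, by simpa using ht.le, by simp [← h0]⟩
  by_contra! hcon
  have hlt : K ≤ ENNReal.ofReal (2 * (K.toReal / 4)) := by
    refine kFunctional_dualEmb_le hP ht (by positivity) fun y => ?_
    set m := max ‖y‖ (t⁻¹ * ‖j y‖) with hm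
    have hm0 : 0 ≤ m := le_max_of_le_left (norm_nonneg y)
    rcases hm0.eq_or_lt with hm1 | hm1
    · have : ‖y‖ ≤ 0 := (le_max_left _ _).trans hm1.symm.le
      rw [norm_le_zero_iff] at this
      rw [this, map_zero, abs_zero]
      positivity
    have hy1 : ‖m⁻¹ • y‖ ≤ 1 := by
      rw [norm_smul, Real.norm_of_nonneg (by positivity), inv_mul_le_iff₀ hm1, mul_one]
      exact le_max_left _ _
    have hy2 : ‖j (m⁻¹ • y)‖ ≤ t := by
      rw [map_smul, norm_smul, Real.norm_of_nonneg (by positivity), inv_mul_le_iff₀ hm1, mul_comm,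
        ← inv_mul_le_iff₀ ht]
      exact le_max_right _ _
    have h1 := hcon _ hy1 hy2
    have h2 := hcon (-(m⁻¹ • y)) (by rwa [norm_neg]) (by rwa [map_neg, norm_neg])
    rw [map_neg] at h2
    rw [map_smul, smul_eq_mul] at h1 h2
    have h3 : |m⁻¹ * f y| ≤ K.toReal / 4 := abs_le.2 ⟨by linarith, by linarith⟩
    rwa [abs_mul, abs_of_pos (inv_pos.2 hm1), inv_mul_le_iff₀ hm1, mul_comm] at h3
  have h4 := ENNReal.toReal_mono ENNReal.ofReal_ne_top hlt
  rw [ENNReal.toReal_ofReal (by positivity)] at h4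
  linarith

/-- Test f on u = ∑ 2^{-βn} b_n y_n, where y_n norms f at scale 2^n and b is chosen by ℓ^q-ℓ^p
duality. Then f(u) is at least a quarter of the ℓ^q norm of the sequence 2^{-βn} K(2^n, f), while
Young's inequality bounds the norm of ju by twice the kernel sum. The constant 16 is 4 · 2 · 2, the
last 2 for returning from the dyadic norm of f. -/
theorem interpENorm_dualEmb_le (hP : ∀ ϕ : StrongDual ℝ X, ∃ g, P g = ϕ ∧ ‖g‖ ≤ ‖ϕ‖) {β : ℝ}
    (hβ : β ∈ Ioo (0 : ℝ) 1) {q p : ℝ≥0} (hqp : q.HolderConjugate p) {f : StrongDual ℝ Y}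
    {A : ℝ≥0∞} (hf : ∀ y, ‖f y‖ₑ ≤ A * interpENorm (.id ℝ X) j (1 - β) p (j y)) :
    interpENorm (.id ℝ (StrongDual ℝ Y)) (dualEmb j P) β q f ≤
      16 * dyadicKernelSum (1 - β) * A := by
  have hqp' : (q : ℝ).HolderConjugate p := by exact_mod_cast hqp
  have hq : 1 ≤ q := hqp.lt.le
  have hp : 1 ≤ p := hqp.symm.lt.le
  have hq0 : (0 : ℝ) < q := lt_of_lt_of_le one_pos (by exact_mod_cast hq)
  have hpos : ∀ n : ℤ, (0 : ℝ) < 2 ^ n := fun n => by positivity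
  choose y hy1 hy2 hy3 using fun n : ℤ => exists_norming_vector (j := j) hP (hpos n) f
  set K := fun n : ℤ => kFunctional (.id ℝ (StrongDual ℝ Y)) (dualEmb j P) (2 ^ n) f with hK
  have hKt : ∀ n, K n ≠ ∞ := fun n => kFunctional_id_ne_top _ _ _
  set e : ℤ → ℝ≥0 := fun n =>
    (ENNReal.ofReal (2 ^ (-(β * n))) * K n).toNNReal with he
  have hec : ∀ n, (e n : ℝ≥0∞) = ENNReal.ofReal (2 ^ (-(β * n))) * K n := fun n =>
    ENNReal.coe_toNNReal (ENNReal.mul_ne_top ENNReal.ofReal_ne_top (hKt n))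
  have her : ∀ n, (e n : ℝ) = 2 ^ (-(β * n)) * (K n).toReal := fun n => by
    rw [he, ENNReal.coe_toNNReal_eq_toReal, ENNReal.toReal_mul,
      ENNReal.toReal_ofReal (by positivity)]
  have hfin : ∀ S : Finset ℤ, (∑ n ∈ S, (e n : ℝ≥0∞) ^ (q : ℝ)) ^ (1 / (q : ℝ)) ≤
      8 * dyadicKernelSum (1 - β) * A := fun S => by
    -- Working on a finite set S makes the extremal sequence b attained and u a finite sum. The
    -- bound is uniform in S, so it passes to the sum over ℤ.
    obtain ⟨b, hb, hbe⟩ := (NNReal.isGreatest_Lp S e hqp').1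
    simp only at hbe
    have hb' : ∑ n ∈ S, (b n : ℝ≥0∞) ^ (p : ℝ) ≤ 1 := by
      have : ∑ n ∈ S, b n ^ (p : ℝ) ≤ 1 := hb
      calc _ = ((∑ n ∈ S, b n ^ (p : ℝ) : ℝ≥0) : ℝ≥0∞) := by
            push_cast
            exact Finset.sum_congr rfl fun n _ =>
              (ENNReal.coe_rpow_of_nonneg _ p.coe_nonneg).symm
        _ ≤ 1 := by exact_mod_cast this
    set u : Y := ∑ n ∈ S, ((2 : ℝ) ^ (-(β * n)) * b n) • y n with hu
    have hsum : ((∑ n ∈ S, e n * b n : ℝ≥0) : ℝ≥0∞) ≤ 4 * ‖f u‖ₑ := by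
      have h1 : ((∑ n ∈ S, e n * b n : ℝ≥0) : ℝ) ≤ 4 * f u := by
        rw [hu, map_sum, Finset.mul_sum]
        push_cast
        refine Finset.sum_le_sum fun n _ => ?_
        rw [map_smul, smul_eq_mul, her, mul_left_comm]
        calc _ = 2 ^ (-(β * n)) * b n * (K n).toReal := by ring
          _ ≤ _ := by gcongr; exact hy3 n
      calc _ = ENNReal.ofReal ((∑ n ∈ S, e n * b n : ℝ≥0) : ℝ) := by
            rw [ENNReal.ofReal_coe_nnreal]
        _ ≤ ENNReal.ofReal (4 * ‖f u‖) := by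
            refine ENNReal.ofReal_le_ofReal (h1.trans ?_)
            gcongr
            exact Real.le_norm_self _
        _ = _ := by rw [ENNReal.ofReal_mul (by norm_num), ofReal_norm]; simp
    have hju : interpENorm (.id ℝ X) j (1 - β) p (j u) ≤ 2 * dyadicKernelSum (1 - β) := by
      refine (interpENorm_le_dyadicENorm _ j (by linarith [hβ.2]) hp _).trans ?_
      gcongr
      have h1 := dyadicENorm_sum_le (α := 1 - β) (p := p) j hp S b (y := y)
        (fun n _ => by
          rw [← ofReal_norm]
          exact ENNReal.ofReal_le_one.2 (hy1 n))
        (fun n _ => by rw [← ofReal_norm]; exact ENNReal.ofReal_le_ofReal (hy2 n))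
      simp only [sub_sub_cancel] at h1
      refine h1.trans (mul_le_of_le_one_right' ?_)
      exact ENNReal.rpow_le_one hb' (by positivity)
    calc _ = (((∑ n ∈ S, e n ^ (q : ℝ)) ^ (1 / (q : ℝ)) : ℝ≥0) : ℝ≥0∞) := by
          rw [ENNReal.coe_rpow_of_nonneg _ (by positivity)]
          push_cast
          congr 1
          exact Finset.sum_congr rfl fun n _ =>
            (ENNReal.coe_rpow_of_nonneg _ q.coe_nonneg).symm
      _ ≤ 4 * ‖f u‖ₑ := by rw [← hbe]; exact hsum
      _ ≤ 4 * (A * (2 * dyadicKernelSum (1 - β))) := by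
          gcongr
          exact (hf u).trans (by gcongr)
      _ = _ := by ring
  refine (interpENorm_le_dyadicENorm _ _ hβ.1.le hq f).trans ?_
  have hd : dyadicENorm (.id ℝ (StrongDual ℝ Y)) (dualEmb j P) β q f ≤
      8 * dyadicKernelSum (1 - β) * A := by
    unfold dyadicENorm
    rw [one_div, ENNReal.rpow_inv_le_iff hq0, ENNReal.tsum_eq_iSup_sum]
    refine iSup_le fun S => ?_
    rw [← ENNReal.rpow_inv_le_iff hq0, ← one_div]
    refine le_trans (le_of_eq ?_) (hfin S)
    simp only [hec]
    rfl
  calc _ ≤ 2 * (8 * dyadicKernelSum (1 - β) * A) := by gcongr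
    _ = _ := by ring

end DualBound

end RealInterpolation

/-! ### The Riesz representation of functionals on L^p over a finite measure -/

namespace LpDuality

open Filter Topology

variable {α : Type*} {m : MeasurableSpace α} {μ : Measure α} {p q : ℝ≥0}

theorem indicatorConstLp_eq_smul {s : Set α} (hs : MeasurableSet s) (hμs : μ s ≠ ∞) (c : ℝ) :
    indicatorConstLp (p : ℝ≥0∞) hs hμs c = c • indicatorConstLp (p : ℝ≥0∞) hs hμs (1 : ℝ) := by
  ext1
  grw [Lp.coeFn_smul, indicatorConstLp_coeFn, indicatorConstLp_coeFn]
  refine Eventually.of_forall fun x => ?_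
  simp only [Pi.smul_apply, smul_eq_mul]
  by_cases hx : x ∈ s <;> simp [hx]

variable [hp1 : Fact (1 ≤ p)] [hq1 : Fact (1 ≤ q)]

theorem dual_ext {Φ Ψ : StrongDual ℝ (Lp ℝ (p : ℝ≥0∞) μ)}
    (h : ∀ (s : Set α) (hs : MeasurableSet s) (hμs : μ s ≠ ∞),
      Φ (indicatorConstLp _ hs hμs 1) = Ψ (indicatorConstLp _ hs hμs 1)) : Φ = Ψ := by
  ext u
  refine Lp.induction (p := (p : ℝ≥0∞)) ENNReal.coe_ne_top (fun u => Φ u = Ψ u) ?_ ?_ ?_ u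
  · intro c s hs hμs
    rw [Lp.simpleFunc.coe_indicatorConst, indicatorConstLp_eq_smul, map_smul, map_smul,
      h s hs hμs.ne]
  · intro f g hf hg _ h1 h2
    rw [map_add, map_add, h1, h2]
  · exact isClosed_eq Φ.continuous Ψ.continuous

theorem enorm_lpPairing_le (hqp : q.HolderConjugate p)
    [ENNReal.HolderConjugate (q : ℝ≥0∞) (p : ℝ≥0∞)] (g : Lp ℝ (q : ℝ≥0∞) μ)
    (u : Lp ℝ (p : ℝ≥0∞) μ) :
    ‖(ContinuousLinearMap.mul ℝ ℝ).lpPairing μ (q : ℝ≥0∞) (p : ℝ≥0∞) g u‖ₑ ≤ ‖g‖ₑ * ‖u‖ₑ := by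
  have hqp' : (q : ℝ).HolderConjugate p := by exact_mod_cast hqp
  rw [ContinuousLinearMap.lpPairing_eq_integral, Lp.enorm_def, Lp.enorm_def,
    eLpNorm_coe_eq hp1.out, eLpNorm_coe_eq hq1.out]
  refine (enorm_integral_le_lintegral_enorm _).trans ?_
  simp only [ContinuousLinearMap.mul_apply', enorm_mul]
  exact ENNReal.lintegral_mul_le_Lp_mul_Lq μ hqp' (Lp.aestronglyMeasurable g).enorm
    (Lp.aestronglyMeasurable u).enorm

/-- Converse of Hölder: with k = sign(g) |g|^{q-1}, both ‖k‖_p^p and the pairing of g with k equal J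
= ∫ |g|^q. The hypothesis becomes J ≤ M J^{1/p}, and dividing leaves J^{1/q} ≤ M. -/
theorem enorm_le_of_lpPairing_le (hqp : q.HolderConjugate p)
    [ENNReal.HolderConjugate (q : ℝ≥0∞) (p : ℝ≥0∞)] (g : Lp ℝ (q : ℝ≥0∞) μ) {M : ℝ≥0∞}
    (h : ∀ u : Lp ℝ (p : ℝ≥0∞) μ,
      ‖(ContinuousLinearMap.mul ℝ ℝ).lpPairing μ (q : ℝ≥0∞) (p : ℝ≥0∞) g u‖ₑ ≤ M * ‖u‖ₑ) :
    ‖g‖ₑ ≤ M := by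
  have hqp' : (q : ℝ).HolderConjugate p := by exact_mod_cast hqp
  have hq0 : (0 : ℝ) < q := hqp'.pos
  have hp0 : (0 : ℝ) < p := hqp'.symm.pos
  have hgm : AEStronglyMeasurable g μ := Lp.aestronglyMeasurable g
  set J := ∫⁻ x, ‖g x‖ₑ ^ (q : ℝ) ∂μ with hJ
  have hgJ : ‖g‖ₑ = J ^ (1 / (q : ℝ)) := by
    rw [Lp.enorm_def, eLpNorm_coe_eq hq1.out]
  have hJt : J ≠ ∞ := by
    intro hJ'
    have : ‖g‖ₑ ≠ ∞ := by simp
    rw [hgJ, hJ', ENNReal.top_rpow_of_pos (by positivity)] at this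
    exact this rfl
  rcases eq_or_ne J 0 with hJ0 | hJ0
  · rw [hgJ, hJ0, ENNReal.zero_rpow_of_pos (by positivity)]
    exact zero_le
  set k : α → ℝ := fun x => Real.sign (g x) * |g x| ^ ((q : ℝ) - 1) with hk
  have hkm : AEStronglyMeasurable k μ := by
    have h1 : Measurable Real.sign := by
      unfold Real.sign
      exact Measurable.ite measurableSet_Iio measurable_const
        (Measurable.ite measurableSet_Ioi measurable_const measurable_const)
    have h2 : AEMeasurable g μ := hgm.aemeasurable
    exact ((h1.comp_aemeasurable h2).mul (h2.abs.pow_const _)).aestronglyMeasurable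
  have hknorm : ∀ x, ‖k x‖ₑ ^ (p : ℝ) = ‖g x‖ₑ ^ (q : ℝ) := fun x => by
    have h1 : (q - 1 : ℝ) * p = q := by
      have := hqp'.mul_eq_add
      linarith
    rcases eq_or_ne (g x) 0 with h0 | h0
    · simp [hk, h0, hp0, hq0]
    · have h2 : ‖k x‖ₑ = ‖g x‖ₑ ^ ((q : ℝ) - 1) := by
        have h3 : |Real.sign (g x)| = 1 := by
          rcases lt_or_gt_of_ne h0 with h4 | h4
          · rw [Real.sign_of_neg h4]; simp
          · rw [Real.sign_of_pos h4]; simp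
        rw [← ofReal_norm, Real.norm_eq_abs, hk, abs_mul, h3, one_mul, ← ofReal_norm,
          ENNReal.ofReal_rpow_of_pos (norm_pos_iff.2 h0), Real.norm_eq_abs,
          abs_of_nonneg (by positivity)]
      rw [h2, ← ENNReal.rpow_mul, h1]
  have hkL : eLpNorm k p μ = J ^ (1 / (p : ℝ)) := by
    rw [eLpNorm_coe_eq hp1.out]
    simp only [hknorm]
    rfl
  have hkmem : MemLp k p μ := ⟨hkm, by
    rw [hkL]; exact ENNReal.rpow_lt_top_of_nonneg (by positivity) hJt⟩
  have h1 := h hkmem.toLp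
  rw [Lp.enorm_def, eLpNorm_congr_ae hkmem.coeFn_toLp, hkL,
    ContinuousLinearMap.lpPairing_eq_integral] at h1
  have h2 : ‖∫ x, ContinuousLinearMap.mul ℝ ℝ (g x) (hkmem.toLp k x) ∂μ‖ₑ = J := by
    have h3 : ∫ x, ContinuousLinearMap.mul ℝ ℝ (g x) (hkmem.toLp k x) ∂μ =
        ∫ x, |g x| ^ (q : ℝ) ∂μ := by
      refine integral_congr_ae ?_
      filter_upwards [hkmem.coeFn_toLp] with x hx
      rw [ContinuousLinearMap.mul_apply', hx]
      simp only [hk]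
      rcases eq_or_ne (g x) 0 with h0 | h0
      · simp [h0, hq0.ne']
      · have h5 : g x * Real.sign (g x) = |g x| := by
          rcases lt_or_gt_of_ne h0 with h4 | h4
          · rw [Real.sign_of_neg h4, abs_of_neg h4]; ring
          · rw [Real.sign_of_pos h4, abs_of_pos h4]; ring
        rw [← mul_assoc, h5, mul_comm, ← Real.rpow_add_one (abs_ne_zero.2 h0), sub_add_cancel]
    rw [h3, integral_eq_lintegral_of_nonneg_ae (Eventually.of_forall fun x => by positivity)
      ((hgm.aemeasurable.abs.pow_const _).aestronglyMeasurable), Real.enorm_of_nonneg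
      ENNReal.toReal_nonneg]
    have h4 : ∀ x, ENNReal.ofReal (|g x| ^ (q : ℝ)) = ‖g x‖ₑ ^ (q : ℝ) := fun x => by
      rw [← ofReal_norm, Real.norm_eq_abs, ENNReal.ofReal_rpow_of_nonneg (abs_nonneg _) hq0.le]
    simp only [h4]
    exact ENNReal.ofReal_toReal hJt
  rw [h2] at h1
  have h5 : J = J ^ (1 / (q : ℝ)) * J ^ (1 / (p : ℝ)) := by
    rw [← ENNReal.rpow_add _ _ hJ0 hJt, one_div, one_div, hqp'.inv_add_inv_eq_one, ENNReal.rpow_one]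
  rw [hgJ]
  have h6 : J ^ (1 / (p : ℝ)) ≠ 0 := by simp [hJ0, hJt]
  have h7 : J ^ (1 / (p : ℝ)) ≠ ∞ := ENNReal.rpow_ne_top_of_nonneg (by positivity) hJt
  rw [← ENNReal.mul_le_mul_iff_left h6 h7, ← h5]
  exact h1

section Representation

variable [IsFiniteMeasure μ] (Φ : StrongDual ℝ (Lp ℝ (p : ℝ≥0∞) μ))

theorem dual_indicator_biUnion {f : ℕ → Set α} (hf : ∀ i, MeasurableSet (f i))
    (hd : Pairwise (Function.onFun Disjoint f)) (F : Finset ℕ) :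
    ∑ i ∈ F, Φ (indicatorConstLp _ (hf i) (measure_ne_top μ _) 1) =
      Φ (indicatorConstLp _ (F.measurableSet_biUnion fun i _ => hf i) (measure_ne_top μ _) 1) := by
  classical
  induction F using Finset.induction_on with
  | empty => simp
  | insert a F ha ih =>
    rw [Finset.sum_insert ha, ih, ← map_add]
    have hdis : Disjoint (f a) (⋃ i ∈ F, f i) := by
      rw [disjoint_iUnion₂_right]
      exact fun i hi => hd fun h => ha (h ▸ hi)
    rw [← indicatorConstLp_disjoint_union (hf a) (F.measurableSet_biUnion fun i _ => hf i)
      (measure_ne_top μ _) (measure_ne_top μ _) hdis]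
    congr 2
    rw [Finset.set_biUnion_insert]

/-- The signed measure `A ↦ Φ(1_A)` of a functional on `L^p`. -/
noncomputable def dualMeasure : SignedMeasure α := by
  classical
  exact
  { measureOf' := fun s => if hs : MeasurableSet s then
      Φ (indicatorConstLp _ hs (measure_ne_top μ _) 1) else 0
    empty' := by simp
    not_measurable' := fun s hs => dif_neg hs
    m_iUnion' := fun f hf hd => by
      simp only [hf, MeasurableSet.iUnion hf, dite_true]
      rw [HasSum]
      simp only [dual_indicator_biUnion Φ hf hd]
      -- Countable additivity is the continuity of Φ: as p is finite, indicators converge in L^p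
      -- once the measure of the symmetric difference tends to 0.
      refine (Φ.continuous.tendsto _).comp
        (tendsto_indicatorConstLp_set ENNReal.coe_ne_top ?_)
      have hsub : ∀ F : Finset ℕ, (⋃ i ∈ F, f i) ⊆ ⋃ i, f i := fun F =>
        iUnion₂_subset fun i _ => subset_iUnion f i
      have h1 : ∀ F : Finset ℕ, μ (symmDiff (⋃ i ∈ F, f i) (⋃ i, f i)) =
          μ (⋃ i, f i) - ∑ i ∈ F, μ (f i) := fun F => by
        rw [symmDiff_of_le (hsub F), measure_sdiff (hsub F)
          (F.measurableSet_biUnion fun i _ => hf i).nullMeasurableSet (measure_ne_top μ _),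
          measure_biUnion_finset (fun i _ j _ h => hd h) fun i _ => hf i]
      have h2 : HasSum (fun i => μ (f i)) (μ (⋃ i, f i)) := by
        rw [measure_iUnion hd hf]
        exact ENNReal.summable.hasSum
      have h3 := ENNReal.Tendsto.sub (tendsto_const_nhds (x := μ (⋃ i, f i))) h2
        (Or.inl (measure_ne_top μ _))
      rw [tsub_self] at h3
      simp only [SummationFilter.unconditional_filter] at h3 ⊢
      simpa only [h1] using h3 }

theorem dualMeasure_apply {s : Set α} (hs : MeasurableSet s) :
    dualMeasure Φ s = Φ (indicatorConstLp _ hs (measure_ne_top μ _) 1) :=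
  dif_pos hs

/-- The indicator of a null set is 0 in L^p, so the signed measure is absolutely continuous, and
Radon-Nikodym gives it a density. -/
theorem setIntegral_rnDeriv_dualMeasure {s : Set α} (hs : MeasurableSet s) :
    ∫ x in s, (dualMeasure Φ).rnDeriv μ x ∂μ =
      Φ (indicatorConstLp _ hs (measure_ne_top μ _) 1) := by
  have hac : dualMeasure Φ ≪ᵥ μ.toENNRealVectorMeasure := by
    refine VectorMeasure.AbsolutelyContinuous.mk fun t ht h => ?_
    rw [Measure.toENNRealVectorMeasure_apply_measurable ht] at h
    rw [dualMeasure_apply Φ ht]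
    have h0 : indicatorConstLp (p : ℝ≥0∞) ht (measure_ne_top μ _) (1 : ℝ) = 0 := by
      rw [← norm_eq_zero, norm_indicatorConstLp (by
        have := hp1.out; simpa using (zero_lt_one.trans_le this).ne') ENNReal.coe_ne_top]
      have : (0 : ℝ) < p := lt_of_lt_of_le one_pos (by exact_mod_cast hp1.out)
      simp [Measure.real, h, this.ne']
    rw [h0, map_zero]
  have h := SignedMeasure.withDensityᵥ_rnDeriv_eq _ μ hac
  rw [← dualMeasure_apply Φ hs]
  conv_rhs => rw [← h]
  rw [withDensityᵥ_apply (SignedMeasure.integrable_rnDeriv _ _) hs]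

/-- The Riesz representation of functionals on `L^p` over a finite measure space. -/
theorem exists_lpPairing_eq (hqp : q.HolderConjugate p)
    [ENNReal.HolderConjugate (q : ℝ≥0∞) (p : ℝ≥0∞)] :
    ∃ g : Lp ℝ (q : ℝ≥0∞) μ,
      (ContinuousLinearMap.mul ℝ ℝ).lpPairing μ (q : ℝ≥0∞) (p : ℝ≥0∞) g = Φ ∧ ‖g‖ ≤ ‖Φ‖ := by
  set g₀ : α → ℝ := (dualMeasure Φ).rnDeriv μ with hg₀
  have hgm : Measurable g₀ := SignedMeasure.measurable_rnDeriv _ _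
  have hpair : ∀ (g : Lp ℝ (q : ℝ≥0∞) μ) (s : Set α) (hs : MeasurableSet s),
      (ContinuousLinearMap.mul ℝ ℝ).lpPairing μ (q : ℝ≥0∞) (p : ℝ≥0∞) g
        (indicatorConstLp _ hs (measure_ne_top μ _) 1) = ∫ x in s, g x ∂μ := by
    intro g s hs
    rw [ContinuousLinearMap.lpPairing_eq_integral, ← integral_indicator hs]
    refine integral_congr_ae ?_
    filter_upwards [indicatorConstLp_coeFn (p := (p : ℝ≥0∞)) (hs := hs)
      (hμs := measure_ne_top μ s) (c := (1 : ℝ))] with x hx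
    rw [hx, ContinuousLinearMap.mul_apply']
    by_cases hxs : x ∈ s <;> simp [hxs]
  -- The density is only known to be integrable. Its truncations are bounded, hence in L^q of the
  -- finite measure.
  set E : ℕ → Set α := fun n => {x | |g₀ x| ≤ n} with hE
  have hEm : ∀ n, MeasurableSet (E n) := fun n => measurableSet_le hgm.abs measurable_const
  have hmem : ∀ n, MemLp ((E n).indicator g₀) q μ := fun n => by
    refine MemLp.of_bound (hgm.indicator (hEm n)).aestronglyMeasurable n
      (Eventually.of_forall fun x => ?_)
    by_cases hx : x ∈ E n
    · rw [indicator_of_mem hx]; exact hx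
    · simp [indicator_of_notMem hx]
  -- The truncated density represents Φ ∘ T, where T is multiplication by the indicator of E n. As T
  -- is a contraction of L^p, the converse of Hölder bounds the truncation by ‖Φ‖; Fatou's lemma
  -- then gives the same bound for g₀.
  have htrunc : ∀ n, eLpNorm ((E n).indicator g₀) q μ ≤ ‖Φ‖ₑ := fun n => by
    set χ : Lp ℝ ∞ μ := indicatorConstLp ∞ (hEm n) (measure_ne_top μ _) 1 with hχ
    set T : Lp ℝ (p : ℝ≥0∞) μ →L[ℝ] Lp ℝ (p : ℝ≥0∞) μ :=
      (ContinuousLinearMap.mul ℝ ℝ).holderL μ ∞ (p : ℝ≥0∞) (p : ℝ≥0∞) χ with hT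
    have hTn : ∀ u, ‖T u‖ ≤ ‖u‖ := fun u => by
      refine (ContinuousLinearMap.norm_holder_apply_apply_le _ _ _).trans ?_
      have h1 : ‖χ‖ ≤ 1 := norm_indicatorConstLp_le.trans (by simp)
      have h2 : ‖ContinuousLinearMap.mul ℝ ℝ‖ ≤ 1 := ContinuousLinearMap.opNorm_mul_le ℝ ℝ
      calc _ ≤ 1 * 1 * ‖u‖ := by gcongr
        _ = _ := by ring
    have heq : (ContinuousLinearMap.mul ℝ ℝ).lpPairing μ (q : ℝ≥0∞) (p : ℝ≥0∞) (hmem n).toLp =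
        Φ.comp T := by
      refine dual_ext fun s hs _ => ?_
      have h1 : T (indicatorConstLp _ hs (measure_ne_top μ _) 1) =
          indicatorConstLp _ ((hEm n).inter hs) (measure_ne_top μ _) 1 := by
        ext1
        refine (ContinuousLinearMap.coeFn_holder _ _ _).trans ?_
        filter_upwards [indicatorConstLp_coeFn (p := (p : ℝ≥0∞)) (hs := hs)
          (hμs := measure_ne_top μ s) (c := (1 : ℝ)),
          indicatorConstLp_coeFn (p := (p : ℝ≥0∞)) (hs := (hEm n).inter hs)
          (hμs := measure_ne_top μ _) (c := (1 : ℝ)),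
          indicatorConstLp_coeFn (p := ∞) (hs := hEm n)
          (hμs := measure_ne_top μ _) (c := (1 : ℝ))] with x h1 h2 h3
        rw [h1, h2, h3, ContinuousLinearMap.mul_apply']
        by_cases hx1 : x ∈ E n <;> by_cases hx2 : x ∈ s <;> simp [hx1, hx2]
      rw [hpair _ _ hs, ContinuousLinearMap.comp_apply, h1,
        ← setIntegral_rnDeriv_dualMeasure Φ ((hEm n).inter hs),
        integral_congr_ae (ae_restrict_of_ae (hmem n).coeFn_toLp),
        setIntegral_indicator (hEm n), inter_comm]
    have h3 : ‖(hmem n).toLp‖ₑ ≤ ‖Φ‖ₑ := by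
      refine enorm_le_of_lpPairing_le hqp _ fun u => ?_
      rw [heq]
      refine (Φ.le_opENorm (T u)).trans ?_
      gcongr
      rw [← ofReal_norm, ← ofReal_norm]
      exact ENNReal.ofReal_le_ofReal (hTn u)
    rwa [Lp.enorm_def, eLpNorm_congr_ae (hmem n).coeFn_toLp] at h3
  have hg : eLpNorm g₀ q μ ≤ ‖Φ‖ₑ := by
    refine (Lp.eLpNorm_lim_le_liminf_eLpNorm (f := fun n => (E n).indicator g₀)
      (fun n => (hmem n).1) g₀ (Eventually.of_forall fun x => ?_)).trans ?_
    · obtain ⟨k, hk⟩ := exists_nat_ge |g₀ x|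
      refine tendsto_const_nhds.congr' ?_
      filter_upwards [eventually_ge_atTop k] with n hn
      rw [indicator_of_mem]
      exact hk.trans (by exact_mod_cast hn)
    · refine liminf_le_of_le (by isBoundedDefault) fun b hb => ?_
      obtain ⟨n, hn⟩ := hb.exists
      exact hn.trans (htrunc n)
  have hgmem : MemLp g₀ q μ := ⟨hgm.aestronglyMeasurable, hg.trans_lt (by simp)⟩
  refine ⟨hgmem.toLp, dual_ext fun s hs _ => ?_, ?_⟩
  · rw [hpair _ _ hs, ← setIntegral_rnDeriv_dualMeasure Φ hs,
      integral_congr_ae (ae_restrict_of_ae hgmem.coeFn_toLp)]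
  · rw [Lp.norm_toLp]
    have := ENNReal.toReal_mono (by simp) hg
    simpa using this

end Representation

end LpDuality

/-! ### The Gagliardo seminorm through translation energies -/

namespace HomSobolev

variable {N : ℕ} {s : ℝ} {p : ℝ≥0}

/-- `∫ |u (x + h) - u x| ^ p dx`. -/
noncomputable def translationEnergy (p : ℝ≥0) (u : Euc N → ℝ) (h : Euc N) : ℝ≥0∞ :=
  ∫⁻ x, ‖u (x + h) - u x‖ₑ ^ (p : ℝ)

/-- The integral of `∫ |u (x + h) - u x| ^ p dx` over the `h` of norm less than `t`. -/
noncomputable def ballEnergy (p : ℝ≥0) (u : Euc N → ℝ) (t : ℝ) : ℝ≥0∞ :=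
  ∫⁻ h in Metric.ball 0 t, translationEnergy p u h

theorem measurable_translation {u : Euc N → ℝ} (hu : Continuous u) :
    Measurable fun z : Euc N × Euc N => ‖u (z.1 + z.2) - u z.1‖ₑ ^ (p : ℝ) := by
  have : Continuous fun z : Euc N × Euc N => u (z.1 + z.2) - u z.1 := by fun_prop
  exact this.enorm.measurable.pow_const _

theorem measurable_translationEnergy {u : Euc N → ℝ} (hu : Continuous u) :
    Measurable (translationEnergy p u) :=
  (measurable_translation hu).lintegral_prod_left'

theorem translationEnergy_zero (hp : 0 < p) (u : Euc N → ℝ) : translationEnergy p u 0 = 0 := by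
  have hp0 : (0 : ℝ) < p := by exact_mod_cast hp
  simp [translationEnergy, hp0]

/-- Substitute y = x + h and exchange the integrals. -/
theorem gagliardo_rpow (hp : 1 ≤ p) {u : Euc N → ℝ} (hu : Continuous u) :
    gagliardo s p u ^ (p : ℝ) =
      ∫⁻ h, translationEnergy p u h / ‖h‖ₑ ^ ((N : ℝ) + s * p) := by
  have hp0 : (0 : ℝ) < p := lt_of_lt_of_le one_pos (by exact_mod_cast hp)
  unfold gagliardo
  rw [← ENNReal.rpow_mul, one_div_mul_cancel hp0.ne', ENNReal.rpow_one]
  have h1 : ∀ x : Euc N, ∫⁻ y, ‖u x - u y‖ₑ ^ (p : ℝ) / ‖x - y‖ₑ ^ ((N : ℝ) + s * p) =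
      ∫⁻ h, ‖u (x + h) - u x‖ₑ ^ (p : ℝ) / ‖h‖ₑ ^ ((N : ℝ) + s * p) := fun x => by
    rw [← lintegral_add_left_eq_self _ x]
    refine lintegral_congr fun h => ?_
    rw [sub_add_cancel_left, enorm_neg, enorm_sub_rev]
  simp only [h1]
  rw [lintegral_lintegral_swap]
  · refine lintegral_congr fun h => ?_
    simp only [div_eq_mul_inv]
    have hc : Continuous fun x => u (x + h) - u x := by fun_prop
    rw [lintegral_mul_const _ (hc.enorm.measurable.pow_const _), translationEnergy]
  · have h2 : Measurable fun z : Euc N × Euc N => ‖z.2‖ₑ ^ ((N : ℝ) + s * p) := by fun_prop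
    exact ((measurable_translation (p := p) hu).div h2).aemeasurable

theorem lintegral_Ioi_rpow {a ρ : ℝ} (ha : 0 < a) (hρ : 0 < ρ) :
    ENNReal.ofReal a * ∫⁻ t in Ioi ρ, ENNReal.ofReal (t ^ (-a - 1)) =
      ENNReal.ofReal (ρ ^ (-a)) := by
  rw [← ofReal_integral_eq_lintegral_ofReal (integrableOn_Ioi_rpow_of_lt (by linarith) hρ),
    integral_Ioi_rpow_of_lt (by linarith) hρ, ← ENNReal.ofReal_mul ha.le]
  · congr 1
    rw [sub_add_cancel]
    field_simp
  · filter_upwards [ae_restrict_mem measurableSet_Ioi] with t ht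
    have : 0 < t := hρ.trans ht
    positivity

/-- The Gagliardo seminorm is a weighted integral of the energies on balls. -/
theorem gagliardo_rpow_eq_lintegral_ballEnergy (hs : 0 < s) (hp : 1 ≤ p) {u : Euc N → ℝ}
    (hu : Continuous u) :
    gagliardo s p u ^ (p : ℝ) = ENNReal.ofReal ((N : ℝ) + s * p) *
      ∫⁻ t in Ioi (0 : ℝ), ENNReal.ofReal (t ^ (-((N : ℝ) + s * p) - 1)) * ballEnergy p u t := by
  have hp0 : (0 : ℝ) < p := lt_of_lt_of_le one_pos (by exact_mod_cast hp)
  rw [gagliardo_rpow hp hu]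
  set a : ℝ := (N : ℝ) + s * p with ha
  have ha0 : 0 < a := by positivity
  set w : ℝ → ℝ≥0∞ := fun t => ENNReal.ofReal (t ^ (-a - 1)) with hw
  have hwm : Measurable w := by fun_prop
  have hWm := measurable_translationEnergy (p := p) hu
  -- Layer-cake formula: ‖h‖^{-a} = a ∫ t^{-a-1} dt over t > ‖h‖. The singular point h = 0 is
  -- harmless since the energy vanishes there.
  have h1 : ∀ h : Euc N, translationEnergy p u h / ‖h‖ₑ ^ a =
      ENNReal.ofReal a * ∫⁻ t in Ioi (0 : ℝ),
        w t * (Metric.ball 0 t).indicator (translationEnergy p u) h := fun h => by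
    rcases eq_or_ne h 0 with rfl | hh
    · have : ∀ t, (Metric.ball (0 : Euc N) t).indicator (translationEnergy p u) 0 = 0 :=
        fun t => by
          rw [indicator_apply_eq_zero]
          exact fun _ => translationEnergy_zero (by exact_mod_cast hp0) u
      simp [this, translationEnergy_zero (by exact_mod_cast hp0 : 0 < p)]
    have hh0 : 0 < ‖h‖ := norm_pos_iff.2 hh
    have h2 : ∀ t, w t * (Metric.ball 0 t).indicator (translationEnergy p u) h =
        (Ioi ‖h‖).indicator w t * translationEnergy p u h := fun t => by
      by_cases ht : ‖h‖ < t
      · rw [indicator_of_mem (by simpa using ht), indicator_of_mem (mem_Ioi.2 ht)]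
      · rw [indicator_of_notMem (by simpa using ht), indicator_of_notMem (by simpa using ht)]
        simp
    simp only [h2]
    rw [lintegral_mul_const _ (hwm.indicator measurableSet_Ioi),
      setLIntegral_indicator measurableSet_Ioi,
      inter_eq_left.2 (Ioi_subset_Ioi hh0.le), ← mul_assoc, lintegral_Ioi_rpow ha0 hh0,
      ENNReal.div_eq_inv_mul, ← ENNReal.rpow_neg, ← ofReal_norm, ENNReal.ofReal_rpow_of_pos hh0]
  simp only [h1]
  have hm : Measurable fun z : Euc N × ℝ =>
      w z.2 * (Metric.ball 0 z.2).indicator (translationEnergy p u) z.1 := by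
    refine (hwm.comp measurable_snd).mul ?_
    have : (fun z : Euc N × ℝ => (Metric.ball 0 z.2).indicator (translationEnergy p u) z.1) =
        {z : Euc N × ℝ | ‖z.1‖ < z.2}.indicator fun z => translationEnergy p u z.1 := by
      ext z
      by_cases hz : ‖z.1‖ < z.2
      · rw [indicator_of_mem (by simpa using hz), 
          indicator_of_mem (by exact hz : z ∈ {z : Euc N × ℝ | ‖z.1‖ < z.2})]
      · rw [indicator_of_notMem (by simpa using hz),
          indicator_of_notMem (by exact hz : z ∉ {z : Euc N × ℝ | ‖z.1‖ < z.2})]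
    rw [this]
    exact (hWm.comp measurable_fst).indicator
      (measurableSet_lt measurable_fst.norm measurable_snd)
  rw [lintegral_const_mul _ hm.lintegral_prod_right', lintegral_lintegral_swap hm.aemeasurable]
  congr 1
  refine lintegral_congr fun t => ?_
  simp only
  rw [lintegral_const_mul _ (hWm.indicator measurableSet_ball),
    lintegral_indicator measurableSet_ball, ballEnergy]

/-! ### The K-functional dominates the translation energies -/

section TestNorms

variable {Ω : Opens (Euc N)} [hp : Fact (1 ≤ p)]

theorem test_eq_zero (φ : Test Ω) {x : Euc N} (hx : x ∉ Ω) : φ x = 0 :=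
  image_eq_zero_of_notMem_tsupport fun h => hx (φ.tsupport_subset h)

theorem enorm_testToLp (φ : Test Ω) : ‖testToLp Ω p φ‖ₑ = eLpNorm φ p volume := by
  rw [Lp.enorm_def]
  have h1 : eLpNorm (testToLp Ω p φ) p (volume.restrict (Ω : Set (Euc N))) =
      eLpNorm φ p (volume.restrict (Ω : Set (Euc N))) := eLpNorm_congr_ae
    (MemLp.coeFn_toLp ((φ.continuous.memLp_of_hasCompactSupport φ.hasCompactSupport).restrict _))
  rw [h1]
  refine eLpNorm_restrict_eq_of_support_subset fun x hx => ?_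
  by_contra h
  exact hx (test_eq_zero φ h)

theorem enorm_ofTest (s : ℝ) (hs : s ∈ Ioc (0 : ℝ) 1) (φ : Test Ω) :
    ‖ofTest Ω s hs p φ‖ₑ = homENorm s p φ := by
  have h : ‖ofTest Ω s hs p φ‖ = ‖HomTest.of Ω s hs p φ‖ := UniformSpace.Completion.norm_coe _
  rw [← ofReal_norm, h, HomTest.norm_of, ENNReal.ofReal_toReal (homENorm_lt_top hs hp.out φ).ne]

theorem enorm_ofTest_one (φ : Test Ω) :
    ‖ofTest Ω 1 one_mem_Ioc p φ‖ₑ = eLpNorm (fun x => fderiv ℝ φ x) p volume := by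
  rw [enorm_ofTest, homENorm, if_pos rfl]

theorem denseRange_ofTest (s : ℝ) (hs : s ∈ Ioc (0 : ℝ) 1) :
    DenseRange (ofTest Ω s hs p) :=
  UniformSpace.Completion.denseRange_coe (α := HomTest Ω s hs p)

/-- Split φ = (φ - ψ) + ψ. Translation is an isometry of L^p, whence the factor 2; the increment of
ψ is the integral of its gradient along a segment of length ‖h‖. -/
theorem translationEnergy_le_rpow (φ ψ : Test Ω) (h : Euc N) :
    translationEnergy p φ h ^ (1 / (p : ℝ)) ≤ 2 * ‖testToLp Ω p (φ - ψ)‖ₑ +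
      ‖h‖ₑ * ‖ofTest Ω 1 one_mem_Ioc p ψ‖ₑ := by
  have hp1 : (1 : ℝ) ≤ p := by exact_mod_cast hp.out
  have hp0 : (0 : ℝ) < p := one_pos.trans_le hp1
  have hE : ∀ u : Euc N → ℝ, translationEnergy p u h ^ (1 / (p : ℝ)) =
      eLpNorm (fun x => u (x + h) - u x) p volume := fun u => by
    rw [eLpNorm_coe_eq hp.out, translationEnergy]
  have hmp : MeasurePreserving (fun x : Euc N => x + h) volume volume :=
    measurePreserving_add_right volume h
  have h1 : eLpNorm (fun x => (φ - ψ) (x + h) - (φ - ψ) x) p volume ≤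
      2 * eLpNorm (φ - ψ : Test Ω) p volume := by
    have h2 := eLpNorm_sub_le (μ := (volume : Measure (Euc N))) (p := (p : ℝ≥0∞))
      (((φ - ψ).continuous.comp (continuous_add_const h)).aestronglyMeasurable)
      (φ - ψ).continuous.aestronglyMeasurable (by exact_mod_cast hp.out)
    refine h2.trans (le_of_eq ?_)
    rw [eLpNorm_comp_measurePreserving (φ - ψ).continuous.aestronglyMeasurable hmp, two_mul]
  have h2 : translationEnergy p ψ h ^ (1 / (p : ℝ)) ≤
      ‖h‖ₑ * eLpNorm (fun x => fderiv ℝ ψ x) p volume := by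
    have h3 := lintegral_translate_sub_le hp.out
      (ψ.contDiff.of_le (by simp) : ContDiff ℝ 1 ψ) h
    rw [eLpNorm_coe_eq hp.out]
    calc _ ≤ (‖h‖ₑ ^ (p : ℝ) * ∫⁻ x, ‖fderiv ℝ ψ x‖ₑ ^ (p : ℝ)) ^ (1 / (p : ℝ)) := by
          exact ENNReal.rpow_le_rpow h3 (by positivity)
      _ = _ := by
          rw [ENNReal.mul_rpow_of_nonneg _ _ (by positivity), ← ENNReal.rpow_mul,
            mul_one_div_cancel hp0.ne', ENNReal.rpow_one]
  rw [enorm_testToLp, enorm_ofTest_one]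
  refine le_trans ?_ (add_le_add h1 h2)
  rw [hE, hE]
  have hc1 : Continuous fun x => (φ - ψ) (x + h) - (φ - ψ) x :=
    ((φ - ψ).continuous.comp (continuous_add_const h)).sub (φ - ψ).continuous
  have hc2 : Continuous fun x => ψ (x + h) - ψ x :=
    (ψ.continuous.comp (continuous_add_const h)).sub ψ.continuous
  have h4 := eLpNorm_add_le (μ := (volume : Measure (Euc N))) (p := (p : ℝ≥0∞))
    hc1.aestronglyMeasurable hc2.aestronglyMeasurable (by exact_mod_cast hp.out)
  refine le_trans (le_of_eq ?_) h4
  congr 1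
  ext x
  simp only [Pi.add_apply, FunLike.coe_sub, Pi.sub_apply]
  ring

variable [NeZero N] (hΩ : Bornology.IsBounded (Ω : Set (Euc N)))

/-- The infimum runs over the completion, but the inequality is closed in y, so it is enough to test
it on smooth y. -/
theorem translationEnergy_le_kFunctional (φ : Test Ω) {h : Euc N} {t : ℝ} (ht : ‖h‖ ≤ t) :
    translationEnergy p φ h ^ (1 / (p : ℝ)) ≤
      2 * kFunctional (.id ℝ (LpSpace Ω p)) (oneToLp hΩ p) t (testToLp Ω p φ) := by
  rw [kFunctional_id_eq, ENNReal.mul_iInf_of_ne (by simp) (by simp)]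
  refine le_iInf fun y => ?_
  have hcl : IsClosed {y : D0One Ω p | translationEnergy p φ h ^ (1 / (p : ℝ)) ≤
      2 * (‖testToLp Ω p φ - oneToLp hΩ p y‖ₑ + ENNReal.ofReal t * ‖y‖ₑ)} := by
    have h1 : Continuous fun y : D0One Ω p => ‖testToLp Ω p φ - oneToLp hΩ p y‖ₑ :=
      (continuous_const.sub (oneToLp hΩ p).continuous).enorm
    have h2 : Continuous fun y : D0One Ω p => ENNReal.ofReal t * ‖y‖ₑ :=
      (ENNReal.continuous_const_mul ENNReal.ofReal_ne_top).comp continuous_enorm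
    exact isClosed_le continuous_const ((ENNReal.continuous_const_mul (by simp)).comp (h1.add h2))
  refine (denseRange_ofTest (p := p) 1 one_mem_Ioc).induction_on
    (p := fun y => translationEnergy p φ h ^ (1 / (p : ℝ)) ≤
      2 * (‖testToLp Ω p φ - oneToLp hΩ p y‖ₑ + ENNReal.ofReal t * ‖y‖ₑ)) y hcl fun ψ => ?_
  rw [toLp_ofTest, ← map_sub, mul_add]
  refine (translationEnergy_le_rpow φ ψ h).trans ?_
  have h1 : ‖h‖ₑ ≤ ENNReal.ofReal t := by
    rw [← ofReal_norm]; exact ENNReal.ofReal_le_ofReal ht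
  refine add_le_add le_rfl ?_
  calc _ ≤ ENNReal.ofReal t * ‖ofTest Ω 1 one_mem_Ioc p ψ‖ₑ := by gcongr
    _ ≤ _ := le_mul_of_one_le_left zero_le one_le_two

theorem ballEnergy_le_kFunctional (φ : Test Ω) {t : ℝ} (ht : 0 < t) :
    ballEnergy p φ t ≤ ENNReal.ofReal (t ^ (N : ℝ)) * volume (Metric.ball (0 : Euc N) 1) *
      (2 * kFunctional (.id ℝ (LpSpace Ω p)) (oneToLp hΩ p) t (testToLp Ω p φ)) ^ (p : ℝ) := by
  have hp0 : (0 : ℝ) < p := lt_of_lt_of_le one_pos (by exact_mod_cast hp.out)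
  have hvol : volume (Metric.ball (0 : Euc N) t) =
      ENNReal.ofReal (t ^ (N : ℝ)) * volume (Metric.ball (0 : Euc N) 1) := by
    rw [Measure.addHaar_ball_of_pos _ _ ht, finrank_euclideanSpace_fin, Real.rpow_natCast]
  rw [← hvol, mul_comm, ← setLIntegral_const, ballEnergy]
  refine setLIntegral_mono' measurableSet_ball fun h hh => ?_
  have h1 := translationEnergy_le_kFunctional (p := p) hΩ φ (mem_ball_zero_iff.1 hh).le
  have h2 := ENNReal.rpow_le_rpow h1 hp0.le
  rwa [← ENNReal.rpow_mul, one_div_mul_cancel hp0.ne', ENNReal.rpow_one] at h2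

/-- The interpolation norm dominates the Gagliardo seminorm. -/
theorem exists_gagliardo_le_interpENorm (N : ℕ) [NeZero N] (hs : 0 < s) (p : ℝ≥0)
    [hp : Fact (1 ≤ p)] : ∃ C : ℝ≥0, ∀ (Ω : Opens (Euc N))
      (hΩ : Bornology.IsBounded (Ω : Set (Euc N))) (φ : Test Ω),
      gagliardo s p φ ≤
        C * interpENorm (.id ℝ (LpSpace Ω p)) (oneToLp hΩ p) s p (testToLp Ω p φ) := by
  have hp0 : (0 : ℝ) < p := lt_of_lt_of_le one_pos (by exact_mod_cast hp.out)
  set ω := volume (Metric.ball (0 : Euc N) 1)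
  have hω : ω ≠ ∞ := Metric.isBounded_ball.measure_lt_top.ne
  -- The layer-cake constant, the volume of the unit ball and the 2 of the translation bound. None
  -- of them involves Ω.
  set A : ℝ≥0∞ := ENNReal.ofReal ((N : ℝ) + s * p) * (ω * 2 ^ (p : ℝ)) with hA
  have hAt : A ≠ ∞ := by finiteness
  refine ⟨(A ^ (1 / (p : ℝ))).toNNReal, fun Ω hΩ φ => ?_⟩
  rw [ENNReal.coe_toNNReal (by simp [hAt])]
  have h1 : gagliardo s p φ ^ (p : ℝ) ≤ A * ∫⁻ t in Ioi (0 : ℝ), ENNReal.ofReal (t ^ (-(s * p))) *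
      kFunctional (.id ℝ (LpSpace Ω p)) (oneToLp hΩ p) t (testToLp Ω p φ) ^ (p : ℝ) /
        ENNReal.ofReal t := by
    rw [gagliardo_rpow_eq_lintegral_ballEnergy hs hp.out φ.continuous, hA, mul_assoc]
    refine mul_le_mul_right ?_ _
    rw [← lintegral_const_mul' (ω * 2 ^ (p : ℝ)) _ (by finiteness)]
    refine setLIntegral_mono' measurableSet_Ioi fun t (ht : 0 < t) => ?_
    calc _ ≤ ENNReal.ofReal (t ^ (-((N : ℝ) + s * p) - 1)) * (ENNReal.ofReal (t ^ (N : ℝ)) * ω *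
          (2 * kFunctional (.id ℝ (LpSpace Ω p)) (oneToLp hΩ p) t (testToLp Ω p φ)) ^ (p : ℝ)) := by
          gcongr
          exact ballEnergy_le_kFunctional hΩ φ ht
      _ = _ := by
          rw [ENNReal.mul_rpow_of_nonneg _ _ hp0.le, ENNReal.mul_div_right_comm,
            ← ENNReal.ofReal_div_of_pos ht]
          have : t ^ (-(s * p)) / t = t ^ (-((N : ℝ) + s * p) - 1) * t ^ (N : ℝ) := by
            rw [← Real.rpow_add ht, ← Real.rpow_sub_one ht.ne']
            congr 1; ring
          rw [this, ENNReal.ofReal_mul (by positivity)]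
          ring
  have h2 := ENNReal.rpow_le_rpow h1 (by positivity : 0 ≤ 1 / (p : ℝ))
  rwa [← ENNReal.rpow_mul, mul_one_div_cancel hp0.ne', ENNReal.rpow_one,
    ENNReal.mul_rpow_of_nonneg _ _ (by positivity)] at h2

end TestNorms

end HomSobolev

namespace HomSobolev

/-! ### Mollification combined with a dilation of the ball -/

section Mollifier

open ContinuousLinearMap
open scoped Convolution

/-- A bump function of `ℝ^N` supported in the unit ball. -/
noncomputable def unitBump (N : ℕ) : ContDiffBump (0 : Euc N) := ⟨1 / 2, 1, by norm_num, by norm_num⟩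

/-- A standard mollifier of `ℝ^N` supported in the unit ball. -/
noncomputable def mollifier (N : ℕ) : Euc N → ℝ := (unitBump N).normed volume

variable {N : ℕ}

theorem contDiff_mollifier {n : ℕ∞} : ContDiff ℝ n (mollifier N) := (unitBump N).contDiff_normed

theorem hasCompactSupport_mollifier : HasCompactSupport (mollifier N) :=
  (unitBump N).hasCompactSupport_normed

theorem tsupport_mollifier : tsupport (mollifier N) = Metric.closedBall 0 1 :=
  (unitBump N).tsupport_normed_eq

theorem integral_mollifier : ∫ z, mollifier N z = 1 := (unitBump N).integral_normed

theorem mollifier_eq_zero {z : Euc N} (hz : z ∉ Metric.closedBall (0 : Euc N) 1) :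
    mollifier N z = 0 :=
  image_eq_zero_of_notMem_tsupport (by rwa [tsupport_mollifier])

theorem fderiv_mollifier_eq_zero {z : Euc N} (hz : z ∉ Metric.closedBall (0 : Euc N) 1) :
    fderiv ℝ (mollifier N) z = 0 := by
  refine image_eq_zero_of_notMem_tsupport fun h => hz ?_
  rw [← tsupport_mollifier]
  exact tsupport_fderiv_subset ℝ h

theorem continuous_fderiv_mollifier : Continuous (fderiv ℝ (mollifier N)) :=
  (contDiff_mollifier (n := 1)).continuous_fderiv one_ne_zero

variable (N) in
theorem exists_mollifier_bound : ∃ L : ℝ≥0, (∀ z, ‖mollifier N z‖ₑ ≤ L) ∧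
    ∀ z, ‖fderiv ℝ (mollifier N) z‖ₑ ≤ L := by
  obtain ⟨L₁, h1⟩ := (contDiff_mollifier (n := 0)).continuous.bounded_above_of_compact_support
    (hasCompactSupport_mollifier (N := N))
  obtain ⟨L₂, h2⟩ := continuous_fderiv_mollifier.bounded_above_of_compact_support
    ((hasCompactSupport_mollifier (N := N)).fderiv (𝕜 := ℝ))
  refine ⟨(max L₁ L₂).toNNReal, fun z => ?_, fun z => ?_⟩
  · rw [← ofReal_norm]
    exact ENNReal.ofReal_le_ofReal ((h1 z).trans (le_max_left _ _))
  · rw [← ofReal_norm]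
    exact ENNReal.ofReal_le_ofReal ((h2 z).trans (le_max_right _ _))

theorem hasFDerivAt_mollifier_convolution {g : Euc N → ℝ} (hg : Continuous g) (w : Euc N) :
    HasFDerivAt (mollifier N ⋆[lsmul ℝ ℝ] g)
      (∫ z, g (w - z) • fderiv ℝ (mollifier N) z) w := by
  have h := (hasCompactSupport_mollifier (N := N)).hasFDerivAt_convolution_left (lsmul ℝ ℝ)
    (contDiff_mollifier (n := 1)) (hg.locallyIntegrable (μ := volume)) w
  refine h.congr_fderiv (integral_congr_ae (Filter.Eventually.of_forall fun z => ?_))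
  ext v
  simp [mul_comm]

/-- The integral is the derivative at 0 of the convolution of the mollifier with 1, which is
constant. -/
theorem integral_fderiv_mollifier : ∫ z, fderiv ℝ (mollifier N) z = 0 := by
  have h := hasFDerivAt_mollifier_convolution (N := N) (g := fun _ => 1) continuous_const 0
  have h1 : (mollifier N ⋆[lsmul ℝ ℝ] fun _ => (1 : ℝ)) = fun _ => 1 := by
    ext w
    simp [convolution, integral_mollifier]
  rw [h1] at h
  simpa using h.unique (hasFDerivAt_const _ _)

/-- The average of `φ` over the points `x + (2 τ / r) (x - c) - τ z`, for `z` in the unit ball. It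
vanishes near the complement of the ball `B(c, r)` if `φ` vanishes outside. -/
noncomputable def ballMollify (c : Euc N) (r τ : ℝ) (φ : Euc N → ℝ) (x : Euc N) : ℝ :=
  ∫ z, φ (x + ((2 * τ / r) • (x - c) - τ • z)) * mollifier N z

variable (c : Euc N) {r τ : ℝ}

/-- In rescaled variables the average is an ordinary convolution composed with an affine map, which
yields smoothness and a gradient falling on the mollifier. -/
theorem ballMollify_eq_convolution (hτ : τ ≠ 0) (φ : Euc N → ℝ) :
    ballMollify c r τ φ = fun x => (mollifier N ⋆[lsmul ℝ ℝ] fun w => φ (τ • w))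
      (τ⁻¹ • (x + (2 * τ / r) • (x - c))) := by
  ext x
  rw [ballMollify, convolution]
  refine integral_congr_ae (Filter.Eventually.of_forall fun z => ?_)
  simp only [lsmul_apply, smul_eq_mul]
  rw [mul_comm, smul_sub τ, smul_inv_smul₀ hτ, add_sub_assoc]

theorem contDiff_ballMollify (hτ : τ ≠ 0) {φ : Euc N → ℝ} (hφ : Continuous φ) :
    ContDiff ℝ ((⊤ : ℕ∞) : WithTop ℕ∞) (ballMollify c r τ φ) := by
  rw [ballMollify_eq_convolution c hτ]
  have h := (hasCompactSupport_mollifier (N := N)).contDiff_convolution_left (μ := volume)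
    (lsmul ℝ ℝ)
    (contDiff_mollifier (n := ⊤))
    ((hφ.comp (continuous_const_smul τ)).locallyIntegrable (μ := volume))
  exact h.comp (by fun_prop)

theorem fderiv_ballMollify (hτ : τ ≠ 0) {φ : Euc N → ℝ} (hφ : Continuous φ) (x : Euc N) :
    fderiv ℝ (ballMollify c r τ φ) x = ((1 + 2 * τ / r) / τ) •
      ∫ z, φ (x + ((2 * τ / r) • (x - c) - τ • z)) • fderiv ℝ (mollifier N) z := by
  have h1 := hasFDerivAt_mollifier_convolution (N := N) (g := fun w => φ (τ • w)) (by fun_prop)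
    (τ⁻¹ • (x + (2 * τ / r) • (x - c)))
  have h2 : HasFDerivAt (fun x : Euc N => τ⁻¹ • (x + (2 * τ / r) • (x - c)))
      (((1 + 2 * τ / r) / τ) • ContinuousLinearMap.id ℝ (Euc N)) x := by
    have := ((hasFDerivAt_id (𝕜 := ℝ) x).add (((hasFDerivAt_id (𝕜 := ℝ) x).sub_const c).const_smul
      (2 * τ / r))).const_smul τ⁻¹
    refine this.congr_fderiv ?_
    ext v : 1
    simp only [smul_apply, add_apply, ContinuousLinearMap.id_apply]
    rw [smul_add, smul_smul, ← add_smul]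
    congr 1
    field_simp
  rw [ballMollify_eq_convolution c hτ]
  refine (h1.comp x h2).fderiv.trans ?_
  rw [comp_smul, comp_id]
  congr 1
  refine integral_congr_ae (Filter.Eventually.of_forall fun z => ?_)
  simp only
  rw [smul_sub τ, smul_inv_smul₀ hτ, add_sub_assoc]

theorem enorm_integral_smul_le {F : Type*} [NormedAddCommGroup F] [NormedSpace ℝ F] {L : ℝ≥0}
    {k : Euc N → F} (hk : ∀ z, ‖k z‖ₑ ≤ L) (hk0 : ∀ z, z ∉ Metric.closedBall (0 : Euc N) 1 → k z = 0)
    (g : Euc N → ℝ) :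
    ‖∫ z, g z • k z‖ₑ ≤ L * ∫⁻ z in Metric.closedBall (0 : Euc N) 1, ‖g z‖ₑ := by
  refine (enorm_integral_le_lintegral_enorm _).trans ?_
  rw [← lintegral_const_mul' _ _ (by simp), ← lintegral_indicator measurableSet_closedBall]
  refine lintegral_mono fun z => ?_
  by_cases hz : z ∈ Metric.closedBall (0 : Euc N) 1
  · rw [indicator_of_mem hz, enorm_smul, mul_comm]
    gcongr
    exact hk z
  · rw [hk0 z hz]; simp

/-- `∫ |φ (x + (2 τ / r) (x - c) - τ z) - φ x| dz` over the unit ball. -/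
noncomputable def ballOscillation (c : Euc N) (r τ : ℝ) (φ : Euc N → ℝ) (x : Euc N) : ℝ≥0∞ :=
  ∫⁻ z in Metric.closedBall (0 : Euc N) 1, ‖φ (x + ((2 * τ / r) • (x - c) - τ • z)) - φ x‖ₑ

theorem integrable_smul_mollifier {F : Type*} [NormedAddCommGroup F] [NormedSpace ℝ F]
    {k : Euc N → F} (hk : Continuous k) (hkc : HasCompactSupport k) {g : Euc N → ℝ}
    (hg : Continuous g) : Integrable fun z => g z • k z :=
  (hg.smul hk).integrable_of_hasCompactSupport hkc.smul_left

/-- The mollifier has integral 1, so φ x can be brought under the integral. For the gradient bound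
below it can be subtracted there because the gradient of the mollifier has integral 0. -/
theorem enorm_ballMollify_sub_le {L : ℝ≥0} (hL : ∀ z, ‖mollifier N z‖ₑ ≤ L) {φ : Euc N → ℝ}
    (hφ : Continuous φ) (x : Euc N) :
    ‖ballMollify c r τ φ x - φ x‖ₑ ≤ L * ballOscillation c r τ φ x := by
  have hc : Continuous fun z => φ (x + ((2 * τ / r) • (x - c) - τ • z)) := by fun_prop
  have h1 : ballMollify c r τ φ x - φ x =
      ∫ z, (φ (x + ((2 * τ / r) • (x - c) - τ • z)) - φ x) • mollifier N z := by
    simp only [sub_smul]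
    rw [integral_sub, integral_smul, integral_mollifier, smul_eq_mul, mul_one]
    · rfl
    · exact integrable_smul_mollifier (contDiff_mollifier (n := 0)).continuous
        hasCompactSupport_mollifier hc
    · exact integrable_smul_mollifier (contDiff_mollifier (n := 0)).continuous
        hasCompactSupport_mollifier continuous_const
  rw [h1]
  exact enorm_integral_smul_le hL (fun z => mollifier_eq_zero) _

theorem enorm_fderiv_ballMollify_le {L : ℝ≥0} (hL : ∀ z, ‖fderiv ℝ (mollifier N) z‖ₑ ≤ L)
    (hτ : τ ≠ 0) {φ : Euc N → ℝ} (hφ : Continuous φ) (x : Euc N) :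
    ‖fderiv ℝ (ballMollify c r τ φ) x‖ₑ ≤
      ‖(1 + 2 * τ / r) / τ‖ₑ * (L * ballOscillation c r τ φ x) := by
  have hc : Continuous fun z => φ (x + ((2 * τ / r) • (x - c) - τ • z)) := by fun_prop
  have h1 : ∫ z, φ (x + ((2 * τ / r) • (x - c) - τ • z)) • fderiv ℝ (mollifier N) z =
      ∫ z, (φ (x + ((2 * τ / r) • (x - c) - τ • z)) - φ x) • fderiv ℝ (mollifier N) z := by
    simp only [sub_smul]
    rw [integral_sub, integral_smul, integral_fderiv_mollifier, smul_zero, sub_zero]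
    · exact integrable_smul_mollifier continuous_fderiv_mollifier
        (hasCompactSupport_mollifier.fderiv (𝕜 := ℝ)) hc
    · exact integrable_smul_mollifier continuous_fderiv_mollifier
        (hasCompactSupport_mollifier.fderiv (𝕜 := ℝ)) continuous_const
  rw [fderiv_ballMollify c hτ hφ, h1, enorm_smul]
  gcongr
  exact enorm_integral_smul_le hL (fun z => fderiv_mollifier_eq_zero) _

variable {c}

/-- The dilation by 1 + 2τ/r pushes a point of the sphere outward by 2τ and the shift τz takes back
at most τ. Points on or outside the sphere thus land outside the ball, with a margin. -/
theorem le_norm_displaced (hr : 0 < r) (hτ : 0 < τ) {x z : Euc N} (hz : ‖z‖ ≤ 1) :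
    (1 + 2 * τ / r) * ‖x - c‖ - τ ≤ ‖x + ((2 * τ / r) • (x - c) - τ • z) - c‖ := by
  have h1 : x + ((2 * τ / r) • (x - c) - τ • z) - c = (1 + 2 * τ / r) • (x - c) - τ • z := by
    rw [add_smul, one_smul]; abel
  rw [h1]
  have h2 := norm_sub_norm_le ((1 + 2 * τ / r) • (x - c)) (τ • z)
  rw [norm_smul, norm_smul, Real.norm_of_nonneg (by positivity), Real.norm_of_nonneg hτ.le] at h2
  have h3 : τ * ‖z‖ ≤ τ := mul_le_of_le_one_right hτ.le hz
  linarith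

theorem ballMollify_eq_zero (hr : 0 < r) (hτ : 0 < τ) {φ : Euc N → ℝ}
    (hφ : ∀ x, r ≤ ‖x - c‖ → φ x = 0) {x : Euc N} (hx : (r + τ) / (1 + 2 * τ / r) ≤ ‖x - c‖) :
    ballMollify c r τ φ x = 0 := by
  rw [ballMollify]
  refine integral_eq_zero_of_ae (Filter.Eventually.of_forall fun z => ?_)
  by_cases hz : z ∈ Metric.closedBall (0 : Euc N) 1
  · have h1 := le_norm_displaced (c := c) hr hτ (x := x) (mem_closedBall_zero_iff.1 hz)
    rw [div_le_iff₀' (by positivity)] at hx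
    simp only [Pi.zero_apply]
    rw [hφ _ (by linarith), zero_mul]
  · simp [mollifier_eq_zero hz]

theorem ballOscillation_eq_zero (hr : 0 < r) (hτ : 0 < τ) {φ : Euc N → ℝ}
    (hφ : ∀ x, r ≤ ‖x - c‖ → φ x = 0) {x : Euc N} (hx : r ≤ ‖x - c‖) :
    ballOscillation c r τ φ x = 0 := by
  rw [ballOscillation, setLIntegral_congr_fun (g := 0) measurableSet_closedBall]
  · simp
  · intro z hz
    have h1 := le_norm_displaced (c := c) hr hτ (x := x) (mem_closedBall_zero_iff.1 hz)
    have h2 : (1 + 2 * τ / r) * r ≤ (1 + 2 * τ / r) * ‖x - c‖ := by gcongr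
    have h3 : (1 + 2 * τ / r) * r = r + 2 * τ := by field_simp
    simp only [Pi.zero_apply]
    rw [hφ _ (by linarith), hφ x hx, sub_zero, enorm_zero]

theorem lintegral_comp_sub_smul (f : Euc N → ℝ≥0∞) (hτ : 0 < τ) (a : Euc N) :
    ∫⁻ z, f (a - τ • z) = ENNReal.ofReal (τ ^ (-(N : ℝ))) * ∫⁻ w, f w := by
  have h1 : ∫⁻ z : Euc N, f (a - τ • z) = ∫⁻ w, f (a - w) ∂(Measure.map (τ • ·) volume) := by
    have he : MeasurableEmbedding fun z : Euc N => τ • z :=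
      (Homeomorph.smulOfNeZero τ hτ.ne').measurableEmbedding
    rw [he.lintegral_map]
  rw [h1, Measure.map_addHaar_smul _ hτ.ne', lintegral_smul_measure,
    lintegral_sub_left_eq_self f a, finrank_euclideanSpace_fin, abs_of_pos (by positivity),
    Real.rpow_neg hτ.le, Real.rpow_natCast, smul_eq_mul]

/-- Outside the ball the oscillation is 0. Inside, the displacement has norm less than 2τ + τ.
Hölder on the unit ball brings the power of its volume, and the change of variable from z to the
displacement, at fixed x, brings τ^{-N}. -/
theorem lintegral_ballOscillation_le {p : ℝ≥0} (hp : 1 ≤ p) (hr : 0 < r) (hτ : 0 < τ)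
    {φ : Euc N → ℝ} (hc : Continuous φ) (hφ : ∀ x, r ≤ ‖x - c‖ → φ x = 0) :
    ∫⁻ x, ballOscillation c r τ φ x ^ (p : ℝ) ≤
      volume (Metric.closedBall (0 : Euc N) 1) ^ ((p : ℝ) - 1) *
        (ENNReal.ofReal (τ ^ (-(N : ℝ))) * ballEnergy p φ (3 * τ)) := by
  have hp1 : (1 : ℝ) ≤ p := by exact_mod_cast hp
  have hp0 : (0 : ℝ) < p := one_pos.trans_le hp1
  set V := volume (Metric.closedBall (0 : Euc N) 1)
  have hVt : V ≠ ∞ := Metric.isBounded_closedBall.measure_lt_top.ne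
  have hpt : ∀ x, ballOscillation c r τ φ x ^ (p : ℝ) ≤ V ^ ((p : ℝ) - 1) *
      (ENNReal.ofReal (τ ^ (-(N : ℝ))) *
        ∫⁻ h in Metric.ball (0 : Euc N) (3 * τ), ‖φ (x + h) - φ x‖ₑ ^ (p : ℝ)) := fun x => by
    rcases le_or_gt r ‖x - c‖ with hx | hx
    · rw [ballOscillation_eq_zero hr hτ hφ hx, ENNReal.zero_rpow_of_pos hp0]
      exact zero_le
    have hcz : Continuous fun z => φ (x + ((2 * τ / r) • (x - c) - τ • z)) - φ x := by fun_prop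
    have h1 := eLpNorm'_le_eLpNorm'_mul_rpow_measure_univ
      (μ := volume.restrict (Metric.closedBall (0 : Euc N) 1)) one_pos hp1
      (f := fun z => φ (x + ((2 * τ / r) • (x - c) - τ • z)) - φ x) hcz.aestronglyMeasurable
    simp only [eLpNorm', ENNReal.rpow_one, div_one, Measure.restrict_apply_univ] at h1
    have h2 : ∫⁻ z in Metric.closedBall (0 : Euc N) 1,
        ‖φ (x + ((2 * τ / r) • (x - c) - τ • z)) - φ x‖ₑ ^ (p : ℝ) ≤
        ENNReal.ofReal (τ ^ (-(N : ℝ))) *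
        ∫⁻ h in Metric.ball (0 : Euc N) (3 * τ), ‖φ (x + h) - φ x‖ₑ ^ (p : ℝ) := by
      rw [← lintegral_indicator measurableSet_ball,
        ← lintegral_comp_sub_smul _ hτ ((2 * τ / r) • (x - c)),
        ← lintegral_indicator measurableSet_closedBall]
      refine lintegral_mono fun z => ?_
      by_cases hz : z ∈ Metric.closedBall (0 : Euc N) 1
      · have hz1 : ‖z‖ ≤ 1 := mem_closedBall_zero_iff.1 hz
        have h3 : (2 * τ / r) • (x - c) - τ • z ∈ Metric.ball (0 : Euc N) (3 * τ) := by
          rw [mem_ball_zero_iff]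
          refine (norm_sub_le _ _).trans_lt ?_
          rw [norm_smul, norm_smul, Real.norm_of_nonneg (by positivity), Real.norm_of_nonneg hτ.le]
          have h4 : 2 * τ / r * ‖x - c‖ < 2 * τ / r * r := by gcongr
          have h5 : 2 * τ / r * r = 2 * τ := by field_simp
          have h6 : τ * ‖z‖ ≤ τ := mul_le_of_le_one_right hτ.le hz1
          linarith
        rw [indicator_of_mem hz, indicator_of_mem h3]
      · rw [indicator_of_notMem hz]
        exact zero_le
    calc ballOscillation c r τ φ x ^ (p : ℝ) ≤
        ((∫⁻ z in Metric.closedBall (0 : Euc N) 1,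
          ‖φ (x + ((2 * τ / r) • (x - c) - τ • z)) - φ x‖ₑ ^ (p : ℝ)) ^ (1 / (p : ℝ)) *
            V ^ (1 - 1 / (p : ℝ))) ^ (p : ℝ) := by
          gcongr
          simpa [ballOscillation, V] using h1
      _ = V ^ ((p : ℝ) - 1) * ∫⁻ z in Metric.closedBall (0 : Euc N) 1,
          ‖φ (x + ((2 * τ / r) • (x - c) - τ • z)) - φ x‖ₑ ^ (p : ℝ) := by
          rw [ENNReal.mul_rpow_of_nonneg _ _ hp0.le, ← ENNReal.rpow_mul, ← ENNReal.rpow_mul,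
            one_div_mul_cancel hp0.ne', ENNReal.rpow_one, sub_mul, one_mul,
            one_div_mul_cancel hp0.ne', mul_comm]
      _ ≤ _ := by gcongr
  refine (lintegral_mono hpt).trans (le_of_eq ?_)
  rw [lintegral_const_mul' _ _ (ENNReal.rpow_ne_top_of_nonneg (by linarith) hVt),
    lintegral_const_mul' _ _ ENNReal.ofReal_ne_top]
  congr 2
  rw [ballEnergy]
  simp only [translationEnergy]
  rw [lintegral_lintegral_swap]
  exact (measurable_translation hc).aemeasurable

end Mollifier

end HomSobolev

namespace HomSobolev

/-! ### On a ball the translation energies dominate the K-functional -/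

section BallUpperBound

variable {N : ℕ} {c : Euc N} {r τ : ℝ}

theorem test_openBall_eq_zero (φ : Test (openBall c r)) {x : Euc N} (hx : r ≤ ‖x - c‖) :
    φ x = 0 := by
  refine test_eq_zero φ fun h => ?_
  have h1 : x ∈ Metric.ball c r := h
  rw [mem_ball_iff_norm] at h1
  linarith

theorem tsupport_ballMollify_subset (hr : 0 < r) (hτ : 0 < τ) {φ : Euc N → ℝ}
    (hφ : ∀ x, r ≤ ‖x - c‖ → φ x = 0) :
    tsupport (ballMollify c r τ φ) ⊆ Metric.closedBall c ((r + τ) / (1 + 2 * τ / r)) := by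
  refine closure_minimal (fun x hx => ?_) Metric.isClosed_closedBall
  rw [mem_closedBall_iff_norm]
  by_contra! h
  exact hx (ballMollify_eq_zero hr hτ hφ h.le)

/-- The function `ballMollify c r τ φ` as a test function on the ball. -/
noncomputable def ballMollifyTest (hr : 0 < r) (hτ : 0 < τ) (φ : Test (openBall c r)) :
    Test (openBall c r) where
  toFun := ballMollify c r τ φ
  contDiff' := contDiff_ballMollify c hτ.ne' φ.continuous
  hasCompactSupport' := HasCompactSupport.of_support_subset_isCompact
    (isCompact_closedBall c ((r + τ) / (1 + 2 * τ / r)))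
    ((subset_tsupport _).trans
      (tsupport_ballMollify_subset hr hτ fun _ hx => test_openBall_eq_zero φ hx))
  tsupport_subset' := by
    refine (tsupport_ballMollify_subset hr hτ fun _ hx => test_openBall_eq_zero φ hx).trans ?_
    refine Metric.closedBall_subset_ball ?_
    -- The support has radius (r + τ)/(1 + 2τ/r), which is less than r because r (1 + 2τ/r) = r +
    -- 2τ.
    rw [div_lt_iff₀ (by positivity)]
    have : r * (1 + 2 * τ / r) = r + 2 * τ := by field_simp
    linarith

variable {p : ℝ≥0} [hp : Fact (1 ≤ p)]

theorem eLpNorm_le_of_enorm_le {F : Type*} [NormedAddCommGroup F] {f : Euc N → F}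
    {g : Euc N → ℝ≥0∞} {A : ℝ≥0∞} (hA : A ≠ ∞) (h : ∀ x, ‖f x‖ₑ ≤ A * g x) :
    eLpNorm f p volume ≤ A * (∫⁻ x, g x ^ (p : ℝ)) ^ (1 / (p : ℝ)) := by
  have hp0 : (0 : ℝ) < p := lt_of_lt_of_le one_pos (by exact_mod_cast hp.out)
  rw [eLpNorm_coe_eq hp.out]
  calc (∫⁻ x, ‖f x‖ₑ ^ (p : ℝ)) ^ (1 / (p : ℝ))
      ≤ (∫⁻ x, A ^ (p : ℝ) * g x ^ (p : ℝ)) ^ (1 / (p : ℝ)) := by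
        gcongr with x
        rw [← ENNReal.mul_rpow_of_nonneg _ _ hp0.le]
        gcongr
        exact h x
    _ = _ := by
        rw [lintegral_const_mul' _ _ (ENNReal.rpow_ne_top_of_nonneg hp0.le hA),
          ENNReal.mul_rpow_of_nonneg _ _ (by positivity), ← ENNReal.rpow_mul,
          mul_one_div_cancel hp0.ne', ENNReal.rpow_one]

theorem enorm_testToLp_rpow (φ : Test (openBall c r)) :
    ‖testToLp (openBall c r) p φ‖ₑ ^ (p : ℝ) = ∫⁻ x in Metric.ball c r, ‖φ x‖ₑ ^ (p : ℝ) := by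
  have hp0 : (0 : ℝ) < p := lt_of_lt_of_le one_pos (by exact_mod_cast hp.out)
  rw [enorm_testToLp, eLpNorm_coe_eq hp.out, ← ENNReal.rpow_mul, one_div_mul_cancel hp0.ne',
    ENNReal.rpow_one]
  refine (setLIntegral_eq_of_support_subset fun x hx => ?_).symm
  by_contra h
  rw [mem_ball_iff_norm, not_lt] at h
  exact hx (by simp [test_openBall_eq_zero φ h, hp0])

/-- A shift by at least the diameter moves the ball off itself, so φ(x + h) = 0 for x in the ball.
-/
theorem enorm_rpow_le_translationEnergy (φ : Test (openBall c r)) {h : Euc N}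
    (hh : 2 * r ≤ ‖h‖) :
    ‖testToLp (openBall c r) p φ‖ₑ ^ (p : ℝ) ≤ translationEnergy p φ h := by
  rw [enorm_testToLp_rpow, translationEnergy]
  refine (setLIntegral_mono' measurableSet_ball fun x hx => ?_).trans (setLIntegral_le_lintegral _ _)
  rw [mem_ball_iff_norm] at hx
  have h1 : r ≤ ‖x + h - c‖ := by
    have h2 := norm_sub_norm_le h (c - x)
    rw [show h - (c - x) = x + h - c by abel, norm_sub_rev c x] at h2
    linarith
  rw [test_openBall_eq_zero φ h1, zero_sub, enorm_neg]

variable [NeZero N]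

/-- The competitor is the mollified φ. The error costs L and, since τ ≤ r gives 1 + 2τ/r ≤ 3, the
gradient costs 3L/τ, both times the L^p norm of the oscillation. At t = 3τ the total is L + 9L. -/
theorem kFunctional_rpow_le_of_lt {L : ℝ≥0} (hL : ∀ z, ‖mollifier N z‖ₑ ≤ L)
    (hL' : ∀ z, ‖fderiv ℝ (mollifier N) z‖ₑ ≤ L) (hr : 0 < r) (hτ : 0 < τ) (hτr : τ ≤ r)
    (φ : Test (openBall c r)) :
    kFunctional (.id ℝ (LpSpace (openBall c r) p)) (oneToLp (isBounded_openBall c r) p) (3 * τ)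
      (testToLp (openBall c r) p φ) ^ (p : ℝ) ≤ (10 * L) ^ (p : ℝ) *
        (volume (Metric.closedBall (0 : Euc N) 1) ^ ((p : ℝ) - 1) *
          (ENNReal.ofReal (τ ^ (-(N : ℝ))) * ballEnergy p φ (3 * τ))) := by
  have hp0 : (0 : ℝ) < p := lt_of_lt_of_le one_pos (by exact_mod_cast hp.out)
  set I := ∫⁻ x, ballOscillation c r τ φ x ^ (p : ℝ) with hI
  have hv : kFunctional (.id ℝ (LpSpace (openBall c r) p)) (oneToLp (isBounded_openBall c r) p)
      (3 * τ) (testToLp (openBall c r) p φ) ≤ 10 * L * I ^ (1 / (p : ℝ)) := by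
    refine (kFunctional_le _ _ _ (testToLp (openBall c r) p (φ - ballMollifyTest hr hτ φ))
      (ofTest _ 1 one_mem_Ioc p (ballMollifyTest hr hτ φ)) ?_).trans ?_
    · rw [toLp_ofTest, map_sub, ContinuousLinearMap.id_apply, sub_add_cancel]
    rw [enorm_testToLp, enorm_ofTest_one]
    have h1 : eLpNorm ⇑(φ - ballMollifyTest hr hτ φ) p volume ≤ L * I ^ (1 / (p : ℝ)) := by
      refine eLpNorm_le_of_enorm_le ENNReal.coe_ne_top fun x => ?_
      have h2 := enorm_ballMollify_sub_le (r := r) (τ := τ) c hL φ.continuous x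
      rw [← enorm_neg, neg_sub] at h2
      exact h2
    have h3 : eLpNorm (fun x => fderiv ℝ (ballMollifyTest hr hτ φ) x) p volume ≤
        ENNReal.ofReal (3 / τ) * L * I ^ (1 / (p : ℝ)) := by
      refine eLpNorm_le_of_enorm_le
        (ENNReal.mul_ne_top ENNReal.ofReal_ne_top ENNReal.coe_ne_top) fun x => ?_
      have h2 := enorm_fderiv_ballMollify_le (r := r) c hL' hτ.ne' φ.continuous x
      refine h2.trans ?_
      rw [mul_assoc, ← ofReal_norm, Real.norm_of_nonneg (by positivity)]
      gcongr
      have : 2 * τ / r ≤ 2 := by rw [div_le_iff₀ hr]; linarith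
      linarith
    calc _ ≤ L * I ^ (1 / (p : ℝ)) +
        ENNReal.ofReal (3 * τ) * (ENNReal.ofReal (3 / τ) * L * I ^ (1 / (p : ℝ))) :=
          add_le_add h1 (by gcongr)
      _ = L * I ^ (1 / (p : ℝ)) + 9 * L * I ^ (1 / (p : ℝ)) := by
          rw [← mul_assoc, ← mul_assoc, ← ENNReal.ofReal_mul (by positivity),
            show 3 * τ * (3 / τ) = 9 by field_simp; norm_num]
          norm_num
      _ = _ := by ring
  calc _ ≤ (10 * L * I ^ (1 / (p : ℝ))) ^ (p : ℝ) := by gcongr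
    _ = (10 * L) ^ (p : ℝ) * I := by
        rw [ENNReal.mul_rpow_of_nonneg _ _ hp0.le, ← ENNReal.rpow_mul,
          one_div_mul_cancel hp0.ne', ENNReal.rpow_one]
    _ ≤ _ := by
        gcongr
        exact lintegral_ballOscillation_le hp.out hr hτ φ.continuous
          fun _ hx => test_openBall_eq_zero φ hx

/-- For large t take K ≤ ‖φ‖_p. A fixed proportion of the shifts of norm less than t exceed the
diameter of the ball, and each of them has energy at least ‖φ‖_p^p. -/
theorem kFunctional_rpow_le_of_le (hr : 0 < r) {t : ℝ} (ht : 3 * r ≤ t)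
    (φ : Test (openBall c r)) :
    kFunctional (.id ℝ (LpSpace (openBall c r) p)) (oneToLp (isBounded_openBall c r) p) t
      (testToLp (openBall c r) p φ) ^ (p : ℝ) ≤
        (volume (Metric.ball (0 : Euc N) (1 / 6)))⁻¹ *
          (ENNReal.ofReal (t ^ (-(N : ℝ))) * ballEnergy p φ t) := by
  have ht0 : 0 < t := by linarith
  obtain ⟨e, he⟩ := exists_unit (N := N)
  set ω := volume (Metric.ball (0 : Euc N) (1 / 6)) with hω
  have hω0 : ω ≠ 0 := (Metric.measure_ball_pos _ _ (by norm_num)).ne'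
  have hωt : ω ≠ ∞ := Metric.isBounded_ball.measure_lt_top.ne
  -- Norms in this ball lie between 2t/3, which is at least 2r as t ≥ 3r, and t.
  have hmem : ∀ h ∈ Metric.ball ((5 / 6 * t) • e) (t * (1 / 6)), 2 * r ≤ ‖h‖ ∧ ‖h‖ < t := by
    intro h hh
    rw [mem_ball_iff_norm] at hh
    have h1 : ‖(5 / 6 * t) • e‖ = 5 / 6 * t := by
      rw [norm_smul, he, mul_one, Real.norm_of_nonneg (by positivity)]
    have h2 := norm_sub_norm_le h ((5 / 6 * t) • e)
    have h3 := norm_sub_norm_le ((5 / 6 * t) • e) h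
    rw [norm_sub_rev] at h3
    constructor <;> linarith
  have hvol : volume (Metric.ball ((5 / 6 * t) • e) (t * (1 / 6))) =
      ENNReal.ofReal (t ^ (N : ℝ)) * ω := by
    rw [Measure.addHaar_ball_mul_of_pos _ _ ht0, finrank_euclideanSpace_fin, Real.rpow_natCast]
  have h1 : ‖testToLp (openBall c r) p φ‖ₑ ^ (p : ℝ) * (ENNReal.ofReal (t ^ (N : ℝ)) * ω) ≤
      ballEnergy p φ t := by
    rw [← hvol, ← setLIntegral_const, ballEnergy]
    refine (setLIntegral_mono' measurableSet_ball fun h hh => ?_).trans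
      (lintegral_mono_set fun h hh => mem_ball_zero_iff.2 (hmem h hh).2)
    exact enorm_rpow_le_translationEnergy φ (hmem h hh).1
  calc _ ≤ ‖testToLp (openBall c r) p φ‖ₑ ^ (p : ℝ) := by
        gcongr
        exact kFunctional_id_le_enorm _ _ _
    _ = ω⁻¹ * (ENNReal.ofReal (t ^ (-(N : ℝ))) *
          (‖testToLp (openBall c r) p φ‖ₑ ^ (p : ℝ) * (ENNReal.ofReal (t ^ (N : ℝ)) * ω))) := by
        have h2 : ENNReal.ofReal (t ^ (-(N : ℝ))) * ENNReal.ofReal (t ^ (N : ℝ)) = 1 := by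
          rw [← ENNReal.ofReal_mul (by positivity), ← Real.rpow_add ht0]
          simp
        calc _ = ‖testToLp (openBall c r) p φ‖ₑ ^ (p : ℝ) * (ω⁻¹ * ω) *
              (ENNReal.ofReal (t ^ (-(N : ℝ))) * ENNReal.ofReal (t ^ (N : ℝ))) := by
              rw [h2, ENNReal.inv_mul_cancel hω0 hωt, mul_one, mul_one]
          _ = _ := by ring
    _ ≤ _ := by gcongr

/-- For t < 3r mollify at scale τ = t/3; for t ≥ 3r use the trivial decomposition. The constant
precedes the ball in the quantifiers. -/
theorem exists_kFunctional_rpow_le (N : ℕ) [NeZero N] (p : ℝ≥0) [hp : Fact (1 ≤ p)] :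
    ∃ C : ℝ≥0, ∀ (c : Euc N) (r : ℝ), 0 < r → ∀ t : ℝ, 0 < t → ∀ φ : Test (openBall c r),
      kFunctional (.id ℝ (LpSpace (openBall c r) p)) (oneToLp (isBounded_openBall c r) p) t
        (testToLp (openBall c r) p φ) ^ (p : ℝ) ≤
          C * (ENNReal.ofReal (t ^ (-(N : ℝ))) * ballEnergy p φ t) := by
  have hp1 : (1 : ℝ) ≤ p := by exact_mod_cast hp.out
  obtain ⟨L, hL, hL'⟩ := exists_mollifier_bound N
  set V := volume (Metric.closedBall (0 : Euc N) 1)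
  have hVt : V ≠ ∞ := Metric.isBounded_closedBall.measure_lt_top.ne
  set ω := volume (Metric.ball (0 : Euc N) (1 / 6))
  have hω0 : ω ≠ 0 := (Metric.measure_ball_pos _ _ (by norm_num)).ne'
  set A : ℝ≥0∞ := (10 * L) ^ (p : ℝ) * (V ^ ((p : ℝ) - 1) * ENNReal.ofReal (3 ^ (N : ℝ))) + ω⁻¹
  have hA : A ≠ ∞ := by
    refine ENNReal.add_ne_top.2 ⟨ENNReal.mul_ne_top (ENNReal.rpow_ne_top_of_nonneg p.coe_nonneg
      (ENNReal.mul_ne_top (by simp) (by simp))) (ENNReal.mul_ne_top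
        (ENNReal.rpow_ne_top_of_nonneg (by linarith) hVt) ENNReal.ofReal_ne_top), by simpa⟩
  refine ⟨A.toNNReal, fun c r hr t ht φ => ?_⟩
  rw [ENNReal.coe_toNNReal hA]
  rcases le_or_gt (3 * r) t with h | h
  · refine (kFunctional_rpow_le_of_le hr h φ).trans ?_
    gcongr
    exact le_add_self
  · have h1 := kFunctional_rpow_le_of_lt (p := p) hL hL' hr (τ := t / 3) (by positivity)
      (by linarith) φ
    rw [mul_div_cancel₀ t three_ne_zero] at h1
    refine h1.trans ?_
    rw [Real.div_rpow ht.le (by norm_num), Real.rpow_neg (by norm_num : (0 : ℝ) ≤ 3), div_inv_eq_mul,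
      mul_comm (t ^ (-(N : ℝ))), ENNReal.ofReal_mul (by positivity)]
    calc _ = (10 * L) ^ (p : ℝ) * (V ^ ((p : ℝ) - 1) * ENNReal.ofReal (3 ^ (N : ℝ))) *
          (ENNReal.ofReal (t ^ (-(N : ℝ))) * ballEnergy p φ t) := by ring
      _ ≤ _ := by
        gcongr
        exact le_self_add

theorem exists_interpENorm_le_gagliardo (N : ℕ) [NeZero N] {s : ℝ} (hs : 0 < s) (p : ℝ≥0)
    [hp : Fact (1 ≤ p)] :
    ∃ C : ℝ≥0, ∀ (c : Euc N) (r : ℝ), 0 < r → ∀ φ : Test (openBall c r),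
      interpENorm (.id ℝ (LpSpace (openBall c r) p)) (oneToLp (isBounded_openBall c r) p) s p
        (testToLp (openBall c r) p φ) ≤ C * gagliardo s p φ := by
  have hp0 : (0 : ℝ) < p := lt_of_lt_of_le one_pos (by exact_mod_cast hp.out)
  obtain ⟨C, hC⟩ := exists_kFunctional_rpow_le N p
  set a : ℝ := (N : ℝ) + s * p with ha
  have ha0 : 0 < a := by positivity
  set A : ℝ≥0∞ := (C / ENNReal.ofReal a) ^ (1 / (p : ℝ))
  have hA : A ≠ ∞ := ENNReal.rpow_ne_top_of_nonneg (by positivity)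
    (ENNReal.div_ne_top ENNReal.coe_ne_top (by simpa using ha0))
  refine ⟨A.toNNReal, fun c r hr φ => ?_⟩
  rw [ENNReal.coe_toNNReal hA]
  have h1 : gagliardo s p φ = (gagliardo s p φ ^ (p : ℝ)) ^ (1 / (p : ℝ)) := by
    rw [← ENNReal.rpow_mul, mul_one_div_cancel hp0.ne', ENNReal.rpow_one]
  rw [h1, ← ENNReal.mul_rpow_of_nonneg _ _ (by positivity), interpENorm]
  refine ENNReal.rpow_le_rpow ?_ (by positivity)
  rw [gagliardo_rpow_eq_lintegral_ballEnergy hs hp.out φ.continuous, ← ha, ← mul_assoc,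
    ENNReal.div_mul_cancel (by simpa using ha0) ENNReal.ofReal_ne_top,
    ← lintegral_const_mul' _ _ ENNReal.coe_ne_top]
  refine setLIntegral_mono' measurableSet_Ioi fun t ht => ?_
  have ht0 : 0 < t := ht
  calc _ ≤ ENNReal.ofReal (t ^ (-(s * p))) *
        (C * (ENNReal.ofReal (t ^ (-(N : ℝ))) * ballEnergy p φ t)) / ENNReal.ofReal t := by
        gcongr
        exact hC c r hr t ht0 φ
    _ = C * (ENNReal.ofReal (t ^ (-(s * p))) * ENNReal.ofReal (t ^ (-(N : ℝ))) *
          ENNReal.ofReal t⁻¹ * ballEnergy p φ t) := by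
        rw [div_eq_mul_inv, ← ENNReal.ofReal_inv_of_pos ht0]
        ring
    _ = _ := by
        rw [← ENNReal.ofReal_mul (by positivity), ← ENNReal.ofReal_mul (by positivity),
          ← Real.rpow_neg_one t, ← Real.rpow_add ht0, ← Real.rpow_add ht0]
        congr 5
        rw [ha]; ring

end BallUpperBound

end HomSobolev

namespace HomSobolev

/-! ### Injectivity of the embeddings -/

section Injectivity

open Filter Topology

variable {N : ℕ} {Ω : Opens (Euc N)} {p : ℝ≥0} [hp : Fact (1 ≤ p)]

theorem opNorm_le_sum_basis (A : Euc N →L[ℝ] ℝ) :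
    ‖A‖ ≤ ∑ i, ‖A (EuclideanSpace.single i 1)‖ := by
  refine A.opNorm_le_bound (by positivity) fun v => ?_
  have hv : v = ∑ i, v i • EuclideanSpace.single i (1 : ℝ) := by
    conv_lhs => rw [← (EuclideanSpace.basisFun (Fin N) ℝ).sum_repr v]
    simp
  conv_lhs => rw [hv, map_sum]
  rw [Finset.sum_mul]
  refine (norm_sum_le _ _).trans (Finset.sum_le_sum fun i _ => ?_)
  rw [map_smul, norm_smul, mul_comm]
  gcongr
  exact PiLp.norm_apply_le v i

/-- Difference quotients with step 1/(n + 1) have L^p norm at most M; Fatou's lemma passes the bound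
to the directional derivative. -/
theorem eLpNorm_fderiv_apply_le (ψ : Test Ω) {M : ℝ≥0∞}
    (hM : ∀ h, translationEnergy p ψ h ^ (1 / (p : ℝ)) ≤ M * ‖h‖ₑ) {e : Euc N} (he : ‖e‖ₑ = 1) :
    eLpNorm (fun x => fderiv ℝ ψ x e) p volume ≤ M := by
  have hd : Differentiable ℝ ψ :=
    (ψ.contDiff.of_le (m := 1) (by simp)).differentiable one_ne_zero
  set f : ℕ → Euc N → ℝ := fun n x => ((n : ℝ) + 1) • (ψ (x + ((n : ℝ) + 1)⁻¹ • e) - ψ x) with hf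
  have hψ := ψ.continuous
  have hlim : Tendsto (fun n : ℕ => ‖(n : ℝ) + 1‖) atTop atTop :=
    tendsto_norm_atTop_atTop.comp
      (tendsto_atTop_add_const_right _ _ tendsto_natCast_atTop_atTop)
  have h1 := Lp.eLpNorm_lim_le_liminf_eLpNorm (p := p) (μ := (volume : Measure (Euc N))) (f := f)
    (fun n => Continuous.aestronglyMeasurable (by fun_prop)) (fun x => fderiv ℝ ψ x e)
    (Eventually.of_forall fun x => (hd x).hasFDerivAt.lim e hlim)
  refine h1.trans ((liminf_le_liminf (Eventually.of_forall fun n => ?_)).trans_eq (liminf_const M))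
  have hn : (0 : ℝ) < (n : ℝ) + 1 := by positivity
  have h2 := hM (((n : ℝ) + 1)⁻¹ • e)
  rw [enorm_smul, he, mul_one, translationEnergy, ← eLpNorm_coe_eq hp.out] at h2
  calc eLpNorm (f n) p volume =
      ‖(n : ℝ) + 1‖ₑ * eLpNorm (fun x => ψ (x + ((n : ℝ) + 1)⁻¹ • e) - ψ x) p volume :=
        eLpNorm_const_smul ((n : ℝ) + 1) (fun x => ψ (x + ((n : ℝ) + 1)⁻¹ • e) - ψ x) p volume
    _ ≤ ‖(n : ℝ) + 1‖ₑ * (M * ‖((n : ℝ) + 1)⁻¹‖ₑ) := by gcongr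
    _ = M := by
        rw [mul_left_comm, ← enorm_mul, mul_inv_cancel₀ hn.ne']
        simp

theorem eLpNorm_fderiv_le (ψ : Test Ω) {M : ℝ≥0∞}
    (hM : ∀ h, translationEnergy p ψ h ^ (1 / (p : ℝ)) ≤ M * ‖h‖ₑ) :
    eLpNorm (fun x => fderiv ℝ ψ x) p volume ≤ N * M := by
  have hc : Continuous (fderiv ℝ ψ) :=
    (ψ.contDiff.of_le (m := 1) (by simp)).continuous_fderiv one_ne_zero
  calc _ ≤ eLpNorm (∑ i, fun x => ‖fderiv ℝ ψ x (EuclideanSpace.single i 1)‖) p volume := by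
        refine eLpNorm_mono fun x => ?_
        rw [Finset.sum_apply]
        exact (opNorm_le_sum_basis _).trans (le_abs_self _)
    _ ≤ ∑ i : Fin N, eLpNorm (fun x => ‖fderiv ℝ ψ x (EuclideanSpace.single i 1)‖) p volume :=
        eLpNorm_sum_le (fun i _ => Continuous.aestronglyMeasurable (by fun_prop))
          (by exact_mod_cast hp.out)
    _ ≤ ∑ i : Fin N, M := by
        gcongr with i
        rw [eLpNorm_norm]
        exact eLpNorm_fderiv_apply_le ψ hM (by rw [← ofReal_norm]; simp)
    _ = N * M := by simp

variable [NeZero N] (hΩ : Bornology.IsBounded (Ω : Set (Euc N)))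

/-- If z maps to 0, then ψ - z has the same image as ψ, so K(t, ψ) ≤ t ‖ψ - z‖. The translation
energies of ψ, and through difference quotients its gradient, are then bounded by 2N ‖ψ - z‖. By
density this estimate holds at ψ = z, which forces z = 0. -/
theorem oneToLp_injective (p : ℝ≥0) [hp : Fact (1 ≤ p)] : Function.Injective (oneToLp hΩ p) := by
  refine (injective_iff_map_eq_zero _).2 fun z hz => ?_
  have key : ∀ ψ : Test Ω, ‖ofTest Ω 1 one_mem_Ioc p ψ‖ₑ ≤
      N * (2 * ‖ofTest Ω 1 one_mem_Ioc p ψ - z‖ₑ) := fun ψ => by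
    rw [enorm_ofTest_one]
    refine eLpNorm_fderiv_le ψ fun h => ?_
    refine (translationEnergy_le_kFunctional hΩ ψ le_rfl).trans ?_
    rw [mul_assoc]
    refine mul_le_mul_right ((kFunctional_id_le_sub _ _ _ (ofTest Ω 1 one_mem_Ioc p ψ - z)).trans
      (le_of_eq ?_)) _
    rw [map_sub, hz, sub_zero, toLp_ofTest, sub_self, enorm_zero, zero_add, ofReal_norm, mul_comm]
  have hcl : IsClosed {y : D0One Ω p | ‖y‖ ≤ N * (2 * ‖y - z‖)} :=
    isClosed_le (by fun_prop) (by fun_prop)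
  have h1 : ‖z‖ ≤ N * (2 * ‖z - z‖) := by
    refine (denseRange_ofTest 1 one_mem_Ioc).induction_on
      (p := fun y : D0One Ω p => ‖y‖ ≤ N * (2 * ‖y - z‖)) z hcl fun ψ => ?_
    have h2 := ENNReal.toReal_mono (by finiteness) (key ψ)
    simpa using h2
  simpa using h1

/-- The fundamental lemma of the calculus of variations; f is integrable because Ω has finite
measure. -/
theorem lpToNegOne_injective {q : ℝ≥0} [Fact (1 ≤ q)] (hq : q.HolderConjugate p) :
    Function.Injective (lpToNegOne hΩ hq) := by
  have : IsFiniteMeasure (volume.restrict (Ω : Set (Euc N))) :=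
    ⟨by rw [Measure.restrict_apply_univ]; exact hΩ.measure_lt_top⟩
  refine (injective_iff_map_eq_zero _).2 fun f hf => ?_
  have hint : IntegrableOn f (Ω : Set (Euc N)) :=
    (Lp.memLp f).integrable (by exact_mod_cast (Fact.out : 1 ≤ q))
  have h1 := Ω.isOpen.ae_eq_zero_of_integral_contDiff_smul_eq_zero
    (μ := (volume : Measure (Euc N))) hint.locallyIntegrableOn fun g hg hgc hgs => by
      set φ : Test Ω := ⟨g, hg, hgc, hgs⟩
      have h2 : lpToNegOne hΩ hq f (ofTest Ω 1 one_mem_Ioc p φ) = 0 := by rw [hf]; rfl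
      rw [lpToDual_apply, toLp_ofTest] at h2
      rw [← setIntegral_eq_integral_of_forall_compl_eq_zero (s := (Ω : Set (Euc N))), ← h2]
      · refine integral_congr_ae ?_
        filter_upwards [MemLp.coeFn_toLp
          ((φ.continuous.memLp_of_hasCompactSupport (p := p) φ.hasCompactSupport).restrict
            (μ := volume) (Ω : Set (Euc N)))] with x hx
        have h3 : testToLp Ω p φ x = φ x := hx
        rw [h3, smul_eq_mul, mul_comm]
        rfl
      · intro x hx
        have h3 : g x = 0 := test_eq_zero φ hx
        rw [h3, zero_smul]
  rw [Lp.eq_zero_iff_ae_eq_zero]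
  exact (ae_restrict_iff' Ω.isOpen.measurableSet).2 h1

end Injectivity

end HomSobolev

namespace RealInterpolation

/-! ### Calculus of equality with equivalent norms -/

section EquivalentNorms

variable {X Y Z W : Type*} [NormedAddCommGroup X] [NormedSpace ℝ X]
  [NormedAddCommGroup Y] [NormedSpace ℝ Y] [NormedAddCommGroup Z] [NormedSpace ℝ Z]
  [AddCommGroup W] [Module ℝ W]

theorem EqWithEquivalentNorms.symm {C : ℝ} {r : X →ₗ[ℝ] W} {r' : Y →ₗ[ℝ] W}
    (h : EqWithEquivalentNorms C r r') : EqWithEquivalentNorms C r' r :=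
  ⟨h.2.1, h.1, h.2.2.1.symm, fun y x hyx => (h.2.2.2 x y hyx.symm).symm⟩

theorem EqWithEquivalentNorms.mono {C C' : ℝ} (hC : C ≤ C') {r : X →ₗ[ℝ] W} {r' : Y →ₗ[ℝ] W}
    (h : EqWithEquivalentNorms C r r') : EqWithEquivalentNorms C' r r' :=
  ⟨h.1, h.2.1, h.2.2.1, fun x y hxy =>
    ⟨(h.2.2.2 x y hxy).1.trans (by gcongr), (h.2.2.2 x y hxy).2.trans (by gcongr)⟩⟩

theorem EqWithEquivalentNorms.trans {C C' : ℝ} (hC : 0 ≤ C) (hC' : 0 ≤ C') {r : X →ₗ[ℝ] W}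
    {r' : Y →ₗ[ℝ] W} {r'' : Z →ₗ[ℝ] W} (h : EqWithEquivalentNorms C r r')
    (h' : EqWithEquivalentNorms C' r' r'') : EqWithEquivalentNorms (C * C') r r'' := by
  refine ⟨h.1, h'.2.1, h.2.2.1.trans h'.2.2.1, fun x z hxz => ?_⟩
  obtain ⟨y, hy⟩ : r x ∈ LinearMap.range r' := h.2.2.1 ▸ LinearMap.mem_range_self r x
  have h1 := h.2.2.2 x y hy.symm
  have h2 := h'.2.2.2 y z (hy.trans hxz)
  constructor
  · calc ‖x‖ ≤ C * (C' * ‖z‖) := h1.1.trans (by gcongr; exact h2.1)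
      _ = _ := by ring
  · calc ‖z‖ ≤ C' * (C * ‖x‖) := h2.2.trans (by gcongr; exact h1.2)
      _ = _ := by ring

theorem eqWithEquivalentNorms_of_equiv {C : ℝ} {r : X →ₗ[ℝ] W} {r' : Y →ₗ[ℝ] W} (T : X ≃ₗ[ℝ] Y)
    (hr' : Function.Injective r') (hT : ∀ x, r' (T x) = r x)
    (hC : ∀ x, ‖T x‖ ≤ C * ‖x‖ ∧ ‖x‖ ≤ C * ‖T x‖) : EqWithEquivalentNorms C r r' := by
  have hr : r = r' ∘ₗ T.toLinearMap := LinearMap.ext fun x => (hT x).symm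
  refine ⟨?_, hr', ?_, fun x y hxy => ?_⟩
  · rw [hr]
    exact hr'.comp T.injective
  · rw [hr, LinearMap.range_comp, LinearEquiv.range, Submodule.map_top]
  · obtain rfl : T x = y := hr' ((hT x).trans hxy)
    exact (hC x).symm

theorem dualRestrict_injective {ι : W →ₗ[ℝ] X} (hι : DenseRange ι) :
    Function.Injective (dualRestrict ι) := fun F G h => by
  refine ContinuousLinearMap.ext fun x => congrFun (hι.equalizer F.continuous G.continuous ?_) x
  exact funext fun w => LinearMap.congr_fun h w

theorem norm_le_of_dualRestrict {ι : W →ₗ[ℝ] X} (hι : DenseRange ι) {F : StrongDual ℝ X} {C : ℝ}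
    (hC : 0 ≤ C) (h : ∀ w, ‖F (ι w)‖ ≤ C * ‖ι w‖) : ‖F‖ ≤ C :=
  F.opNorm_le_bound hC fun x => hι.induction_on (p := fun x => ‖F x‖ ≤ C * ‖x‖) x
    (isClosed_le (by fun_prop) (by fun_prop)) h

theorem exists_dualRestrict_eq {ι : W →ₗ[ℝ] X} (hι : DenseRange ι) {f : W →ₗ[ℝ] ℝ} {C : ℝ}
    (h : ∀ w, ‖f w‖ ≤ C * ‖ι w‖) : ∃ F, dualRestrict ι F = f :=
  ⟨f.extendOfNorm ι, LinearMap.ext fun w => LinearMap.extendOfNorm_eq hι ⟨C, h⟩ w⟩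

/-- Two completions of the same space in equivalent norms have the same dual. -/
theorem eqWithEquivalentNorms_dualRestrict {ι : W →ₗ[ℝ] X} {ι' : W →ₗ[ℝ] Y} (hι : DenseRange ι)
    (hι' : DenseRange ι') {C : ℝ} (hC : 0 ≤ C)
    (h : ∀ w, ‖ι' w‖ ≤ C * ‖ι w‖ ∧ ‖ι w‖ ≤ C * ‖ι' w‖) :
    EqWithEquivalentNorms C (dualRestrict ι) (dualRestrict ι') := by
  have key : ∀ (F : StrongDual ℝ X) (w : W), ‖F (ι w)‖ ≤ C * ‖F‖ * ‖ι' w‖ := fun F w =>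
    calc _ ≤ ‖F‖ * ‖ι w‖ := F.le_opNorm _
      _ ≤ ‖F‖ * (C * ‖ι' w‖) := by gcongr; exact (h w).2
      _ = _ := by ring
  have key' : ∀ (G : StrongDual ℝ Y) (w : W), ‖G (ι' w)‖ ≤ C * ‖G‖ * ‖ι w‖ := fun G w =>
    calc _ ≤ ‖G‖ * ‖ι' w‖ := G.le_opNorm _
      _ ≤ ‖G‖ * (C * ‖ι w‖) := by gcongr; exact (h w).1
      _ = _ := by ring
  refine ⟨dualRestrict_injective hι, dualRestrict_injective hι', le_antisymm ?_ ?_, ?_⟩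
  · rintro _ ⟨F, rfl⟩
    exact exists_dualRestrict_eq hι' (key F)
  · rintro _ ⟨G, rfl⟩
    exact exists_dualRestrict_eq hι (key' G)
  · intro F G hFG
    have hw : ∀ w, F (ι w) = G (ι' w) := fun w => LinearMap.congr_fun hFG w
    refine ⟨norm_le_of_dualRestrict hι (by positivity) fun w => ?_,
      norm_le_of_dualRestrict hι' (by positivity) fun w => ?_⟩
    · rw [hw]; exact key' G w
    · rw [← hw]; exact key F w

/-- Two completions of the same space in equivalent norms, embedded compatibly in a third space,
coincide. -/
theorem eqWithEquivalentNorms_of_denseRange [CompleteSpace X] [CompleteSpace Y] {ι : W →ₗ[ℝ] X}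
    {ι' : W →ₗ[ℝ] Y} (hι : DenseRange ι) (hι' : DenseRange ι') {C : ℝ}
    (h : ∀ w, ‖ι' w‖ ≤ C * ‖ι w‖ ∧ ‖ι w‖ ≤ C * ‖ι' w‖) {r : X →ₗ[ℝ] Z} {r' : Y →ₗ[ℝ] Z}
    (hr : Continuous r) (hr' : Continuous r') (hinj : Function.Injective r')
    (hrr' : ∀ w, r (ι w) = r' (ι' w)) : EqWithEquivalentNorms C r r' := by
  have h1 : ∀ w, ‖ι' (LinearEquiv.refl ℝ W w)‖ ≤ C * ‖ι w‖ := fun w => (h w).1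
  have h2 : ∀ w, ‖ι ((LinearEquiv.refl ℝ W).symm w)‖ ≤ C * ‖ι' w‖ := fun w => (h w).2
  set T := (LinearEquiv.refl ℝ W).extend ι ι' hι ⟨C, h1⟩ hι' ⟨C, h2⟩ with hT
  refine eqWithEquivalentNorms_of_equiv T.toLinearEquiv hinj (fun x => ?_) fun x =>
    ⟨LinearEquiv.norm_extend_le _ _ _ C hι h1 hι' ⟨C, h2⟩ x, ?_⟩
  · refine congrFun (hι.equalizer (hr'.comp T.continuous) hr (funext fun w => ?_)) x
    simp only [Function.comp_apply]
    rw [hT, LinearEquiv.extend_eq, hrr']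
    rfl
  · have h3 := LinearEquiv.norm_extend_symm_le _ _ _ C hι ⟨C, h1⟩ hι' h2 (T x)
    rwa [← hT, T.symm_apply_apply] at h3

end EquivalentNorms

/-! ### Symmetry, density and the duality theorem for interpolation spaces -/

section InterpolationSpaces

variable {X Y Z W : Type*} [NormedAddCommGroup X] [NormedSpace ℝ X]
  [NormedAddCommGroup Y] [NormedSpace ℝ Y] [NormedAddCommGroup Z] [NormedSpace ℝ Z]
  [AddCommGroup W] [Module ℝ W]

theorem interpSubmodule_swap (i : X →L[ℝ] Z) (j : Y →L[ℝ] Z) (α : ℝ) (q : ℝ≥0)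
    [Fact (1 ≤ q)] : interpSubmodule i j α q = interpSubmodule j i (1 - α) q := by
  have h : ∀ z, interpENorm i j α q z = interpENorm j i (1 - α) q z := interpENorm_swap j i α q
  ext z
  change (_ ∧ _) ↔ (_ ∧ _)
  rw [h z, exists_comm]
  simp only [add_comm]

/-- The linear equivalence of `(X, Y)_{α, q}` and `(Y, X)_{1 - α, q}`. -/
def RealInterp.swap (i : X →L[ℝ] Z) (j : Y →L[ℝ] Z) (α : ℝ) (q : ℝ≥0) [Fact (1 ≤ q)] :
    RealInterp i j α q ≃ₗ[ℝ] RealInterp j i (1 - α) q :=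
  LinearEquiv.ofEq _ _ (interpSubmodule_swap i j α q)

theorem RealInterp.subtype_swap (i : X →L[ℝ] Z) (j : Y →L[ℝ] Z) (α : ℝ) (q : ℝ≥0) [Fact (1 ≤ q)]
    (z : RealInterp i j α q) :
    RealInterp.subtype j i (1 - α) q (RealInterp.swap i j α q z) =
      RealInterp.subtype i j α q z := rfl

theorem RealInterp.norm_swap (i : X →L[ℝ] Z) (j : Y →L[ℝ] Z) (α : ℝ) (q : ℝ≥0) [Fact (1 ≤ q)]
    (z : RealInterp i j α q) : ‖RealInterp.swap i j α q z‖ = ‖z‖ := by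
  rw [RealInterp.norm_def, RealInterp.norm_def, RealInterp.subtype_swap, ← interpENorm_swap]

theorem eqWithEquivalentNorms_swap (i : X →L[ℝ] Z) (j : Y →L[ℝ] Z) (α : ℝ) (q : ℝ≥0)
    [Fact (1 ≤ q)] :
    EqWithEquivalentNorms 1 (RealInterp.subtype i j α q) (RealInterp.subtype j i (1 - α) q) :=
  eqWithEquivalentNorms_of_equiv (RealInterp.swap i j α q) (RealInterp.subtype_injective _ _ _ _)
    (RealInterp.subtype_swap i j α q) fun x => by simp [RealInterp.norm_swap]

variable (j : Y →L[ℝ] X) {α : ℝ} {q : ℝ≥0} [hq : Fact (1 ≤ q)]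

/-- A dense subspace of `Y` is mapped by `j : Y → X` to a dense subspace of `(X, Y)_{α, q}`. -/
theorem denseRange_realInterp (hα : α ∈ Ioo (0 : ℝ) 1) {ι : W →ₗ[ℝ] Y} (hι : DenseRange ι)
    {τ : W →ₗ[ℝ] RealInterp (.id ℝ X) j α q}
    (hτ : ∀ w, RealInterp.subtype _ _ _ _ (τ w) = j (ι w)) : DenseRange τ := by
  intro z
  rw [EMetric.mem_closure_iff]
  intro ε hε
  have hε2 : 0 < ε / 2 := ENNReal.half_pos hε.ne'
  obtain ⟨y, hy⟩ := exists_interpENorm_sub_lt j hα hq.out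
    (RealInterp.interpENorm_lt_top _ _ α q z) hε2
  obtain ⟨C, hC⟩ := exists_interpENorm_apply_le j hα hq.out
  have hd : 0 < ε / 2 / (C + 1) := ENNReal.div_pos hε2.ne' (by finiteness)
  obtain ⟨_, ⟨w, rfl⟩, hw⟩ := EMetric.mem_closure_iff.1 (hι y) _ hd
  refine ⟨τ w, mem_range_self w, ?_⟩
  rw [edist_eq_enorm_sub, RealInterp.enorm_def, map_sub, hτ]
  have h1 : interpENorm (.id ℝ X) j α q (j (y - ι w)) ≤ ε / 2 := by
    refine (hC _).trans ?_
    rw [edist_eq_enorm_sub] at hw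
    calc (C : ℝ≥0∞) * ‖y - ι w‖ₑ ≤ (C + 1) * (ε / 2 / (C + 1)) := by
          gcongr
          exact le_self_add
      _ = ε / 2 := ENNReal.mul_div_cancel (by simp) (by finiteness)
  have h2 := interpENorm_add (.id ℝ X) j α q hq.out (RealInterp.subtype _ _ _ _ z - j y)
    (j (y - ι w))
  have h3 : interpENorm (.id ℝ X) j α q (j (y - ι w)) ≠ ∞ :=
    ne_top_of_le_ne_top (by finiteness) (hC _)
  rw [show RealInterp.subtype _ _ _ _ z - j y + j (y - ι w) =
    RealInterp.subtype _ _ _ _ z - j (ι w) by rw [map_sub, sub_add_sub_cancel]] at h2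
  calc _ ≤ _ := h2
    _ < ε / 2 + ε / 2 := ENNReal.add_lt_add_of_lt_of_le h3 hy h1
    _ = ε := ENNReal.add_halves ε

/-- Precomposition with κ turns a functional on the interpolation space into an element of Y*. -/
theorem exists_toRealInterp (hα : α ∈ Ioo (0 : ℝ) 1) :
    ∃ κ : Y →L[ℝ] RealInterp (.id ℝ X) j α q,
      ∀ y, RealInterp.subtype _ _ _ _ (κ y) = j y := by
  obtain ⟨C, hC⟩ := exists_interpENorm_apply_le j hα hq.out
  refine ⟨(RealInterp.ofBoth (.id ℝ X) j α q hα j.toLinearMap .id fun y => rfl).mkContinuous C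
    fun y => ?_, fun y => rfl⟩
  rw [RealInterp.norm_def]
  have h := ENNReal.toReal_mono (by finiteness) (hC y)
  rw [ENNReal.toReal_mul, ENNReal.coe_toReal, toReal_enorm] at h
  exact h

/-- The duality theorem for the real method: `(Y*, X*)_{β, q} = ((X, Y)_{1 - β, p})*`, where `G`
represents `X*` and `Y` is mapped to `X` by `j`. -/
theorem eqWithEquivalentNorms_dual {G : Type*} [NormedAddCommGroup G] [NormedSpace ℝ G]
    {P : G →L[ℝ] StrongDual ℝ X} (hP : ∀ g x, ‖P g x‖ₑ ≤ ‖g‖ₑ * ‖x‖ₑ)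
    (hP' : ∀ ϕ : StrongDual ℝ X, ∃ g, P g = ϕ ∧ ‖g‖ ≤ ‖ϕ‖) {β : ℝ} (hβ : β ∈ Ioo (0 : ℝ) 1)
    {p : ℝ≥0} [Fact (1 ≤ p)] (hqp : q.HolderConjugate p) {ι : W →ₗ[ℝ] Y} (hι : DenseRange ι)
    {τ : W →ₗ[ℝ] RealInterp (.id ℝ X) j (1 - β) p}
    (hτ : ∀ w, RealInterp.subtype _ _ _ _ (τ w) = j (ι w)) :
    EqWithEquivalentNorms (320 + 16 * (dyadicKernelSum (1 - β)).toReal)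
      (dualRestrict ι ∘ₗ RealInterp.subtype (.id ℝ (StrongDual ℝ Y)) (dualEmb j P) β q)
      (dualRestrict τ) := by
  have hβ' : 1 - β ∈ Ioo (0 : ℝ) 1 := ⟨by linarith [hβ.2], by linarith [hβ.1]⟩
  have hτd := denseRange_realInterp j hβ' hι hτ
  obtain ⟨κ, hκ⟩ := exists_toRealInterp (q := p) j hβ'
  have hκτ : ∀ w, κ (ι w) = τ w := fun w =>
    RealInterp.subtype_injective _ _ _ _ ((hκ _).trans (hτ w).symm)
  set S := dyadicKernelSum (1 - β)
  have hS : S ≠ ∞ := dyadicKernelSum_ne_top hβ'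
  have h1 : ∀ (x : RealInterp (.id ℝ (StrongDual ℝ Y)) (dualEmb j P) β q) (w : W),
      ‖RealInterp.subtype _ _ _ _ x (ι w)‖ ≤ 320 * ‖x‖ * ‖τ w‖ := fun x w => by
    have h := enorm_apply_le_interpENorm hP hβ hqp
      (RealInterp.interpENorm_lt_top _ _ _ _ x).ne (ι w)
    rw [← hτ, ← RealInterp.enorm_def, ← RealInterp.enorm_def] at h
    have h' := ENNReal.toReal_mono (by finiteness) h
    simpa [mul_assoc] using h'
  have h2 : ∀ F : StrongDual ℝ (RealInterp (.id ℝ X) j (1 - β) p),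
      interpENorm (.id ℝ (StrongDual ℝ Y)) (dualEmb j P) β q (F.comp κ) ≤ 16 * S * ‖F‖ₑ :=
    fun F => interpENorm_dualEmb_le hP' hβ hqp fun y => by
      rw [← hκ, ← RealInterp.enorm_def]
      exact F.le_opENorm _
  refine ⟨(dualRestrict_injective hι).comp (RealInterp.subtype_injective _ _ _ _),
    dualRestrict_injective hτd, le_antisymm ?_ ?_, fun x F hxF => ⟨?_, ?_⟩⟩
  · rintro _ ⟨x, rfl⟩
    exact exists_dualRestrict_eq hτd (h1 x)
  · rintro _ ⟨F, rfl⟩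
    -- The preimage of F is its restriction to Y, which has finite interpolation norm by the second
    -- half of the duality.
    refine ⟨RealInterp.mk (dualEmb j P) (F.comp κ) ((h2 F).trans_lt (by finiteness)), ?_⟩
    refine LinearMap.ext fun w => ?_
    change F (κ (ι w)) = F (τ w)
    rw [hκτ]
  · have hx : RealInterp.subtype _ _ _ _ x = F.comp κ := by
      refine dualRestrict_injective hι (hxF.trans (LinearMap.ext fun w => ?_))
      change F (τ w) = F (κ (ι w))
      rw [hκτ]
    have h3 := ENNReal.toReal_mono (by finiteness) (h2 F)
    rw [← hx, ← RealInterp.enorm_def] at h3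
    simp only [toReal_enorm, ENNReal.toReal_mul, ENNReal.toReal_ofNat] at h3
    refine h3.trans ?_
    gcongr
    linarith
  · refine norm_le_of_dualRestrict hτd (by positivity) fun w => ?_
    have hw : F (τ w) = RealInterp.subtype _ _ _ _ x (ι w) := (LinearMap.congr_fun hxF w).symm
    rw [hw]
    refine (h1 x w).trans ?_
    gcongr
    have : 0 ≤ S.toReal := ENNReal.toReal_nonneg
    linarith

end InterpolationSpaces

end RealInterpolation

namespace HomSobolev

/-! ### The spaces on balls -/

section Identification

variable {N : ℕ} [NeZero N] {p : ℝ≥0} [hp : Fact (1 ≤ p)]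

theorem subtype_testToInterpLD {Ω : Opens (Euc N)} (hΩ : Bornology.IsBounded (Ω : Set (Euc N)))
    {α : ℝ} (hα : α ∈ Ioo (0 : ℝ) 1) (φ : Test Ω) :
    RealInterp.subtype _ _ _ _ (testToInterpLD hΩ hα p φ) =
      oneToLp hΩ p (ofTest Ω 1 one_mem_Ioc p φ) :=
  (toLp_ofTest Ω 1 one_mem_Ioc p hΩ φ).symm

theorem denseRange_testToInterpLD {Ω : Opens (Euc N)}
    (hΩ : Bornology.IsBounded (Ω : Set (Euc N))) {α : ℝ} (hα : α ∈ Ioo (0 : ℝ) 1) :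
    DenseRange (testToInterpLD hΩ hα p) :=
  denseRange_realInterp (oneToLp hΩ p) hα (denseRange_ofTest 1 one_mem_Ioc)
    (subtype_testToInterpLD hΩ hα)

theorem swap_testToInterpDL {Ω : Opens (Euc N)} (hΩ : Bornology.IsBounded (Ω : Set (Euc N)))
    {α : ℝ} (hα : α ∈ Ioo (0 : ℝ) 1) (φ : Test Ω) :
    RealInterp.swap _ _ _ _ (testToInterpDL hΩ hα p φ) =
      testToInterpLD hΩ (one_sub_mem_Ioo hα) p φ :=
  RealInterp.subtype_injective _ _ _ _ (toLp_ofTest Ω 1 one_mem_Ioc p hΩ φ)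

theorem eqWithEquivalentNorms_interpDLDualAct {Ω : Opens (Euc N)}
    (hΩ : Bornology.IsBounded (Ω : Set (Euc N))) {α : ℝ} (hα : α ∈ Ioo (0 : ℝ) 1) :
    EqWithEquivalentNorms 1 (interpDLDualAct hΩ hα p)
      (interpLDDualAct hΩ (one_sub_mem_Ioo hα) p) := by
  set T : InterpDL hΩ α p ≃ₗᵢ[ℝ] InterpLD hΩ (1 - α) p :=
    ⟨RealInterp.swap _ _ _ _, RealInterp.norm_swap _ _ _ _⟩
  have hT : ∀ φ, T (testToInterpDL hΩ hα p φ) = testToInterpLD hΩ (one_sub_mem_Ioo hα) p φ :=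
    swap_testToInterpDL hΩ hα
  have hd := denseRange_testToInterpLD (p := p) hΩ (one_sub_mem_Ioo hα)
  have hd' : DenseRange (testToInterpDL hΩ hα p) := by
    refine (T.symm.surjective.denseRange.comp hd T.symm.continuous).mono ?_
    rintro _ ⟨φ, rfl⟩
    exact ⟨φ, by rw [Function.comp_apply, ← hT, T.symm_apply_apply]⟩
  exact eqWithEquivalentNorms_dualRestrict hd' hd zero_le_one fun φ => by
    rw [← hT, T.norm_map, one_mul]; exact ⟨le_rfl, le_rfl⟩

/-- The two comparisons of K with the translation energies, integrated in t. Only one of them uses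
that the domain is a ball, and both constants are uniform. -/
theorem exists_norm_testToInterpLD_le (N : ℕ) [NeZero N] (p : ℝ≥0) [hp : Fact (1 ≤ p)] {s : ℝ}
    (hs : s ∈ Ioo (0 : ℝ) 1) :
    ∃ C : ℝ, 0 ≤ C ∧ ∀ (c : Euc N) (r : ℝ), 0 < r → ∀ φ : Test (openBall c r),
      ‖testToInterpLD (isBounded_openBall c r) hs p φ‖ ≤
          C * ‖ofTest (openBall c r) s (Ioo_subset_Ioc_self hs) p φ‖ ∧
        ‖ofTest (openBall c r) s (Ioo_subset_Ioc_self hs) p φ‖ ≤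
          C * ‖testToInterpLD (isBounded_openBall c r) hs p φ‖ := by
  obtain ⟨C₁, h1⟩ := exists_interpENorm_le_gagliardo N hs.1 p
  obtain ⟨C₂, h2⟩ := exists_gagliardo_le_interpENorm N hs.1 p
  refine ⟨C₁ + C₂, by positivity, fun c r hr φ => ?_⟩
  have hD : ‖ofTest (openBall c r) s (Ioo_subset_Ioc_self hs) p φ‖ₑ = gagliardo s p φ := by
    rw [enorm_ofTest, homENorm, if_neg hs.2.ne]
  have hI : ‖testToInterpLD (isBounded_openBall c r) hs p φ‖ₑ =
      interpENorm (.id ℝ (LpSpace (openBall c r) p)) (oneToLp (isBounded_openBall c r) p) s p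
        (testToLp (openBall c r) p φ) := RealInterp.enorm_def _ _ _
  have h3 := h1 c r hr φ
  have h4 := h2 (openBall c r) (isBounded_openBall c r) φ
  rw [← hD, ← hI] at h3 h4
  have h5 := ENNReal.toReal_mono (by finiteness) h3
  have h6 := ENNReal.toReal_mono (by finiteness) h4
  simp only [toReal_enorm, ENNReal.toReal_mul, ENNReal.coe_toReal] at h5 h6
  constructor
  · refine h5.trans ?_
    gcongr
    simp
  · refine h6.trans ?_
    gcongr
    simp

/-- If the interpolation norm and the homogeneous norm of order `s` are equivalent on test
functions, then `(L^p(Ω), D_0^{1,p}(Ω))_{s,p} = D_0^{s,p}(Ω)`. -/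
theorem eqWithEquivalentNorms_interpLD {Ω : Opens (Euc N)}
    (hΩ : Bornology.IsBounded (Ω : Set (Euc N))) {s : ℝ} (hs : s ∈ Ioo (0 : ℝ) 1) {C : ℝ}
    (hC : ∀ φ : Test Ω, ‖testToInterpLD hΩ hs p φ‖ ≤
        C * ‖ofTest Ω s (Ioo_subset_Ioc_self hs) p φ‖ ∧
      ‖ofTest Ω s (Ioo_subset_Ioc_self hs) p φ‖ ≤ C * ‖testToInterpLD hΩ hs p φ‖) :
    EqWithEquivalentNorms C
      (RealInterp.subtype _ _ _ _ : InterpLD hΩ s p →ₗ[ℝ] LpSpace Ω p)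
      (toLp Ω s (Ioo_subset_Ioc_self hs) p hΩ).toLinearMap := by
  have hcomp : CompleteSpace (InterpLD hΩ s p) :=
    RealInterp.completeSpace (oneToLp hΩ p) (Ioo_subset_Icc_self hs)
  obtain ⟨C', hC'⟩ := exists_enorm_le_interpENorm (oneToLp hΩ p) (q := p)
    (Ioo_subset_Icc_self hs) hp.out
  have hσ : Continuous (RealInterp.subtype _ _ _ _ : InterpLD hΩ s p →ₗ[ℝ] LpSpace Ω p) := by
    refine LipschitzWith.continuous (K := C') fun z w => ?_
    rw [edist_eq_enorm_sub, edist_eq_enorm_sub, ← map_sub, RealInterp.enorm_def]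
    exact hC' _
  exact (eqWithEquivalentNorms_of_denseRange (denseRange_ofTest s (Ioo_subset_Ioc_self hs))
    (denseRange_testToInterpLD hΩ hs) hC (ContinuousLinearMap.continuous _) hσ
    (RealInterp.subtype_injective _ _ _ _)
    (toLp_ofTest Ω s (Ioo_subset_Ioc_self hs) p hΩ)).symm

/-- The abstract duality with X = L^p, Y = D_0^{1,p}, G = L^q and P the integral pairing; `dualEmb`
then unfolds to the embedding of L^q in D^{-1,q}. The constant depends on β alone and Ω is any
bounded open set. -/
theorem eqWithEquivalentNorms_interpNegAct {Ω : Opens (Euc N)}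
    (hΩ : Bornology.IsBounded (Ω : Set (Euc N))) {β : ℝ} (hβ : β ∈ Ioo (0 : ℝ) 1)
    {q : ℝ≥0} [Fact (1 ≤ q)] (hq : q.HolderConjugate p) :
    EqWithEquivalentNorms (320 + 16 * (dyadicKernelSum (1 - β)).toReal)
      (interpNegAct hΩ β hq) (interpLDDualAct hΩ (one_sub_mem_Ioo hβ) p) := by
  have : IsFiniteMeasure (volume.restrict (Ω : Set (Euc N))) :=
    ⟨by rw [Measure.restrict_apply_univ]; exact hΩ.measure_lt_top⟩
  have : ENNReal.HolderConjugate (q : ℝ≥0∞) (p : ℝ≥0∞) := hq.coe_ennreal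
  exact eqWithEquivalentNorms_dual (oneToLp hΩ p) (LpDuality.enorm_lpPairing_le hq)
    (fun Φ => LpDuality.exists_lpPairing_eq Φ hq) hβ hq (denseRange_ofTest 1 one_mem_Ioc)
    (subtype_testToInterpLD hΩ (one_sub_mem_Ioo hβ))

end Identification

end HomSobolev

theorem lemmaA (N : ℕ) [NeZero N] (β : ℝ) (hβ : β ∈ Ioo (0 : ℝ) 1)
    (q q' : ℝ≥0) [Fact (1 ≤ q)] [Fact (1 ≤ q')] (hq : q.HolderConjugate q') :
    ∃ C : ℝ, 0 < C ∧ ∀ (c : Euc N) (r : ℝ), 0 < r →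
      -- the two couples are compatible
      IsCompatibleCouple (ContinuousLinearMap.id ℝ (StrongDual ℝ (D0One (openBall c r) q')))
        (lpToNegOne (isBounded_openBall c r) hq) ∧
      IsCompatibleCouple (ContinuousLinearMap.id ℝ (LpSpace (openBall c r) q'))
        (oneToLp (isBounded_openBall c r) q') ∧
      -- `(D_0^{1,q'}, L^{q'})_{β,q'} = (L^{q'}, D_0^{1,q'})_{1-β,q'}` in `L^{q'}(B)`
      EqWithEquivalentNorms C
        (RealInterp.subtype _ _ _ _ :
          InterpDL (isBounded_openBall c r) β q' →ₗ[ℝ] LpSpace (openBall c r) q')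
        (RealInterp.subtype _ _ _ _ :
          InterpLD (isBounded_openBall c r) (1 - β) q' →ₗ[ℝ] LpSpace (openBall c r) q') ∧
      -- `(L^{q'}, D_0^{1,q'})_{1-β,q'} = D_0^{1-β,q'}` in `L^{q'}(B)`
      EqWithEquivalentNorms C
        (RealInterp.subtype _ _ _ _ :
          InterpLD (isBounded_openBall c r) (1 - β) q' →ₗ[ℝ] LpSpace (openBall c r) q')
        (toLp (openBall c r) (1 - β) (one_sub_mem_Ioc hβ) q'
          (isBounded_openBall c r)).toLinearMap ∧
      -- `(D^{-1,q}, L^q)_{β,q} = ((D_0^{1,q'}, L^{q'})_{β,q'})^*`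
      EqWithEquivalentNorms C
        (interpNegAct (isBounded_openBall c r) β hq)
        (interpDLDualAct (isBounded_openBall c r) hβ q') ∧
      -- `((D_0^{1,q'}, L^{q'})_{β,q'})^* = ((L^{q'}, D_0^{1,q'})_{1-β,q'})^*`
      EqWithEquivalentNorms C
        (interpDLDualAct (isBounded_openBall c r) hβ q')
        (interpLDDualAct (isBounded_openBall c r) (one_sub_mem_Ioo hβ) q') ∧
      -- `((L^{q'}, D_0^{1,q'})_{1-β,q'})^* = (D_0^{1-β,q'})^* = D^{β-1,q}`
      EqWithEquivalentNorms C
        (interpLDDualAct (isBounded_openBall c r) (one_sub_mem_Ioo hβ) q')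
        (d0DualAct (openBall c r) (1 - β) (one_sub_mem_Ioc hβ) q') ∧
      -- `(D^{-1,q}, L^q)_{β,q} = D^{β-1,q}`
      EqWithEquivalentNorms C
        (interpNegAct (isBounded_openBall c r) β hq)
        (d0DualAct (openBall c r) (1 - β) (one_sub_mem_Ioc hβ) q') := by
  obtain ⟨C₁, hC₁, h₁⟩ := exists_norm_testToInterpLD_le N q' (one_sub_mem_Ioo hβ)
  set C₂ : ℝ := 320 + 16 * (dyadicKernelSum (1 - β)).toReal
  have hC₂ : 1 ≤ C₂ := by
    have : 0 ≤ (dyadicKernelSum (1 - β)).toReal := ENNReal.toReal_nonneg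
    change 1 ≤ 320 + 16 * (dyadicKernelSum (1 - β)).toReal
    linarith
  -- One constant for all the identities: as C₂ ≥ 1, it dominates 1, C₁, C₂ and the product C₂ C₁ of
  -- the last, composed identity.
  refine ⟨C₂ * (C₁ + 1), by positivity, fun c r hr => ?_⟩
  have hle₁ : C₁ ≤ C₂ * (C₁ + 1) := by nlinarith
  have hle₂ : C₂ ≤ C₂ * (C₁ + 1) := by nlinarith
  have hle₃ : 1 ≤ C₂ * (C₁ + 1) := by nlinarith
  have hB := isBounded_openBall c r
  have hLD := eqWithEquivalentNorms_interpLD hB (one_sub_mem_Ioo hβ) (h₁ c r hr)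
  have hdual := eqWithEquivalentNorms_interpDLDualAct (p := q') hB hβ
  have hneg := eqWithEquivalentNorms_interpNegAct hB hβ hq
  have hD : EqWithEquivalentNorms C₁ (interpLDDualAct hB (one_sub_mem_Ioo hβ) q')
      (d0DualAct (openBall c r) (1 - β) (one_sub_mem_Ioc hβ) q') :=
    eqWithEquivalentNorms_dualRestrict (denseRange_testToInterpLD hB (one_sub_mem_Ioo hβ))
      (denseRange_ofTest _ _) hC₁ fun φ => (h₁ c r hr φ).symm
  refine ⟨⟨Function.injective_id, lpToNegOne_injective hB hq⟩,
    ⟨Function.injective_id, oneToLp_injective hB q'⟩,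
    (eqWithEquivalentNorms_swap _ _ _ _).mono hle₃, hLD.mono hle₁,
    (hneg.trans (by positivity) zero_le_one hdual.symm).mono (by rwa [mul_one]),
    hdual.mono hle₃, hD.mono hle₁,
    (hneg.trans (by positivity) hC₁ hD).mono (by gcongr; linarith)⟩
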